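/- Let $L,B,K_d,\zeta,\eta,\rho_o,V_{eff},S_{eff}>0$ be constants and put $$\mathcal P(N,l)=\frac{\eta\rho_oV_{eff}N(L-l)}{B\rho_o+K_d(L-l)},\qquad \mathcal F(l,N,\varphi)=\frac{\frac{K_d}{\eta}\mathcal P(N,l)-\rho_oV_{eff}N\varphi}{\rho_oS_{eff}(1-\varphi)} .$$ Let $(l_e,N_e,f_{p_e})$ be an equilibrium: $l_e\in(0,L)$, $f_{p_e}\in(0,1)$, $N_e>0$ and $\mathcal F(l_e,N_e,f_{p_e})=0$; let $\Delta P_e=\mathcal P(N_e,l_e)$ and $F_{in_e}=\rho_oV_{eff}N_ef_{p_e}$. Let $(a_1,a_2,a_3)=(\partial_l\mathcal F,\partial_N\mathcal F,\partial_{\varphi}\mathcal F)(l_e,N_e,f_{p_e})$, and let $b_1=\partial_l\mathcal P$, $b_2=\partial_N\mathcal P$ at $N=N_e$, $l=l_e$. For $k_1,k_2\in\mathbb R$ consider the closed-loop system for the interface position $l(t)$ and the filling ratio $f_p(t,x)$, $x\in(0,1)$, $$\dot l(t)=\mathcal F(l(t),N(t),f_p(t,1)),\qquad l(0)=l^0,$$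 $$\partial_tf_p+\alpha_p\,\partial_xf_p=0,\qquad \alpha_p(t,x)=\frac{\zeta N(t)-x\,\mathcal F(l(t),N(t),f_p(t,1))}{l(t)},\qquad f_p(0,x)=f_p^0(x),\qquad f_p(t,0)=\frac{F_{in}(t)}{\rho_oV_{eff}N(t)},$$ with the feedback $$N(t)-N_e=k_1(\Delta P(t)-\Delta P_e),\qquad F_{in}(t)-F_{in_e}=k_2(\Delta P(t)-\Delta P_e),\qquad \Delta P(t)=\mathcal P(N(t),l(t)).$$ A solution on $[0,T)$, $0<T\le\infty$, is a pair $(l,f_p)\in W^{1,\infty}([0,T))\times C^0([0,T);H^2(0,1))$ satisfying these equations for some inputs $N,F_{in}$, with $l(t)\in(0,L)$, $N(t)\neq0$ and $f_p(t,1)\ne1$ for all $t\in[0,T)$. The compatibility conditions at $(t,x)=(0,0)$ are $$f_p^0(0)=\frac{F_{in}(0)}{\rho_oV_{eff}N(0)},\qquad \frac{\dot F_{in}(0)N(0)-F_{in}(0)\dot N(0)}{\rho_oV_{eff}N(0)^2}+\frac{\zeta N(0)}{l^0}\,(f_p^0)'(0)=0,$$ where $N(0),F_{in}(0)$ are determined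 by the feedback with $l(0)=l^0$, and $\dot N(0),\dot F_{in}(0)$ by differentiating the feedback and the relation $\Delta P=\mathcal P(N,l)$ in time, with $\dot l(0)=\mathcal F(l^0,N(0),f_p^0(1))$. **Theorem.** Suppose that $k_1,k_2\in\mathbb R$ satisfy $1-k_1b_2\neq0$ and $$a_1+\frac{k_1a_2b_1}{1-k_1b_2}<0,\qquad \left|\frac{a_3b_1(k_2-f_{p_e}\rho_oV_{eff}k_1)}{\rho_oV_{eff}N_e(1-k_1b_2)}\right|<\left|a_1+\frac{k_1a_2b_1}{1-k_1b_2}\right| .$$ Then there are constants $\varepsilon,M,\omega>0$ such that for all $l^0\in\mathbb R$ and $f_p^0\in H^2(0,1)$ with $|l^0-l_e|^2+\|f_p^0-f_{p_e}\|^2_{H^2(0,1)}\le\varepsilon$ which satisfy the compatibility conditions, the closed-loop system has a solution $(l,f_p)$ on $[0,\infty)$, every solution on an interval $[0,T)$ with these data coincides with it on $[0,T)$, and $$|l(t)-l_e|^2+\|f_p(t,\cdot)-f_{p_e}\|^2_{H^2(0,1)}\le Me^{-\omega t}\Big(|l^0-l_e|^2+\|f_p^0-f_{p_e}\|^2_{H^2(0,1)}\Big)\qquad\text{for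 all }t\ge0 .$$ -/

import Mathlib

noncomputable section

open Set Filter Topology MeasureTheory
open scoped ContDiff NNReal

namespace Extruder

/-! ### The Sobolev space `H²(0,1)` -/

/-- `v` is the weak derivative of `u` on `(0,1)`. -/
def HasWeakDeriv (u v : ℝ → ℝ) : Prop :=
  ∀ φ : ℝ → ℝ, ContDiff ℝ ∞ φ → HasCompactSupport φ → tsupport φ ⊆ Ioo 0 1 →
    ∫ x in (0 : ℝ)..1, u x * deriv φ x = -∫ x in (0 : ℝ)..1, v x * φ x

/-- An element of `H²(0,1)`: `val` is its continuous representative on `[0,1]`, `d1` the continuous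
representative of its weak derivative, `d2` its second weak derivative, in `L²(0,1)`.
Point values at `0` and `1` are those of the continuous representatives. -/
structure H2 where
  val : ℝ → ℝ
  d1 : ℝ → ℝ
  d2 : ℝ → ℝ
  continuousOn_val : ContinuousOn val (Icc 0 1)
  continuousOn_d1 : ContinuousOn d1 (Icc 0 1)
  memLp_d2 : MemLp d2 2 (volume.restrict (Ioo (0 : ℝ) 1))
  weakDeriv_val : HasWeakDeriv val d1
  weakDeriv_d1 : HasWeakDeriv d1 d2

theorem hasWeakDeriv_const (c : ℝ) : HasWeakDeriv (fun _ => c) (fun _ => 0) := by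
  intro φ hφ _ hs
  have h0 : φ 0 = 0 := image_eq_zero_of_notMem_tsupport fun h => lt_irrefl _ (hs h).1
  have h1 : φ 1 = 0 := image_eq_zero_of_notMem_tsupport fun h => lt_irrefl _ (hs h).2
  have hd : ∫ x in (0 : ℝ)..1, deriv φ x = φ 1 - φ 0 :=
    intervalIntegral.integral_deriv_eq_sub
      (fun x _ => (hφ.differentiable (by simp)) x)
      ((hφ.continuous_deriv (by simp)).intervalIntegrable _ _)
  simp [hd, h0, h1]

/-- The constant function `c` as an element of `H²(0,1)`. -/
def H2.const (c : ℝ) : H2 where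
  val := fun _ => c
  d1 := fun _ => 0
  d2 := fun _ => 0
  continuousOn_val := continuousOn_const
  continuousOn_d1 := continuousOn_const
  memLp_d2 := MemLp.zero
  weakDeriv_val := hasWeakDeriv_const c
  weakDeriv_d1 := hasWeakDeriv_const 0

/-- `‖u - v‖²` in `H²(0,1)`. -/
def H2.distSq (u v : H2) : ℝ :=
  (∫ x in (0 : ℝ)..1, (u.val x - v.val x) ^ 2) + (∫ x in (0 : ℝ)..1, (u.d1 x - v.d1 x) ^ 2)
    + ∫ x in (0 : ℝ)..1, (u.d2 x - v.d2 x) ^ 2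

/-- The time interval `[0,T)`, where `T = ∞` is allowed. -/
def timeInterval (T : EReal) : Set ℝ := {t | 0 ≤ t ∧ (t : EReal) < T}

/-- `f ∈ C⁰(I; H²(0,1))`. -/
def ContinuousInH2 (I : Set ℝ) (f : ℝ → H2) : Prop :=
  ∀ t₀ ∈ I, Tendsto (fun t => (f t).distSq (f t₀)) (𝓝[I] t₀) (𝓝 0)

/-- `l ∈ W^{1,∞}(I)` for an interval `I`: bounded and Lipschitz. -/
def MemW1Infty (I : Set ℝ) (l : ℝ → ℝ) : Prop :=
  (∃ C : ℝ, ∀ t ∈ I, |l t| ≤ C) ∧ ∃ K : ℝ≥0, LipschitzOnWith K l I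

/-! ### The extruder model -/

/-- The positive physical constants of the extruder: length `L`, geometric parameter `B`, die
conductance `Kd`, screw pitch `ζ`, viscosity `η`, melt density `ρ`, effective volume `V` and
effective section `S`. -/
structure Params where
  L : ℝ
  B : ℝ
  Kd : ℝ
  ζ : ℝ
  η : ℝ
  ρ : ℝ
  V : ℝ
  S : ℝ
  L_pos : 0 < L
  B_pos : 0 < B
  Kd_pos : 0 < Kd
  ζ_pos : 0 < ζ
  η_pos : 0 < η
  ρ_pos : 0 < ρ
  V_pos : 0 < V
  S_pos : 0 < S

/-- The pressure difference `ΔP = 𝒫(N, l)`. -/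
def Params.press (p : Params) (N l : ℝ) : ℝ :=
  p.η * p.ρ * p.V * N * (p.L - l) / (p.B * p.ρ + p.Kd * (p.L - l))

/-- The interface velocity `ℱ(l, N, φ)`, where `φ` is the filling ratio at `x = 1`. -/
def Params.vel (p : Params) (l N φ : ℝ) : ℝ :=
  (p.Kd / p.η * p.press N l - p.ρ * p.V * N * φ) / (p.ρ * p.S * (1 - φ))

/-- The transport speed `α_p` at position `x`. -/
def Params.speed (p : Params) (l N φ x : ℝ) : ℝ :=
  (p.ζ * N - x * p.vel l N φ) / l

/-- Equilibrium values of the interface position, the screw speed and the filling ratio. -/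
structure Equilibrium (p : Params) where
  l : ℝ
  N : ℝ
  f : ℝ
  l_mem : l ∈ Ioo 0 p.L
  f_mem : f ∈ Ioo (0 : ℝ) 1
  N_pos : 0 < N
  vel_eq_zero : p.vel l N f = 0

namespace Equilibrium

variable {p : Params} (e : Equilibrium p)

/-- The equilibrium pressure difference `ΔP_e`. -/
def press : ℝ := p.press e.N e.l

/-- The equilibrium inlet flow rate `F_{in,e}`. -/
def Fi : ℝ := p.ρ * p.V * e.N * e.f

def a₁ : ℝ := deriv (fun l => p.vel l e.N e.f) e.l
def a₂ : ℝ := deriv (fun N => p.vel e.l N e.f) e.N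
def a₃ : ℝ := deriv (fun φ => p.vel e.l e.N φ) e.f
def b₁ : ℝ := deriv (fun l => p.press e.N l) e.l
def b₂ : ℝ := deriv (fun N => p.press N e.l) e.N

/-- The feedback law `N - N_e = k₁ (ΔP - ΔP_e)`, `F_in - F_{in,e} = k₂ (ΔP - ΔP_e)`
with `ΔP = 𝒫(N, l)`. -/
def Feedback (k₁ k₂ l N Fi : ℝ) : Prop :=
  N - e.N = k₁ * (p.press N l - e.press) ∧ Fi - e.Fi = k₂ * (p.press N l - e.press)

/-- The compatibility conditions at `(t,x) = (0,0)`. Here `N` and `Fi` are the initial inputs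
given by the feedback, and `dl`, `dP`, `dN`, `dFi` the initial time derivatives of `l`, `ΔP`, `N`,
`F_in`, obtained from the interface equation and by differentiating the pressure relation and the
feedback law. -/
def Compatible (k₁ k₂ l₀ : ℝ) (f₀ : H2) : Prop :=
  ∃ N Fi dl dP dN dFi : ℝ,
    e.Feedback k₁ k₂ l₀ N Fi ∧
    dl = p.vel l₀ N (f₀.val 1) ∧
    dP = deriv (fun l => p.press N l) l₀ * dl + deriv (fun n => p.press n l₀) N * dN ∧
    dN = k₁ * dP ∧
    dFi = k₂ * dP ∧
    f₀.val 0 = Fi / (p.ρ * p.V * N) ∧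
    (dFi * N - Fi * dN) / (p.ρ * p.V * N ^ 2) + p.ζ * N / l₀ * f₀.d1 0 = 0

/-- `(l, f)`, with inputs `N` and `Fi`, solves the closed-loop system on `[0,T)` with initial data
`(l₀, f₀)`. With this regularity both equations hold pointwise. The condition `admissible` makes all
denominators in the system nonzero. -/
structure IsSolution (k₁ k₂ l₀ : ℝ) (f₀ : H2) (T : EReal)
    (l : ℝ → ℝ) (f : ℝ → H2) (N Fi : ℝ → ℝ) : Prop where
  regular_l : MemW1Infty (timeInterval T) l
  regular_f : ContinuousInH2 (timeInterval T) f
  admissible : ∀ t ∈ timeInterval T, l t ∈ Ioo 0 p.L ∧ N t ≠ 0 ∧ (f t).val 1 ≠ 1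
  feedback : ∀ t ∈ timeInterval T, e.Feedback k₁ k₂ (l t) (N t) (Fi t)
  initial_l : l 0 = l₀
  interface : ∀ t ∈ timeInterval T, 0 < t →
    HasDerivAt l (p.vel (l t) (N t) ((f t).val 1)) t
  initial_f : ∀ x ∈ Ioo (0 : ℝ) 1, (f 0).val x = f₀.val x
  transport : ∀ t ∈ timeInterval T, 0 < t → ∀ x ∈ Ioo (0 : ℝ) 1,
    ∃ ft : ℝ, HasDerivAt (fun s => (f s).val x) ft t ∧
      ft + p.speed (l t) (N t) ((f t).val 1) x * (f t).d1 x = 0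
  boundary : ∀ t ∈ timeInterval T, 0 < t → (f t).val 0 = Fi t / (p.ρ * p.V * N t)

/-- `|l - l_e|² + ‖f - f_e‖²` with the norm of `H²(0,1)`. -/
def deviation (l : ℝ) (f : H2) : ℝ := |l - e.l| ^ 2 + f.distSq (H2.const e.f)

end Equilibrium

end Extruder

end

noncomputable section

open Set Filter Topology MeasureTheory
open scoped ContDiff NNReal

namespace Extruder

/-! ### Weak derivatives and the fundamental theorem of calculus -/

/-! The closed loop reduces to a scalar delay equation. In the coordinate `y = x l` the filling
ratio is transported at speed `ζ N`, so with the transported length `s = ∫ ζ N dt` as new time the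
transport equation is solved by `f(t,x) = G(x l - s)` for a function `G` of one variable. On `[0,
l₀]` it is the initial datum `f₀(ξ / l₀)`, and on the negative axis it records the inlet values. The
pressure is linear in `N`. Hence the interface velocity is `ζ N` times a function `rate` of `(l, φ)`
(`Params.vel_eq`), the feedback can be solved for `N` (`feedback_iff`), and the inlet filling ratio
depends on `l` alone (`inflow_div`). What remains is `dl/ds = rate(l, G(l(s) - s))` with `G(-s) =
inlet(l(s))`, an equation with state-dependent delay.

The velocity is proportional to `N` and vanishes at the equilibrium, so `a₂ = 0`. After division by
`ζ N_e` the hypotheses say that `rateL` is negative and dominates `rateφ` times the slope of `inlet`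
(`exists_delayModel`): instantaneous damping beats the delayed feedback, which gives stability
whatever the delay. The decay proof (`abs_sub_lt_exp`) compares `|l - l_e|` with a barrier `K e^{-μ
s}`; at a first contact the delayed term is larger than the present one by at most a factor `e^{μ ·
delay}`, so for small `μ` the barrier cannot be reached.

Differentiating the delay equation carries the decay over to `G'` and `G''` (`exists_flow`). The
compatibility conditions say exactly that the two pieces of `G` match to first order at `0`; a jump
of `G''` there is harmless in `L²`. Returning to the time `t` and rescaling to `(0,1)` yields the
solution and the `H²` estimate (`exists_solution`).

For uniqueness, the constructed solution satisfies `N > 0` and `l' < ζ N`, so characteristics enter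
at `x = 0` and leave at `x = 1`, and for a short time the outlet value is read off from the present
state. Then `l` and the transported length solve an ODE whose field is Lipschitz because `H²` embeds
in `C¹`. Local uniqueness (`IsTransported.eventually_eq`) is propagated by continuous induction, the
strict inequalities passing to the competing solution wherever the two agree. -/

theorem eq_zero_endpoints {φ : ℝ → ℝ} (hs : tsupport φ ⊆ Ioo 0 1) : φ 0 = 0 ∧ φ 1 = 0 :=
  ⟨image_eq_zero_of_notMem_tsupport fun h => lt_irrefl _ (hs h).1,
    image_eq_zero_of_notMem_tsupport fun h => lt_irrefl _ (hs h).2⟩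

/-- Integration by parts for absolutely continuous functions; the boundary terms vanish with the
test function. -/
theorem hasWeakDeriv_of_eq_integral {u v : ℝ → ℝ} (hv : IntervalIntegrable v volume 0 1)
    (h : ∀ x ∈ Icc (0 : ℝ) 1, u x = u 0 + ∫ y in (0 : ℝ)..x, v y) : HasWeakDeriv u v := by
  intro φ hφ _ hs
  obtain ⟨h0, h1⟩ := eq_zero_endpoints hs
  set w : ℝ → ℝ := fun x => ∫ y in (0 : ℝ)..x, v y with hw
  have hwac : AbsolutelyContinuousOnInterval w 0 1 :=
    hv.absolutelyContinuousOnInterval_intervalIntegral (by simp)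
  have hφac : AbsolutelyContinuousOnInterval φ 0 1 :=
    (hφ.of_le (by simp)).contDiffOn.absolutelyContinuousOnInterval
  have key := hwac.integral_mul_deriv_eq_deriv_mul hφac
  have hd : ∫ x in (0 : ℝ)..1, deriv w x * φ x = ∫ x in (0 : ℝ)..1, v x * φ x := by
    apply intervalIntegral.integral_congr_ae
    filter_upwards [hv.ae_hasDerivAt_integral] with x hx hx'
    rw [(hx (uIoc_subset_uIcc hx') 0 (by simp)).deriv]
  have hcφ : IntervalIntegrable (deriv φ) volume 0 1 :=
    (hφ.continuous_deriv (by simp)).intervalIntegrable _ _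
  have hφ' : ∫ x in (0 : ℝ)..1, deriv φ x = 0 := by
    have := hφac.integral_deriv_eq_sub
    simpa [h0, h1] using this
  calc ∫ x in (0 : ℝ)..1, u x * deriv φ x
      = ∫ x in (0 : ℝ)..1, (u 0 * deriv φ x + w x * deriv φ x) := by
        apply intervalIntegral.integral_congr
        intro x hx
        rw [uIcc_of_le zero_le_one] at hx
        simp only [h x hx, hw]; ring
    _ = -∫ x in (0 : ℝ)..1, v x * φ x := by
        rw [intervalIntegral.integral_add (hcφ.const_mul _)
          (hcφ.continuousOn_mul hwac.continuousOn), intervalIntegral.integral_const_mul, hφ', key,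
          hd, h0, h1]
        ring

theorem integral_eq_of_tsupport_subset {ψ : ℝ → ℝ} (hs : tsupport ψ ⊆ Ioo 0 1) (u : ℝ → ℝ) :
    ∫ x in (0 : ℝ)..1, u x * ψ x = ∫ x, u x * ψ x := by
  apply intervalIntegral.integral_eq_integral_of_support_subset
  intro x hx
  have hx' : ψ x ≠ 0 := fun h => hx (by simp [h])
  have := hs (subset_tsupport _ hx')
  exact ⟨this.1, this.2.le⟩

/-- The primitive from `0` vanishes to the left of the support, and to the right of it because the
mean is zero, so its support stays in a compact interval inside `(0,1)`. -/
theorem exists_primitive_of_integral_eq_zero {ψ : ℝ → ℝ} (hψ : ContDiff ℝ ∞ ψ)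
    (hc : HasCompactSupport ψ) (hs : tsupport ψ ⊆ Ioo 0 1)
    (hi : ∫ x in (0 : ℝ)..1, ψ x = 0) :
    ∃ φ : ℝ → ℝ, ContDiff ℝ ∞ φ ∧ HasCompactSupport φ ∧ tsupport φ ⊆ Ioo 0 1 ∧ deriv φ = ψ := by
  have hcont : Continuous ψ := hψ.continuous
  have hcpt : IsCompact (tsupport ψ) := hc
  obtain ⟨a, b, ha, hb, hab⟩ : ∃ a b : ℝ, 0 < a ∧ b < 1 ∧ tsupport ψ ⊆ Icc a b := by
    rcases (tsupport ψ).eq_empty_or_nonempty with he | hne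
    · exact ⟨1 / 2, 1 / 2, by norm_num, by norm_num, by simp [he]⟩
    · obtain ⟨a, ha, ha'⟩ := hcpt.exists_isLeast hne
      obtain ⟨b, hb, hb'⟩ := hcpt.exists_isGreatest hne
      exact ⟨a, b, (hs ha).1, (hs hb).2, fun x hx => ⟨ha' hx, hb' hx⟩⟩
  have hz : ∀ x, x ∉ Icc a b → ψ x = 0 := fun x hx =>
    image_eq_zero_of_notMem_tsupport fun h => hx (hab h)
  have hder : ∀ x, HasDerivAt (fun x => ∫ y in (0 : ℝ)..x, ψ y) (ψ x) x := fun x =>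
    intervalIntegral.integral_hasDerivAt_right (hcont.intervalIntegrable _ _)
      (hcont.stronglyMeasurableAtFilter _ _) hcont.continuousAt
  have hdeq : deriv (fun x => ∫ y in (0 : ℝ)..x, ψ y) = ψ := funext fun x => (hder x).deriv
  have hsupp : Function.support (fun x => ∫ y in (0 : ℝ)..x, ψ y) ⊆ Icc a b := by
    intro x hx
    by_contra hcon
    apply hx
    simp only [mem_Icc, not_and_or, not_le] at hcon
    rcases hcon with hcon | hcon
    · apply intervalIntegral.integral_zero_ae
      filter_upwards with y hy
      apply hz
      intro hy'
      have : y ≤ max 0 x := hy.2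
      rcases le_max_iff.1 this with h | h <;> linarith [hy'.1]
    · have h1 : ∫ y in x..1, ψ y = 0 := by
        apply intervalIntegral.integral_zero_ae
        filter_upwards with y hy
        apply hz
        intro hy'
        have : min x 1 < y := hy.1
        rcases min_lt_iff.1 this with h | h <;> linarith [hy'.2]
      have := intervalIntegral.integral_add_adjacent_intervals
        (hcont.intervalIntegrable (μ := volume) 0 x) (hcont.intervalIntegrable x 1)
      show ∫ y in (0 : ℝ)..x, ψ y = 0
      linarith
  have hts : tsupport (fun x => ∫ y in (0 : ℝ)..x, ψ y) ⊆ Icc a b :=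
    closure_minimal hsupp isClosed_Icc
  refine ⟨fun x => ∫ y in (0 : ℝ)..x, ψ y, ?_, ?_, ?_, hdeq⟩
  · rw [contDiff_infty_iff_deriv, hdeq]
    exact ⟨fun x => (hder x).differentiableAt, hψ⟩
  · exact HasCompactSupport.of_support_subset_isCompact isCompact_Icc hsupp
  · exact hts.trans fun x hx => ⟨ha.trans_le hx.1, hx.2.trans_lt hb⟩

theorem exists_testFunction_integral_eq_one : ∃ χ : ℝ → ℝ, ContDiff ℝ ∞ χ ∧ HasCompactSupport χ ∧
    tsupport χ ⊆ Ioo 0 1 ∧ ∫ x in (0 : ℝ)..1, χ x = 1 := by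
  let b : ContDiffBump (1 / 2 : ℝ) := ⟨1 / 8, 1 / 4, by norm_num, by norm_num⟩
  have hs : tsupport (b.normed volume) ⊆ Ioo 0 1 := by
    rw [b.tsupport_normed_eq]
    intro x hx
    rw [Metric.mem_closedBall, Real.dist_eq, abs_le] at hx
    have h : b.rOut = 1 / 4 := rfl
    rw [h] at hx
    constructor <;> linarith [hx.1, hx.2]
  refine ⟨b.normed volume, b.contDiff_normed, b.hasCompactSupport_normed, hs, ?_⟩
  have := integral_eq_of_tsupport_subset hs (fun _ => 1)
  simp only [one_mul] at this
  rw [this, b.integral_normed]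

/-- A continuous function with vanishing weak derivative is constant. -/
theorem eq_of_hasWeakDeriv_zero {w : ℝ → ℝ} (hw : ContinuousOn w (Icc 0 1))
    (h : HasWeakDeriv w fun _ => 0) : ∀ x ∈ Icc (0 : ℝ) 1, w x = w 0 := by
  obtain ⟨χ, hχ, hχc, hχs, hχi⟩ := exists_testFunction_integral_eq_one
  have hwi : IntervalIntegrable w volume 0 1 :=
    ContinuousOn.intervalIntegrable (by rwa [uIcc_of_le zero_le_one])
  set c := ∫ x in (0 : ℝ)..1, w x * χ x with hc
  have hae : ∀ᵐ x : ℝ, x ∈ Ioo (0 : ℝ) 1 → w x - c = 0 := by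
    apply isOpen_Ioo.ae_eq_zero_of_integral_contDiff_smul_eq_zero
    · exact ((hw.mono Ioo_subset_Icc_self).sub continuousOn_const).locallyIntegrableOn
        measurableSet_Ioo
    · intro ψ hψ hψc hψs
      set I := ∫ x in (0 : ℝ)..1, ψ x with hI
      have hψint : IntervalIntegrable ψ volume 0 1 := hψ.continuous.intervalIntegrable _ _
      have hχint : IntervalIntegrable χ volume 0 1 := hχ.continuous.intervalIntegrable _ _
      -- Subtracting `I * χ` makes the mean zero, so the difference is the derivative of a test
      -- function and `w` integrates to zero against it. Hence `w - c` is orthogonal to every test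
      -- function.
      obtain ⟨φ, hφ, hφc, hφs, hφd⟩ := exists_primitive_of_integral_eq_zero
        (ψ := fun x => ψ x - I * χ x) (hψ.sub (contDiff_const.mul hχ))
        (hψc.sub (hχc.mul_left (f := fun _ => I)))
        (by
          refine (tsupport_sub _ _).trans (union_subset hψs ?_)
          exact (tsupport_mul_subset_right (f := fun _ => I)).trans hχs)
        (by
          rw [intervalIntegral.integral_sub hψint (hχint.const_mul _),
            intervalIntegral.integral_const_mul, hχi, ← hI]; ring)
      have key := h φ hφ hφc hφs
      rw [hφd] at key
      have hψw : IntervalIntegrable (fun x => w x * ψ x) volume 0 1 :=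
        hwi.mul_continuousOn hψ.continuous.continuousOn
      have hχw : IntervalIntegrable (fun x => w x * χ x) volume 0 1 :=
        hwi.mul_continuousOn hχ.continuous.continuousOn
      have e1 : ∫ x in (0 : ℝ)..1, w x * (ψ x - I * χ x)
          = (∫ x in (0 : ℝ)..1, w x * ψ x) - I * c := by
        rw [hc, ← intervalIntegral.integral_const_mul,
          ← intervalIntegral.integral_sub hψw (hχw.const_mul _)]
        congr 1; ext x; ring
      have e2 : ∫ x in (0 : ℝ)..1, (w x - c) * ψ x
          = (∫ x in (0 : ℝ)..1, w x * ψ x) - c * I := by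
        rw [hI, ← intervalIntegral.integral_const_mul,
          ← intervalIntegral.integral_sub hψw (hψint.const_mul _)]
        congr 1; ext x; ring
      have e3 := integral_eq_of_tsupport_subset hψs (fun x => w x - c)
      simp only [smul_eq_mul]
      simp only [zero_mul, intervalIntegral.integral_zero, neg_zero] at key
      rw [show (fun x => ψ x * (w x - c)) = fun x => (w x - c) * ψ x by ext; ring, ← e3, e2]
      linarith
  have hopen : ∀ x ∈ Ioo (0 : ℝ) 1, w x = c := by
    have hEq : EqOn w (fun _ => c) (Ioo 0 1) := by
      refine Measure.eqOn_open_of_ae_eq (μ := volume) ?_ isOpen_Ioo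
        (hw.mono Ioo_subset_Icc_self) continuousOn_const
      rw [EventuallyEq, ae_restrict_iff' measurableSet_Ioo]
      filter_upwards [hae] with x hx hx'
      linarith [hx hx']
    exact hEq
  have hcl : EqOn w (fun _ => c) (Icc 0 1) := by
    have : EqOn w (fun _ => c) (Ioo 0 1) := hopen
    refine this.of_subset_closure hw continuousOn_const Ioo_subset_Icc_self ?_
    rw [closure_Ioo (by norm_num)]
  intro x hx
  rw [hcl hx, hcl (left_mem_Icc.2 zero_le_one)]

/-- The difference of `u` and the primitive of `v` has zero weak derivative, hence is constant. -/
theorem HasWeakDeriv.eq_integral {u v : ℝ → ℝ} (h : HasWeakDeriv u v)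
    (hu : ContinuousOn u (Icc 0 1)) (hv : IntervalIntegrable v volume 0 1) :
    ∀ x ∈ Icc (0 : ℝ) 1, u x = u 0 + ∫ y in (0 : ℝ)..x, v y := by
  set w : ℝ → ℝ := fun x => ∫ y in (0 : ℝ)..x, v y with hw
  have hwc : ContinuousOn w (Icc 0 1) := by
    have := (hv.absolutelyContinuousOnInterval_intervalIntegral (c := 0) (by simp)).continuousOn
    rwa [uIcc_of_le zero_le_one] at this
  have hwd : HasWeakDeriv w v := hasWeakDeriv_of_eq_integral hv fun x _ => by simp [hw]
  have hui : IntervalIntegrable u volume 0 1 :=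
    ContinuousOn.intervalIntegrable (by rwa [uIcc_of_le zero_le_one])
  have hwi : IntervalIntegrable w volume 0 1 :=
    ContinuousOn.intervalIntegrable (by rwa [uIcc_of_le zero_le_one])
  have hz : HasWeakDeriv (fun x => u x - w x) fun _ => 0 := by
    intro φ hφ hc hs
    have hcφ : ContinuousOn (deriv φ) (uIcc 0 1) := (hφ.continuous_deriv (by simp)).continuousOn
    simp only [sub_mul]
    rw [intervalIntegral.integral_sub (hui.mul_continuousOn hcφ) (hwi.mul_continuousOn hcφ),
      h φ hφ hc hs, hwd φ hφ hc hs]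
    simp
  intro x hx
  have hxw : u x - w x = u 0 - w 0 := eq_of_hasWeakDeriv_zero (hu.sub hwc) hz x hx
  have h0 : w 0 = 0 := by simp [hw]
  show u x = u 0 + w x
  linarith

/-! ### Elementary properties of `H²(0,1)` -/

theorem intervalIntegrable_of_memLp {v : ℝ → ℝ}
    (hv : MemLp v 2 (volume.restrict (Ioo (0 : ℝ) 1))) : IntervalIntegrable v volume 0 1 := by
  rw [intervalIntegrable_iff_integrableOn_Ioo_of_le zero_le_one]
  exact hv.integrable one_le_two

theorem intervalIntegrable_sq_of_memLp {v : ℝ → ℝ}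
    (hv : MemLp v 2 (volume.restrict (Ioo (0 : ℝ) 1))) :
    IntervalIntegrable (fun x => v x ^ 2) volume 0 1 := by
  rw [intervalIntegrable_iff_integrableOn_Ioo_of_le zero_le_one]
  exact hv.integrable_sq

theorem memLp_of_continuousOn {v : ℝ → ℝ} (hv : ContinuousOn v (Icc 0 1)) :
    MemLp v 2 (volume.restrict (Ioo (0 : ℝ) 1)) := by
  obtain ⟨C, hC⟩ := isCompact_Icc.exists_bound_of_continuousOn hv
  refine MemLp.of_bound ((hv.mono Ioo_subset_Icc_self).aestronglyMeasurable measurableSet_Ioo) C ?_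
  rw [ae_restrict_iff' measurableSet_Ioo]
  filter_upwards with x hx using hC x (Ioo_subset_Icc_self hx)

/-- The Sobolev inequality on `(0,1)`. -/
theorem sq_le_of_eq_integral {u v : ℝ → ℝ} (hu : ContinuousOn u (Icc 0 1))
    (hv : MemLp v 2 (volume.restrict (Ioo (0 : ℝ) 1)))
    (h : ∀ x ∈ Icc (0 : ℝ) 1, u x = u 0 + ∫ y in (0 : ℝ)..x, v y) {x : ℝ}
    (hx : x ∈ Icc (0 : ℝ) 1) :
    u x ^ 2 ≤ 2 * (∫ y in (0 : ℝ)..1, u y ^ 2) + 2 * ∫ y in (0 : ℝ)..1, v y ^ 2 := by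
  have hvi := intervalIntegrable_of_memLp hv
  have hv2 := intervalIntegrable_sq_of_memLp hv
  have hu2 : IntervalIntegrable (fun x => u x ^ 2) volume 0 1 :=
    ContinuousOn.intervalIntegrable (by rw [uIcc_of_le zero_le_one]; exact hu.pow 2)
  set c := ∫ y in (0 : ℝ)..1, |v y| with hc
  have hc0 : 0 ≤ c := intervalIntegral.integral_nonneg zero_le_one fun _ _ => abs_nonneg _
  -- Cauchy–Schwarz on an interval of length one, in the form that the variance of `|v|` is
  -- nonnegative.
  have hcs : c ^ 2 ≤ ∫ y in (0 : ℝ)..1, v y ^ 2 := by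
    have h0 : 0 ≤ ∫ y in (0 : ℝ)..1, (|v y| - c) ^ 2 :=
      intervalIntegral.integral_nonneg zero_le_one fun _ _ => sq_nonneg _
    have h1 : ∫ y in (0 : ℝ)..1, (|v y| - c) ^ 2
        = (∫ y in (0 : ℝ)..1, v y ^ 2) - 2 * c * c + c ^ 2 := by
      have : (fun y => (|v y| - c) ^ 2) = fun y => v y ^ 2 - 2 * c * |v y| + c ^ 2 := by
        ext y; rw [← sq_abs (v y)]; ring
      rw [this, intervalIntegral.integral_add (hv2.sub (hvi.abs.const_mul _)) (by simp),
        intervalIntegral.integral_sub hv2 (hvi.abs.const_mul _),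
        intervalIntegral.integral_const_mul]
      simp [hc]
    nlinarith
  have hpt : ∀ y ∈ Icc (0 : ℝ) 1, u x ^ 2 ≤ 2 * u y ^ 2 + 2 * c ^ 2 := by
    intro y hy
    have hsub : ∀ z ∈ Icc (0 : ℝ) 1, IntervalIntegrable v volume 0 z := fun z hz =>
      hvi.mono_set (by
        rw [uIcc_of_le hz.1, uIcc_of_le zero_le_one]; exact Icc_subset_Icc_right hz.2)
    have hdiff : u x - u y = ∫ z in y..x, v z := by
      rw [h x hx, h y hy, ← intervalIntegral.integral_interval_sub_left (hsub x hx) (hsub y hy)]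
      ring
    have hle : |u x - u y| ≤ c := by
      rw [hdiff, hc, intervalIntegral.integral_of_le zero_le_one]
      refine (intervalIntegral.norm_integral_le_integral_norm_uIoc (f := v)).trans ?_
      refine setIntegral_mono_set ?_ ?_ ?_
      · exact ((intervalIntegrable_iff_integrableOn_Ioc_of_le zero_le_one).1 hvi).norm
      · filter_upwards with z using norm_nonneg _
      · refine Eventually.of_forall fun z hz => ?_
        exact ⟨(le_min hy.1 hx.1).trans_lt hz.1, hz.2.trans (max_le hy.2 hx.2)⟩
    have := sq_abs (u x - u y)
    nlinarith [sq_nonneg (u y - (u x - u y)), abs_nonneg (u x - u y), sq_nonneg (u y),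
      mul_self_nonneg (u x - 2 * u y), pow_le_pow_left₀ (abs_nonneg (u x - u y)) hle 2]
  -- Averaging over `y` replaces the unknown value `u y ^ 2` by its integral.
  have := intervalIntegral.integral_mono_on zero_le_one (by simp)
    ((hu2.const_mul 2).add (by simp : IntervalIntegrable (fun _ => 2 * c ^ 2) volume 0 1)) hpt
  rw [intervalIntegral.integral_add (hu2.const_mul 2) (by simp),
    intervalIntegral.integral_const_mul] at this
  simp only [intervalIntegral.integral_const, sub_zero, smul_eq_mul, one_mul] at this
  linarith

namespace H2

theorem val_eq_integral (u : H2) :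
    ∀ x ∈ Icc (0 : ℝ) 1, u.val x = u.val 0 + ∫ y in (0 : ℝ)..x, u.d1 y :=
  u.weakDeriv_val.eq_integral u.continuousOn_val
    (ContinuousOn.intervalIntegrable (by rw [uIcc_of_le zero_le_one]; exact u.continuousOn_d1))

theorem d1_eq_integral (u : H2) :
    ∀ x ∈ Icc (0 : ℝ) 1, u.d1 x = u.d1 0 + ∫ y in (0 : ℝ)..x, u.d2 y :=
  u.weakDeriv_d1.eq_integral u.continuousOn_d1 (intervalIntegrable_of_memLp u.memLp_d2)

theorem hasWeakDeriv_sub {u v u' v' : ℝ → ℝ} (hu : HasWeakDeriv u v) (hu' : HasWeakDeriv u' v')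
    (h1 : IntervalIntegrable u volume 0 1) (h2 : IntervalIntegrable v volume 0 1)
    (h3 : IntervalIntegrable u' volume 0 1) (h4 : IntervalIntegrable v' volume 0 1) :
    HasWeakDeriv (fun x => u x - u' x) fun x => v x - v' x := by
  intro φ hφ hc hs
  have hcφ : ContinuousOn (deriv φ) (uIcc 0 1) := (hφ.continuous_deriv (by simp)).continuousOn
  have hcφ' : ContinuousOn φ (uIcc 0 1) := hφ.continuous.continuousOn
  simp only [sub_mul]
  rw [intervalIntegral.integral_sub (h1.mul_continuousOn hcφ) (h3.mul_continuousOn hcφ),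
    hu φ hφ hc hs, hu' φ hφ hc hs,
    intervalIntegral.integral_sub (h2.mul_continuousOn hcφ') (h4.mul_continuousOn hcφ')]
  ring

/-- The difference of two elements of `H²(0,1)`. -/
def sub (u v : H2) : H2 where
  val := fun x => u.val x - v.val x
  d1 := fun x => u.d1 x - v.d1 x
  d2 := fun x => u.d2 x - v.d2 x
  continuousOn_val := u.continuousOn_val.sub v.continuousOn_val
  continuousOn_d1 := u.continuousOn_d1.sub v.continuousOn_d1
  memLp_d2 := u.memLp_d2.sub v.memLp_d2
  weakDeriv_val := hasWeakDeriv_sub u.weakDeriv_val v.weakDeriv_val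
    (intervalIntegrable_of_memLp (memLp_of_continuousOn u.continuousOn_val))
    (intervalIntegrable_of_memLp (memLp_of_continuousOn u.continuousOn_d1))
    (intervalIntegrable_of_memLp (memLp_of_continuousOn v.continuousOn_val))
    (intervalIntegrable_of_memLp (memLp_of_continuousOn v.continuousOn_d1))
  weakDeriv_d1 := hasWeakDeriv_sub u.weakDeriv_d1 v.weakDeriv_d1
    (intervalIntegrable_of_memLp (memLp_of_continuousOn u.continuousOn_d1))
    (intervalIntegrable_of_memLp u.memLp_d2)
    (intervalIntegrable_of_memLp (memLp_of_continuousOn v.continuousOn_d1))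
    (intervalIntegrable_of_memLp v.memLp_d2)

theorem integral_sq_nonneg (w : ℝ → ℝ) : 0 ≤ ∫ x in (0 : ℝ)..1, w x ^ 2 :=
  intervalIntegral.integral_nonneg zero_le_one fun _ _ => sq_nonneg _

theorem distSq_nonneg (u v : H2) : 0 ≤ u.distSq v :=
  add_nonneg (add_nonneg (integral_sq_nonneg fun x => u.val x - v.val x)
    (integral_sq_nonneg fun x => u.d1 x - v.d1 x)) (integral_sq_nonneg fun x => u.d2 x - v.d2 x)

theorem sq_val_sub_le (u v : H2) {x : ℝ} (hx : x ∈ Icc (0 : ℝ) 1) :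
    (u.val x - v.val x) ^ 2 ≤ 2 * u.distSq v := by
  have h := sq_le_of_eq_integral (u.sub v).continuousOn_val
    (memLp_of_continuousOn (u.sub v).continuousOn_d1) (u.sub v).val_eq_integral hx
  have h2 := integral_sq_nonneg fun x => u.d2 x - v.d2 x
  simp only [sub] at h
  unfold distSq
  linarith

theorem sq_d1_sub_le (u v : H2) {x : ℝ} (hx : x ∈ Icc (0 : ℝ) 1) :
    (u.d1 x - v.d1 x) ^ 2 ≤ 2 * u.distSq v := by
  have h := sq_le_of_eq_integral (u.sub v).continuousOn_d1 (u.sub v).memLp_d2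
    (u.sub v).d1_eq_integral hx
  have h2 := integral_sq_nonneg fun x => u.val x - v.val x
  simp only [sub] at h
  unfold distSq
  linarith

/-- The derivative of `u`, extended to `ℝ` by constants. -/
def extDeriv (u : H2) (x : ℝ) : ℝ := u.d1 (projIcc 0 1 zero_le_one x)

/-- The extension of `u` to `ℝ` which is affine outside `[0,1]`. -/
def ext (u : H2) (x : ℝ) : ℝ := u.val 0 + ∫ y in (0 : ℝ)..x, u.extDeriv y

theorem continuous_extDeriv (u : H2) : Continuous u.extDeriv :=
  (continuousOn_iff_continuous_domRestrict.1 u.continuousOn_d1).comp continuous_projIcc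

theorem extDeriv_of_mem (u : H2) {x : ℝ} (hx : x ∈ Icc (0 : ℝ) 1) : u.extDeriv x = u.d1 x := by
  simp [extDeriv, projIcc_of_mem zero_le_one hx]

theorem hasDerivAt_ext (u : H2) (x : ℝ) : HasDerivAt u.ext (u.extDeriv x) x :=
  (intervalIntegral.integral_hasDerivAt_right (u.continuous_extDeriv.intervalIntegrable _ _)
    (u.continuous_extDeriv.stronglyMeasurableAtFilter _ _)
    u.continuous_extDeriv.continuousAt).const_add _

theorem ext_of_mem (u : H2) {x : ℝ} (hx : x ∈ Icc (0 : ℝ) 1) : u.ext x = u.val x := by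
  rw [u.val_eq_integral x hx, ext]
  congr 1
  apply intervalIntegral.integral_congr
  intro y hy
  rw [uIcc_of_le hx.1] at hy
  exact u.extDeriv_of_mem ⟨hy.1, hy.2.trans hx.2⟩

/-- This extension makes the vector field of the uniqueness argument locally Lipschitz. -/
theorem contDiff_ext (u : H2) : ContDiff ℝ 1 u.ext := by
  rw [contDiff_one_iff_deriv]
  refine ⟨fun x => (u.hasDerivAt_ext x).differentiableAt, ?_⟩
  rw [show deriv u.ext = u.extDeriv from funext fun x => (u.hasDerivAt_ext x).deriv]
  exact u.continuous_extDeriv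

theorem hasDerivAt_val (u : H2) {x : ℝ} (hx : x ∈ Ioo (0 : ℝ) 1) :
    HasDerivAt u.val (u.d1 x) x := by
  rw [← u.extDeriv_of_mem (Ioo_subset_Icc_self hx)]
  refine (u.hasDerivAt_ext x).congr_of_eventuallyEq ?_
  filter_upwards [isOpen_Ioo.mem_nhds hx] with y hy
  exact (u.ext_of_mem (Ioo_subset_Icc_self hy)).symm

end H2

/-! ### Continuity of affine changes of variables in `L²` -/

theorem integral_sq_comp_le {w : ℝ → ℝ} (hw : Integrable fun x => w x ^ 2) {a b : ℝ} (ha : 0 < a) :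
    ∫ x in (0 : ℝ)..1, w (a * x - b) ^ 2 ≤ a⁻¹ * ∫ x, w x ^ 2 := by
  rw [intervalIntegral.integral_comp_mul_sub (fun y => w y ^ 2) ha.ne', smul_eq_mul]
  refine mul_le_mul_of_nonneg_left ?_ (inv_pos.2 ha).le
  rw [intervalIntegral.integral_of_le (by linarith)]
  exact setIntegral_le_integral hw (Eventually.of_forall fun _ => sq_nonneg _)

theorem memLp_comp_mul_sub {w : ℝ → ℝ} (hw : MemLp w 2) {a : ℝ} (b : ℝ) (ha : a ≠ 0) :
    MemLp (fun x => w (a * x - b)) 2 := by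
  have hm : AEStronglyMeasurable (fun x => w (a * x - b)) volume := by
    refine hw.1.comp_quasiMeasurePreserving ?_
    have h2 : Measure.QuasiMeasurePreserving (fun x : ℝ => a * x) volume volume := by
      refine ⟨measurable_const_mul a, ?_⟩
      rw [Real.map_volume_mul_left ha]
      exact Measure.smul_absolutelyContinuous
    exact (measurePreserving_sub_right volume b).quasiMeasurePreserving.comp h2
  rw [memLp_two_iff_integrable_sq hm]
  exact (hw.integrable_sq.comp_sub_right b).comp_mul_left' ha

theorem memLp_restrict_comp_mul_sub {w : ℝ → ℝ} (hw : MemLp w 2) {a b : ℝ} (ha : 0 < a) :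
    MemLp (fun x => w (a * x - b)) 2 (volume.restrict (Ioo (0 : ℝ) 1)) :=
  (memLp_comp_mul_sub hw b ha.ne').restrict _

/-- Compactly supported continuous functions are dense in `L²`, and affine substitutions with slope
near `a₀` are uniformly bounded on `L²`. It serves for the second space derivative, which is only
square integrable, in the proof of continuity in time. -/
theorem tendsto_integral_sq_comp_sub {w : ℝ → ℝ} (hw : MemLp w 2) {ι : Type*} {F : Filter ι}
    {a b : ι → ℝ} {a₀ b₀ : ℝ} (ha₀ : 0 < a₀) (ha : Tendsto a F (𝓝 a₀)) (hb : Tendsto b F (𝓝 b₀)) :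
    Tendsto (fun i => ∫ x in (0 : ℝ)..1, (w (a i * x - b i) - w (a₀ * x - b₀)) ^ 2) F (𝓝 0) := by
  rw [Metric.tendsto_nhds]
  intro ε hε
  have hw' : MemLp w (ENNReal.ofReal 2) := by simpa using hw
  -- For slopes above `a₀ / 2` a substitution costs a factor at most `2 / a₀`, so each approximation
  -- error is at most `ε / 12`; three such terms with weight `3` stay below `ε`.
  set δ := ε * a₀ / 24 with hδ
  have hδ0 : 0 < δ := by positivity
  obtain ⟨g, hgs, hgi, hgc, hgm⟩ := hw'.exists_hasCompactSupport_integral_rpow_sub_le two_pos hδ0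
  have hgm' : MemLp g 2 := by simpa using hgm
  have hd : MemLp (fun x => w x - g x) 2 := hw.sub hgm'
  have hd2 : ∫ x, (w x - g x) ^ 2 ≤ δ := by
    refine le_trans (le_of_eq ?_) hgi
    congr 1; ext x
    rw [Real.rpow_two, Real.norm_eq_abs, sq_abs]
  have hcont : Tendsto (fun i => ∫ x in (0 : ℝ)..1, (g (a i * x - b i) - g (a₀ * x - b₀)) ^ 2) F
      (𝓝 0) := by
    have hc : Continuous fun q : ℝ × ℝ =>
        ∫ x in (0 : ℝ)..1, (g (q.1 * x - q.2) - g (a₀ * x - b₀)) ^ 2 := by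
      apply intervalIntegral.continuous_parametric_intervalIntegral_of_continuous'
      fun_prop
    have := (hc.tendsto (a₀, b₀)).comp (ha.prodMk_nhds hb)
    simpa [Function.comp_def] using this
  filter_upwards [ha.eventually (lt_mem_nhds (half_lt_self ha₀)),
    hcont.eventually (gt_mem_nhds (show (0 : ℝ) < ε / 12 by positivity))] with i hi1 hi2
  have hai : 0 < a i := by linarith
  have m1 := intervalIntegrable_sq_of_memLp (memLp_restrict_comp_mul_sub hd (b := b i) hai)
  have m0 := intervalIntegrable_sq_of_memLp (memLp_restrict_comp_mul_sub hd (b := b₀) ha₀)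
  have mg : IntervalIntegrable (fun x => (g (a i * x - b i) - g (a₀ * x - b₀)) ^ 2) volume 0 1 := by
    apply Continuous.intervalIntegrable
    fun_prop
  have mw : IntervalIntegrable (fun x => (w (a i * x - b i) - w (a₀ * x - b₀)) ^ 2) volume 0 1 :=
    intervalIntegrable_sq_of_memLp
      ((memLp_restrict_comp_mul_sub hw hai).sub (memLp_restrict_comp_mul_sub hw ha₀))
  have l1 : ∫ x in (0 : ℝ)..1, (w (a i * x - b i) - g (a i * x - b i)) ^ 2 ≤ ε / 12 := by
    refine (integral_sq_comp_le hd.integrable_sq hai).trans ?_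
    rw [inv_mul_le_iff₀ hai]
    nlinarith
  have l0 : ∫ x in (0 : ℝ)..1, (w (a₀ * x - b₀) - g (a₀ * x - b₀)) ^ 2 ≤ ε / 12 := by
    refine (integral_sq_comp_le hd.integrable_sq ha₀).trans ?_
    rw [inv_mul_le_iff₀ ha₀]
    nlinarith
  have key := intervalIntegral.integral_mono_on zero_le_one mw
    (((m1.const_mul 3).add (m0.const_mul 3)).add (mg.const_mul 3))
    (fun x _ => show (w (a i * x - b i) - w (a₀ * x - b₀)) ^ 2 ≤
      3 * (w (a i * x - b i) - g (a i * x - b i)) ^ 2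
      + 3 * (w (a₀ * x - b₀) - g (a₀ * x - b₀)) ^ 2
      + 3 * (g (a i * x - b i) - g (a₀ * x - b₀)) ^ 2 by
        generalize w (a i * x - b i) = p
        generalize w (a₀ * x - b₀) = q
        generalize g (a i * x - b i) = r
        generalize g (a₀ * x - b₀) = s
        nlinarith [sq_nonneg ((p - r) + (q - s)), sq_nonneg ((p - r) - (r - s)),
          sq_nonneg ((q - s) + (r - s))])
  rw [intervalIntegral.integral_add ((m1.const_mul 3).add (m0.const_mul 3)) (mg.const_mul 3),
    intervalIntegral.integral_add (m1.const_mul 3) (m0.const_mul 3)] at key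
  simp only [intervalIntegral.integral_const_mul] at key
  rw [Real.dist_eq, sub_zero, abs_of_nonneg
    (H2.integral_sq_nonneg fun x => w (a i * x - b i) - w (a₀ * x - b₀))]
  linarith

/-! ### Two general lemmas on differential equations -/

/-- A function that starts positive and can only vanish for the first time with positive derivative
stays positive. -/
theorem pos_of_deriv_pos_of_first_zero {u u' : ℝ → ℝ} (hu : ∀ s, 0 ≤ s → HasDerivAt u (u' s) s)
    (h0 : 0 < u 0)
    (h : ∀ s, 0 < s → (∀ σ, 0 ≤ σ → σ < s → 0 < u σ) → u s = 0 → 0 < u' s) :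
    ∀ s, 0 ≤ s → 0 < u s := by
  by_contra hcon
  push Not at hcon
  obtain ⟨s₁, hs₁, hus₁⟩ := hcon
  have hc : ContinuousOn u (Icc 0 s₁) := fun s hs =>
    (hu s hs.1).continuousAt.continuousWithinAt
  have hcl : IsClosed (Icc 0 s₁ ∩ u ⁻¹' Iic 0) := hc.preimage_isClosed_of_isClosed isClosed_Icc
    isClosed_Iic
  have hcpt : IsCompact (Icc 0 s₁ ∩ u ⁻¹' Iic 0) :=
    isCompact_Icc.of_isClosed_subset hcl inter_subset_left
  obtain ⟨s, hs, hsmin⟩ := hcpt.exists_isLeast ⟨s₁, ⟨hs₁, le_rfl⟩, hus₁⟩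
  have hs0 : 0 < s := by
    rcases hs.1.1.eq_or_lt with h' | h'
    · have : u s ≤ 0 := hs.2
      rw [← h'] at this
      linarith
    · exact h'
  have hpos : ∀ σ, 0 ≤ σ → σ < s → 0 < u σ := by
    intro σ hσ hσs
    by_contra hneg
    exact absurd (hsmin ⟨⟨hσ, hσs.le.trans hs.1.2⟩, not_lt.1 hneg⟩) (not_le.2 hσs)
  have hge : 0 ≤ u s := by
    have ht : Tendsto u (𝓝[<] s) (𝓝 (u s)) := (hu s hs0.le).continuousAt.tendsto.mono_left
      nhdsWithin_le_nhds
    refine ge_of_tendsto ht ?_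
    filter_upwards [Ioo_mem_nhdsLT hs0] with σ hσ using (hpos σ hσ.1.le hσ.2).le
  have hus : u s = 0 := le_antisymm hs.2 hge
  have hd := h s hs0 hpos hus
  have hsl : Tendsto (slope u s) (𝓝[<] s) (𝓝 (u' s)) :=
    (hasDerivWithinAt_iff_tendsto_slope' (by simp)).1 (hu s hs0.le).hasDerivWithinAt
  have hle : u' s ≤ 0 := by
    refine le_of_tendsto hsl ?_
    filter_upwards [Ioo_mem_nhdsLT hs0] with σ hσ
    rw [slope_def_field, hus]
    exact div_nonpos_of_nonneg_of_nonpos (by linarith [hpos σ hσ.1.le hσ.2]) (by linarith [hσ.2])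
  linarith

/-- Global solvability of `l' = ρ(l)` for a causal functional `ρ` bounded by `1/2` and Lipschitz in
exponentially weighted norms, on functions with Lipschitz constant `1/2`. -/
theorem exists_solution_of_causal {C : ℝ} (hC : 1 ≤ C) (ρ : (ℝ → ℝ) → ℝ → ℝ)
    (hcont : ∀ l : ℝ → ℝ, (∀ x y, |l x - l y| ≤ 1 / 2 * |x - y|) → Continuous (ρ l))
    (hbd : ∀ l s, |ρ l s| ≤ 1 / 2)
    (hlip : ∀ l m : ℝ → ℝ, (∀ x y, |l x - l y| ≤ 1 / 2 * |x - y|) →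
      (∀ x y, |m x - m y| ≤ 1 / 2 * |x - y|) → ∀ b, 0 ≤ b →
      (∀ s, 0 ≤ s → |l s - m s| ≤ b * Real.exp (2 * C * s)) →
      ∀ s, 0 ≤ s → |ρ l s - ρ m s| ≤ C * (b * Real.exp (2 * C * s))) (l₀ : ℝ) :
    ∃ l : ℝ → ℝ, l 0 = l₀ ∧ (∀ x y, |l x - l y| ≤ 1 / 2 * |x - y|) ∧
      ∀ s, 0 ≤ s → HasDerivAt l (ρ l s) s := by
  set Φ : (ℝ → ℝ) → ℝ → ℝ := fun l s => l₀ + ∫ σ in (0 : ℝ)..s, ρ l σ with hΦ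
  have hder : ∀ l : ℝ → ℝ, (∀ x y, |l x - l y| ≤ 1 / 2 * |x - y|) → ∀ s,
      HasDerivAt (Φ l) (ρ l s) s := fun l hl s =>
    (intervalIntegral.integral_hasDerivAt_right ((hcont l hl).intervalIntegrable _ _)
      ((hcont l hl).stronglyMeasurableAtFilter _ _) (hcont l hl).continuousAt).const_add _
  have hΦlip : ∀ l : ℝ → ℝ, (∀ x y, |l x - l y| ≤ 1 / 2 * |x - y|) →
      ∀ x y, |Φ l x - Φ l y| ≤ 1 / 2 * |x - y| := by
    intro l hl x y
    have e : Φ l x - Φ l y = ∫ σ in y..x, ρ l σ := by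
      simp only [hΦ]
      rw [← intervalIntegral.integral_interval_sub_left ((hcont l hl).intervalIntegrable 0 x)
        ((hcont l hl).intervalIntegrable 0 y)]
      ring
    rw [e, ← Real.norm_eq_abs]
    exact intervalIntegral.norm_integral_le_of_norm_le_const (f := ρ l) (C := 1 / 2)
      fun σ _ => hbd l σ
  -- Picard map in the norm with weight `exp (2 C s)`: integrating `C exp (2 C σ)` gains the factor
  -- `1 / 2`.
  have hcontr : ∀ l m : ℝ → ℝ, (∀ x y, |l x - l y| ≤ 1 / 2 * |x - y|) →
      (∀ x y, |m x - m y| ≤ 1 / 2 * |x - y|) → ∀ b, 0 ≤ b →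
      (∀ s, 0 ≤ s → |l s - m s| ≤ b * Real.exp (2 * C * s)) →
      ∀ s, 0 ≤ s → |Φ l s - Φ m s| ≤ b / 2 * Real.exp (2 * C * s) := by
    intro l m hl hm b hb hlm s hs
    have e : Φ l s - Φ m s = ∫ σ in (0 : ℝ)..s, (ρ l σ - ρ m σ) := by
      rw [intervalIntegral.integral_sub ((hcont l hl).intervalIntegrable _ _)
        ((hcont m hm).intervalIntegrable _ _)]
      simp only [hΦ]; ring
    have hi : ∫ σ in (0 : ℝ)..s, C * (b * Real.exp (2 * C * σ))
        = b / 2 * Real.exp (2 * C * s) - b / 2 * Real.exp (2 * C * 0) := by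
      apply intervalIntegral.integral_eq_sub_of_hasDerivAt
      · intro σ _
        have := (((hasDerivAt_id σ).const_mul (2 * C)).exp).const_mul (b / 2)
        convert! this using 1
        simp only [id]
        ring
      · apply Continuous.intervalIntegrable
        fun_prop
    rw [e, ← Real.norm_eq_abs]
    refine (intervalIntegral.norm_integral_le_of_norm_le hs (g := fun σ =>
      C * (b * Real.exp (2 * C * σ))) ?_ ?_).trans ?_
    · filter_upwards with σ hσ
      exact hlip l m hl hm b hb hlm σ hσ.1.le
    · apply Continuous.intervalIntegrable
      fun_prop
    · rw [hi]
      simp only [mul_zero, Real.exp_zero, mul_one]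
      linarith
  set A : ℕ → ℝ → ℝ := fun n => Φ^[n] fun _ => l₀ with hA
  have hAs : ∀ n, A (n + 1) = Φ (A n) := fun n => Function.iterate_succ_apply' Φ n _
  have hAlip : ∀ n x y, |A n x - A n y| ≤ 1 / 2 * |x - y| := by
    intro n
    induction n with
    | zero => intro x y; simp [hA]
    | succ n ih => rw [hAs]; exact hΦlip _ ih
  have hAstep : ∀ n s, 0 ≤ s → |A n s - A (n + 1) s| ≤ (1 / 2) ^ n * Real.exp (2 * C * s) := by
    intro n
    induction n with
    | zero =>
      intro s hs
      have h1 := hAlip 1 s 0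
      have h2 : A 1 0 = l₀ := by simp [hA, hΦ]
      have h3 : A 0 s = l₀ := by simp [hA]
      have h4 := Real.add_one_le_exp (2 * C * s)
      rw [h2, sub_zero, abs_of_nonneg hs] at h1
      rw [h3, abs_sub_comm]
      norm_num
      nlinarith
    | succ n ih =>
      intro s hs
      rw [hAs (n + 1)]
      nth_rewrite 1 [hAs n]
      have := hcontr (A n) (A (n + 1)) (hAlip _) (hAlip _) _ (by positivity) ih s hs
      rw [pow_succ]
      linarith
  have hlim : ∀ s, ∃ y, 0 ≤ s → Tendsto (fun n => A n s) atTop (𝓝 y) := by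
    intro s
    by_cases hs : 0 ≤ s
    · have : CauchySeq fun n => A n s := by
        refine cauchySeq_of_le_geometric (1 / 2) (Real.exp (2 * C * s)) (by norm_num) fun n => ?_
        rw [Real.dist_eq, mul_comm]
        exact hAstep n s hs
      obtain ⟨y, hy⟩ := cauchySeq_tendsto_of_complete this
      exact ⟨y, fun _ => hy⟩
    · exact ⟨0, fun h => absurd h hs⟩
  choose y hy using hlim
  -- The limit exists only for `s ≥ 0`; freezing it for negative times keeps the Lipschitz bound on
  -- all of `ℝ`.
  set l : ℝ → ℝ := fun s => y (max s 0) with hl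
  have hlt : ∀ s, 0 ≤ s → Tendsto (fun n => A n s) atTop (𝓝 (l s)) := by
    intro s hs
    simp only [hl, max_eq_left hs]
    exact hy s hs
  have hllip : ∀ x z, |l x - l z| ≤ 1 / 2 * |x - z| := by
    intro x z
    have hx := hy (max x 0) (le_max_right _ _)
    have hz := hy (max z 0) (le_max_right _ _)
    refine (le_of_tendsto (hx.sub hz).abs (Eventually.of_forall fun n => hAlip n _ _)).trans ?_
    have := abs_max_sub_max_le_abs x z 0
    linarith
  have hlA : ∀ n s, 0 ≤ s → |A n s - l s| ≤ 2 * (1 / 2) ^ n * Real.exp (2 * C * s) := by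
    intro n s hs
    have := dist_le_of_le_geometric_of_tendsto (1 / 2) (Real.exp (2 * C * s)) (by norm_num)
      (fun n => by rw [Real.dist_eq, mul_comm]; exact hAstep n s hs) (hlt s hs) n
    rw [Real.dist_eq] at this
    refine this.trans (le_of_eq ?_)
    ring
  have hfix : ∀ s, 0 ≤ s → Φ l s = l s := by
    intro s hs
    have h1 : Tendsto (fun n => A (n + 1) s) atTop (𝓝 (l s)) :=
      (hlt s hs).comp (tendsto_add_atTop_nat 1)
    have h2 : Tendsto (fun n => A (n + 1) s) atTop (𝓝 (Φ l s)) := by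
      rw [tendsto_iff_dist_tendsto_zero]
      have h3 : Tendsto (fun n : ℕ => (1 / 2 : ℝ) ^ n * Real.exp (2 * C * s)) atTop (𝓝 0) := by
        simpa using (tendsto_pow_atTop_nhds_zero_of_lt_one (r := (1 / 2 : ℝ)) (by norm_num)
          (by norm_num)).mul_const (Real.exp (2 * C * s))
      refine squeeze_zero (fun _ => dist_nonneg) (fun n => ?_) h3
      rw [hAs, Real.dist_eq]
      have := hcontr (A n) l (hAlip _) hllip _ (by positivity) (hlA n) s hs
      refine this.trans (le_of_eq ?_)
      ring
    exact tendsto_nhds_unique h2 h1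
  -- `Φ l` is chosen rather than `l`, which is frozen for `s < 0` and may fail to have a two-sided
  -- derivative at `0`. Both agree for `s ≥ 0`, so the Lipschitz bound with `b = 0` identifies their
  -- right-hand sides.
  refine ⟨Φ l, by simp [hΦ], hΦlip l hllip, fun s hs => ?_⟩
  have heq : ρ (Φ l) s = ρ l s := by
    have := hlip (Φ l) l (hΦlip l hllip) hllip 0 le_rfl
      (fun σ hσ => by rw [hfix σ hσ]; simp) s hs
    rw [zero_mul, mul_zero] at this
    linarith [abs_nonpos_iff.1 this]
  rw [heq]
  exact hder l hllip s

/-! ### A scalar equation with state-dependent delay -/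

/-- The projection of `ℝ` onto `[c - r, c + r]`. -/
def clamp (c r x : ℝ) : ℝ := max (c - r) (min (c + r) x)

theorem abs_clamp_sub_le {c r : ℝ} (hr : 0 ≤ r) (x : ℝ) : |clamp c r x - c| ≤ r := by
  unfold clamp
  rw [abs_le]
  constructor
  · linarith [le_max_left (c - r) (min (c + r) x)]
  · linarith [max_le (show c - r ≤ c + r by linarith) (min_le_left (c + r) x)]

theorem abs_clamp_sub_clamp_le (c r x y : ℝ) : |clamp c r x - clamp c r y| ≤ |x - y| := by
  unfold clamp
  calc _ ≤ |min (c + r) x - min (c + r) y| := by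
        rw [max_comm, max_comm (c - r)]
        exact abs_max_sub_max_le_abs _ _ _
    _ ≤ |x - y| := by
        have := abs_min_sub_min_le_max (c + r) x (c + r) y
        simpa using this

theorem clamp_of_abs_le {c r x : ℝ} (h : |x - c| ≤ r) : clamp c r x = x := by
  obtain ⟨h1, h2⟩ := abs_le.1 h
  unfold clamp
  rw [min_eq_right (by linarith), max_eq_right (by linarith)]

theorem continuous_clamp (c r : ℝ) : Continuous (clamp c r) := by
  unfold clamp
  fun_prop

/-- The data of the equation `l'(s) = R(l(s), G(l(s) - s))`, `G(-s) = h(l(s))`, near an equilibrium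
`l = le`, `G = fe`, on a box of radius `r`, with the dissipation rate `a` dominating the loop gain
`d * q`. -/
structure DelayModel where
  (le fe r a d q C : ℝ)
  (R Rl Rφ : ℝ → ℝ → ℝ)
  (h h1 h2 : ℝ → ℝ)
  r_pos : 0 < r
  r_lt : r < le
  d_nonneg : 0 ≤ d
  q_pos : 0 < q
  gain : d * q < a
  C_ge : 1 ≤ C
  R_eq : R le fe = 0
  R_lip : ∀ l φ l' φ', |l - le| ≤ r → |φ - fe| ≤ r → |l' - le| ≤ r → |φ' - fe| ≤ r →
    |R l φ - R l' φ'| ≤ C * (|l - l'| + |φ - φ'|)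
  R_bound : ∀ l φ, |l - le| ≤ r → |φ - fe| ≤ r → |R l φ| ≤ 1 / 2
  R_diss : ∀ l φ, |l - le| ≤ r → |φ - fe| ≤ r →
    (l - le) * R l φ ≤ -a * (l - le) ^ 2 + d * |l - le| * |φ - fe|
  R_deriv : ∀ (u v : ℝ → ℝ) (u' v' s : ℝ), |u s - le| ≤ r → |v s - fe| ≤ r →
    HasDerivAt u u' s → HasDerivAt v v' s →
    HasDerivAt (fun s => R (u s) (v s)) (Rl (u s) (v s) * u' + Rφ (u s) (v s) * v') s
  Rl_bound : ∀ l φ, |l - le| ≤ r → |φ - fe| ≤ r → |Rl l φ| ≤ C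
  Rφ_bound : ∀ l φ, |l - le| ≤ r → |φ - fe| ≤ r → |Rφ l φ| ≤ C
  Rl_cont : ContinuousOn (fun z : ℝ × ℝ => Rl z.1 z.2) {z | |z.1 - le| ≤ r ∧ |z.2 - fe| ≤ r}
  Rφ_cont : ContinuousOn (fun z : ℝ × ℝ => Rφ z.1 z.2) {z | |z.1 - le| ≤ r ∧ |z.2 - fe| ≤ r}
  h_gain : ∀ l, |l - le| ≤ r → |h l - fe| ≤ q * |l - le|
  h_lip : ∀ l l', |l - le| ≤ r → |l' - le| ≤ r → |h l - h l'| ≤ C * |l - l'|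
  h_deriv : ∀ l, |l - le| ≤ r → HasDerivAt h (h1 l) l
  h1_deriv : ∀ l, |l - le| ≤ r → HasDerivAt h1 (h2 l) l
  h1_bound : ∀ l, |l - le| ≤ r → |h1 l| ≤ C
  h2_bound : ∀ l, |l - le| ≤ r → |h2 l| ≤ C
  h2_cont : ContinuousOn h2 {l | |l - le| ≤ r}

namespace DelayModel

variable (D : DelayModel)

/-- The value `G(l(s) - s)`, truncated so as to be defined for every continuous `l`. -/
def trace (G₀ l : ℝ → ℝ) (s : ℝ) : ℝ :=
  G₀ (max (clamp D.le D.r (l s) - s) 0) - G₀ 0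
    + D.h (clamp D.le D.r (l (max (s - clamp D.le D.r (l s)) 0)))

/-- The truncated right-hand side. -/
def rhs (G₀ l : ℝ → ℝ) (s : ℝ) : ℝ :=
  D.R (clamp D.le D.r (l s)) (clamp D.fe D.r (D.trace G₀ l s))

theorem clamp_pos (x : ℝ) : 0 < clamp D.le D.r x := by
  have := (abs_le.1 (abs_clamp_sub_le D.r_pos.le x (c := D.le))).1
  linarith [D.r_lt]

/-- Clamping makes the right-hand side globally bounded and Lipschitz, so no a priori estimate is
needed to solve the equation; the decay estimate later shows that the clamps are inactive. -/
theorem exists_truncated {G₀ : ℝ → ℝ} {k : ℝ} (hG : ∀ x y, |G₀ x - G₀ y| ≤ k * |x - y|)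
    (l₀ : ℝ) : ∃ l : ℝ → ℝ, l 0 = l₀ ∧ (∀ x y, |l x - l y| ≤ 1 / 2 * |x - y|) ∧
      ∀ s, 0 ≤ s → HasDerivAt l (D.rhs G₀ l s) s := by
  have hk : 0 ≤ k := by
    have := (abs_nonneg _).trans (hG 1 0)
    simpa using this
  have hC := D.C_ge
  have hr := D.r_pos.le
  -- In units of the weighted distance, `1` is the change of `l s`, `k` that of the argument of
  -- `G₀`, and `D.C * 2` that of the delayed inlet value.
  refine exists_solution_of_causal (C := D.C * (1 + (k + D.C * 2))) 
    (by nlinarith [mul_nonneg (by linarith : (0 : ℝ) ≤ D.C) hk]) (D.rhs G₀) ?_ ?_ ?_ l₀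
  · intro l hl
    have hlc : Continuous l := by
      refine (LipschitzWith.of_dist_le_mul (K := 1 / 2) fun x y => ?_).continuous
      rw [Real.dist_eq, Real.dist_eq]
      simpa using hl x y
    have hGc : Continuous G₀ := by
      refine (LipschitzWith.of_dist_le_mul (K := ⟨k, hk⟩) fun x y => ?_).continuous
      rw [Real.dist_eq, Real.dist_eq]
      exact hG x y
    have hcl := continuous_clamp D.le D.r
    have hcf := continuous_clamp D.fe D.r
    have hhc : Continuous fun x => D.h (clamp D.le D.r x) := by
      refine (LipschitzWith.of_dist_le_mul (K := ⟨D.C, by linarith⟩) fun x y => ?_).continuous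
      rw [Real.dist_eq, Real.dist_eq]
      refine (D.h_lip _ _ (abs_clamp_sub_le hr x) (abs_clamp_sub_le hr y)).trans ?_
      exact mul_le_mul_of_nonneg_left (abs_clamp_sub_clamp_le _ _ _ _) (by linarith)
    have hRc : Continuous fun z : ℝ × ℝ => D.R (clamp D.le D.r z.1) (clamp D.fe D.r z.2) := by
      refine (LipschitzWith.of_dist_le_mul (K := ⟨D.C * 2, by linarith⟩) fun x y => ?_).continuous
      rw [Real.dist_eq]
      refine (D.R_lip _ _ _ _ (abs_clamp_sub_le hr x.1) (abs_clamp_sub_le hr x.2)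
        (abs_clamp_sub_le hr y.1) (abs_clamp_sub_le hr y.2)).trans ?_
      have e1 := abs_clamp_sub_clamp_le D.le D.r x.1 y.1
      have e2 := abs_clamp_sub_clamp_le D.fe D.r x.2 y.2
      have e3 : |x.1 - y.1| ≤ dist x y := by
        rw [Prod.dist_eq, Real.dist_eq]; exact le_max_left _ _
      have e4 : |x.2 - y.2| ≤ dist x y := by
        rw [Prod.dist_eq, Real.dist_eq x.2]; exact le_max_right _ _
      show _ ≤ D.C * 2 * dist x y
      rw [mul_assoc]
      exact mul_le_mul_of_nonneg_left (by linarith) (by linarith)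
    have htr : Continuous (D.trace G₀ l) := by
      unfold trace
      refine Continuous.add (by fun_prop) ?_
      exact hhc.comp (by fun_prop)
    exact hRc.comp (hlc.prodMk htr)
  · intro l s
    exact D.R_bound _ _ (abs_clamp_sub_le hr _) (abs_clamp_sub_le hr _)
  · intro l m hl hm b hb hlm s hs
    set E := b * Real.exp (2 * (D.C * (1 + (k + D.C * 2))) * s) with hE
    have hls : |l s - m s| ≤ E := hlm s hs
    have e1 := (abs_clamp_sub_clamp_le D.le D.r (l s) (m s)).trans hls
    have e2 : |D.trace G₀ l s - D.trace G₀ m s| ≤ (k + D.C * 2) * E := by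
      set u := clamp D.le D.r (l s) with hu
      set v := clamp D.le D.r (m s) with hv
      have hu0 : 0 < u := D.clamp_pos _
      have hv0 : 0 < v := D.clamp_pos _
      have g1 : |G₀ (max (u - s) 0) - G₀ (max (v - s) 0)| ≤ k * E := by
        refine (hG _ _).trans (mul_le_mul_of_nonneg_left ?_ hk)
        have := abs_max_sub_max_le_abs (u - s) (v - s) 0
        rw [sub_sub_sub_cancel_right] at this
        exact this.trans e1
      have g2 : |l (max (s - u) 0) - m (max (s - v) 0)| ≤ 2 * E := by
        -- The delayed time never exceeds `s`, so the weight there is at most the weight at `s`.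
        -- Moving from one delayed time to the other is paid for by the Lipschitz bound on `m`.
        have hσ : max (s - u) 0 ≤ s := max_le (by linarith) hs
        have hσ0 : 0 ≤ max (s - u) 0 := le_max_right _ _
        have i1 : |l (max (s - u) 0) - m (max (s - u) 0)| ≤ E := by
          refine (hlm _ hσ0).trans (mul_le_mul_of_nonneg_left ?_ hb)
          apply Real.exp_le_exp.2
          apply mul_le_mul_of_nonneg_left hσ
          have : 0 ≤ D.C * (1 + (k + D.C * 2)) := by positivity
          linarith
        have i2 : |m (max (s - u) 0) - m (max (s - v) 0)| ≤ 1 / 2 * E := by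
          refine (hm _ _).trans (mul_le_mul_of_nonneg_left ?_ (by norm_num))
          have := abs_max_sub_max_le_abs (s - u) (s - v) 0
          rw [sub_sub_sub_cancel_left, abs_sub_comm v u] at this
          exact this.trans e1
        have i3 := abs_sub_le (l (max (s - u) 0)) (m (max (s - u) 0)) (m (max (s - v) 0))
        have : 0 ≤ E := by positivity
        linarith
      have g3 := (D.h_lip _ _ (abs_clamp_sub_le hr (l (max (s - u) 0)))
        (abs_clamp_sub_le hr (m (max (s - v) 0)))).trans (mul_le_mul_of_nonneg_left
          ((abs_clamp_sub_clamp_le _ _ _ _).trans g2) (by linarith))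
      unfold trace
      rw [← hu, ← hv]
      rw [abs_le] at g1 g3 ⊢
      constructor <;> linarith [g1.1, g1.2, g3.1, g3.2]
    unfold rhs
    refine (D.R_lip _ _ _ _ (abs_clamp_sub_le hr _) (abs_clamp_sub_le hr _)
      (abs_clamp_sub_le hr _) (abs_clamp_sub_le hr _)).trans ?_
    rw [mul_assoc]
    refine mul_le_mul_of_nonneg_left ?_ (by linarith)
    have e3 := abs_clamp_sub_clamp_le D.fe D.r (D.trace G₀ l s) (D.trace G₀ m s)
    linarith

end DelayModel

/-! ### Removal of the truncation and exponential decay of `l` -/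

namespace DelayModel

variable (D : DelayModel)

/-- The function `G` built from its values `G₀` on `[0,∞)` and from `G(-s) = h(l(s))`. -/
def profile (G₀ l : ℝ → ℝ) (ξ : ℝ) : ℝ := if 0 ≤ ξ then G₀ ξ else D.h (l (-ξ))

variable {D}

/-- If `s ≤ l s`, the inlet term is `h (l 0)` and cancels `G₀ 0`; otherwise the two `G₀` terms
cancel. Thus `trace` reproduces both branches in one continuous formula. -/
theorem trace_eq_profile {G₀ l : ℝ → ℝ} (hG : G₀ 0 = D.h (l 0)) {s : ℝ} (hs : 0 ≤ s)
    (hl : ∀ σ, 0 ≤ σ → σ ≤ s → |l σ - D.le| ≤ D.r) :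
    D.trace G₀ l s = D.profile G₀ l (l s - s) := by
  have hls := hl s hs le_rfl
  have hpos : 0 < l s := by linarith [(abs_le.1 hls).1, D.r_lt]
  unfold trace profile
  rw [clamp_of_abs_le hls]
  split_ifs with h
  · rw [max_eq_left h, max_eq_right (by linarith), clamp_of_abs_le (hl 0 le_rfl hs), hG]
    ring
  · rw [max_eq_right (by linarith), max_eq_left (by linarith),
      clamp_of_abs_le (hl _ (by linarith) (by linarith)), neg_sub]
    ring

/-- The delay `l s` is at most `le + r`. If `s ≤ l s`, the value comes from the initial datum and
`exp (μ * (le + r) - μ * s)` is still at least `1`; otherwise it was injected at time `s - l s`,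
where the bound on `l` was weaker by at most that delay factor. -/
theorem abs_profile_sub_le {G₀ l : ℝ → ℝ} {m K μ s : ℝ} (hs : 0 ≤ s) (hμ : 0 ≤ μ) (hKr : K ≤ D.r)
    (hK : 0 ≤ K) (hm : m ≤ D.q * K) (hlip : ∀ x y, |l x - l y| ≤ 1 / 2 * |x - y|)
    (hG : ∀ ξ ∈ Icc 0 (l 0), |G₀ ξ - D.fe| ≤ m)
    (hl : ∀ σ, 0 ≤ σ → σ ≤ s → |l σ - D.le| ≤ K * Real.exp (-μ * σ)) :
    |D.profile G₀ l (l s - s) - D.fe|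
      ≤ D.q * Real.exp (μ * (D.le + D.r)) * (K * Real.exp (-μ * s)) := by
  have hq := D.q_pos
  have hbox : ∀ σ, 0 ≤ σ → σ ≤ s → |l σ - D.le| ≤ D.r := fun σ h0 h1 =>
    (hl σ h0 h1).trans (by
      have : Real.exp (-μ * σ) ≤ 1 := Real.exp_le_one_iff.2 (by nlinarith)
      nlinarith)
  have hls := abs_le.1 (hbox s hs le_rfl)
  have e : D.q * Real.exp (μ * (D.le + D.r)) * (K * Real.exp (-μ * s))
      = D.q * K * Real.exp (μ * (D.le + D.r) + -μ * s) := by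
    rw [Real.exp_add]; ring
  rw [e]
  unfold profile
  split_ifs with h
  · have h1 : l s - s ≤ l 0 := by
      have := (abs_le.1 (hlip s 0)).2
      rw [sub_zero, abs_of_nonneg hs] at this
      linarith
    refine (hG _ ⟨h, h1⟩).trans (hm.trans ?_)
    have : 1 ≤ Real.exp (μ * (D.le + D.r) + -μ * s) := by
      apply Real.one_le_exp
      nlinarith [hls.2]
    nlinarith [mul_nonneg hq.le hK]
  · have hpos : 0 < l s := by linarith [hls.1, D.r_lt]
    rw [neg_sub]
    have h1 : 0 ≤ s - l s := by linarith
    refine (D.h_gain _ (hbox _ h1 (by linarith))).trans ?_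
    rw [mul_assoc]
    refine mul_le_mul_of_nonneg_left ((hl _ h1 (by linarith)).trans
      (mul_le_mul_of_nonneg_left (Real.exp_le_exp.2 ?_) hK)) hq.le
    nlinarith [hls.2]

/-- At `μ = 0` this is the strict inequality `D.gain`; continuity leaves room for a small positive
rate. -/
theorem exists_rate (D : DelayModel) :
    ∃ μ, 0 < μ ∧ μ + D.d * (D.q * Real.exp (μ * (D.le + D.r))) < D.a := by
  have hc : Continuous fun μ : ℝ => μ + D.d * (D.q * Real.exp (μ * (D.le + D.r))) := by fun_prop
  have h0 : (fun μ : ℝ => μ + D.d * (D.q * Real.exp (μ * (D.le + D.r)))) 0 < D.a := by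
    simpa using D.gain
  have := (hc.tendsto 0).eventually (gt_mem_nhds h0)
  obtain ⟨δ, hδ, h⟩ := Metric.eventually_nhds_iff.1 this
  exact ⟨δ / 2, by positivity, h (by rw [Real.dist_eq, sub_zero, abs_of_pos] <;> linarith)⟩

/-- The decay estimate: the loop gain is smaller than the dissipation rate. -/
theorem abs_sub_lt_exp {G₀ l : ℝ → ℝ} {m K μ : ℝ} (hμ : 0 < μ)
    (hrate : μ + D.d * (D.q * Real.exp (μ * (D.le + D.r))) < D.a) (hK : 0 < K)
    (hKr : (1 + D.q) * Real.exp (μ * (D.le + D.r)) * K ≤ D.r) (hm : m ≤ D.q * K)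
    (hlip : ∀ x y, |l x - l y| ≤ 1 / 2 * |x - y|) (hG0 : G₀ 0 = D.h (l 0))
    (hG : ∀ ξ ∈ Icc 0 (l 0), |G₀ ξ - D.fe| ≤ m) (hl0 : |l 0 - D.le| < K)
    (hl : ∀ s, 0 ≤ s → HasDerivAt l (D.rhs G₀ l s) s) {s : ℝ} (hs : 0 ≤ s) :
    |l s - D.le| < K * Real.exp (-μ * s) := by
  have hq := D.q_pos
  have hle : 0 < D.le := D.r_pos.trans D.r_lt
  have hexp1 : 1 ≤ Real.exp (μ * (D.le + D.r)) := Real.one_le_exp (by nlinarith [D.r_pos])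
  have hKr1 : K ≤ D.r := by nlinarith [mul_pos hq hK]
  have hKr2 : D.q * Real.exp (μ * (D.le + D.r)) * K ≤ D.r := by nlinarith
  have hu : ∀ s, 0 ≤ s → HasDerivAt (fun s => (K * Real.exp (-μ * s)) ^ 2 - (l s - D.le) ^ 2)
      (2 * (K * Real.exp (-μ * s)) * (K * (-μ * Real.exp (-μ * s)))
        - 2 * (l s - D.le) * D.rhs G₀ l s) s := by
    intro s hs
    have h1 : HasDerivAt (fun s => K * Real.exp (-μ * s)) (K * (-μ * Real.exp (-μ * s))) s := by
      have := (((hasDerivAt_id s).const_mul (-μ)).exp).const_mul K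
      convert! this using 1
      simp only [id]
      ring
    have h2 := (h1.pow 2).sub (((hl s hs).sub_const D.le).pow 2)
    convert! h2 using 1
    norm_num
  have hpos : ∀ s, 0 ≤ s → 0 < (K * Real.exp (-μ * s)) ^ 2 - (l s - D.le) ^ 2 := by
    refine pos_of_deriv_pos_of_first_zero hu ?_ ?_
    · simp only [mul_zero, Real.exp_zero, mul_one]
      have := pow_lt_pow_left₀ hl0 (abs_nonneg _) two_ne_zero
      rw [sq_abs] at this
      linarith
    · intro s hs hbefore hzero
      set Y := K * Real.exp (-μ * s) with hY
      have hY0 : 0 < Y := by positivity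
      have hdec : ∀ σ, 0 ≤ σ → σ ≤ s → |l σ - D.le| ≤ K * Real.exp (-μ * σ) := by
        intro σ h0 h1
        apply abs_le_of_sq_le_sq _ (by positivity)
        rcases h1.eq_or_lt with h | h
        · rw [h]; linarith
        · linarith [hbefore σ h0 h]
      have hbox : ∀ σ, 0 ≤ σ → σ ≤ s → |l σ - D.le| ≤ D.r := fun σ h0 h1 =>
        (hdec σ h0 h1).trans (by
          have : Real.exp (-μ * σ) ≤ 1 := Real.exp_le_one_iff.2 (by nlinarith)
          nlinarith)
      have htr := abs_profile_sub_le hs.le hμ.le hKr1 hK.le hm hlip hG hdec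
      have htrr : |D.profile G₀ l (l s - s) - D.fe| ≤ D.r := htr.trans (by
        have : Real.exp (-μ * s) ≤ 1 := Real.exp_le_one_iff.2 (by nlinarith)
        have h2 : 0 ≤ D.q * Real.exp (μ * (D.le + D.r)) * K := by positivity
        nlinarith)
      have hrhs : D.rhs G₀ l s = D.R (l s) (D.profile G₀ l (l s - s)) := by
        unfold rhs
        rw [trace_eq_profile hG0 hs.le hbox, clamp_of_abs_le (hbox s hs.le le_rfl),
          clamp_of_abs_le htrr]
      have hdiss := D.R_diss _ _ (hbox s hs.le le_rfl) htrr
      rw [← hrhs] at hdiss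
      have hlY : |l s - D.le| = Y := by
        have h1 : |l s - D.le| ^ 2 = Y ^ 2 := by rw [sq_abs]; linarith
        exact (pow_left_inj₀ (abs_nonneg _) hY0.le two_ne_zero).1 h1
      have hly2 : (l s - D.le) ^ 2 = Y ^ 2 := by linarith
      rw [hlY, hly2] at hdiss
      -- At a first contact the barrier difference has derivative at least `2 * Y ^ 2` times `a - (μ
      -- + d * q * exp (μ * (le + r)))`, which is positive by the choice of `μ`.
      have h3 : D.d * Y * |D.profile G₀ l (l s - s) - D.fe|
          ≤ D.d * Y * (D.q * Real.exp (μ * (D.le + D.r)) * Y) :=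
        mul_le_mul_of_nonneg_left htr (mul_nonneg D.d_nonneg hY0.le)
      have h4 : 0 < Y ^ 2 * (D.a - (μ + D.d * (D.q * Real.exp (μ * (D.le + D.r))))) :=
        mul_pos (by positivity) (by linarith)
      have h5 : K * (-μ * Real.exp (-μ * s)) = -μ * Y := by rw [hY]; ring
      rw [h5]
      nlinarith
  exact abs_lt_of_sq_lt_sq (by linarith [hpos s hs]) (by positivity)

variable (D) in
/-- `l` and `G` solve the delay equation, `G1` and `G2` are the first two derivatives of `G`, and
everything decays at rate `μ`. -/
structure IsFlow (m K μ : ℝ) (G₀ G₀' l G G1 G2 : ℝ → ℝ) : Prop where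
  deriv_l : ∀ s, 0 ≤ s → HasDerivAt l (D.R (l s) (G (l s - s))) s
  lip_l : ∀ x y, |l x - l y| ≤ 1 / 2 * |x - y|
  G_neg : ∀ s, 0 ≤ s → G (-s) = D.h (l s)
  G_nonneg : ∀ ξ, 0 ≤ ξ → G ξ = G₀ ξ
  G1_nonneg : ∀ ξ, 0 ≤ ξ → G1 ξ = G₀' ξ
  deriv_G : ∀ ξ, HasDerivAt G (G1 ξ) ξ
  cont_G1 : Continuous G1
  deriv_G1 : ∀ ξ, ξ < 0 → HasDerivAt G1 (G2 ξ) ξ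
  cont_G2 : ContinuousOn G2 (Iio 0)
  l_box : ∀ s, 0 ≤ s → |l s - D.le| ≤ D.r
  G_box : ∀ s, 0 ≤ s → |G (l s - s) - D.fe| ≤ D.r
  l_decay : ∀ s, 0 ≤ s → |l s - D.le| ≤ K * (m * Real.exp (-μ * s))
  G_decay : ∀ s, 0 ≤ s → |G (-s) - D.fe| ≤ K * (m * Real.exp (-μ * s))
  G1_decay : ∀ s, 0 ≤ s → |G1 (-s)| ≤ K * (m * Real.exp (-μ * s))
  G2_decay : ∀ s, 0 < s → |G2 (-s)| ≤ K * (m * Real.exp (-μ * s))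

/-- The barrier argument needs a strict initial inequality, unavailable for instance when `m = 0`.
It is applied with `K = κ * m + δ` for arbitrarily small `δ`; the strict form of `hmr` leaves room
for `δ`. -/
theorem abs_sub_le_exp {G₀ l : ℝ → ℝ} {m κ μ : ℝ} (hμ : 0 < μ)
    (hrate : μ + D.d * (D.q * Real.exp (μ * (D.le + D.r))) < D.a) (hm0 : 0 ≤ m) (hκ : 1 ≤ κ)
    (hκq : 1 ≤ D.q * κ)
    (hmr : (1 + D.q) * Real.exp (μ * (D.le + D.r)) * (κ * m) < D.r)
    (hlip : ∀ x y, |l x - l y| ≤ 1 / 2 * |x - y|) (hG0 : G₀ 0 = D.h (l 0))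
    (hG : ∀ ξ ∈ Icc 0 (l 0), |G₀ ξ - D.fe| ≤ m) (hl0 : |l 0 - D.le| ≤ m)
    (hl : ∀ s, 0 ≤ s → HasDerivAt l (D.rhs G₀ l s) s) {s : ℝ} (hs : 0 ≤ s) :
    |l s - D.le| ≤ κ * m * Real.exp (-μ * s) := by
  have hq := D.q_pos
  set c := (1 + D.q) * Real.exp (μ * (D.le + D.r)) with hc
  have hc0 : 0 < c := by positivity
  refine le_of_forall_pos_le_add fun ε hε => ?_
  set δ := min ε ((D.r - c * (κ * m)) / c) with hδ
  have hδ0 : 0 < δ := lt_min hε (div_pos (by linarith) hc0)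
  have hδc : c * δ ≤ D.r - c * (κ * m) := by
    have : δ ≤ (D.r - c * (κ * m)) / c := min_le_right _ _
    rw [le_div_iff₀ hc0] at this
    linarith
  have hκm : m ≤ κ * m := by nlinarith
  have hqm : m ≤ D.q * (κ * m) := by nlinarith
  have := abs_sub_lt_exp (D := D) (K := κ * m + δ) hμ hrate (by nlinarith) (by linarith)
    (by nlinarith) hlip hG0 hG (by linarith) hl hs
  have hexp : Real.exp (-μ * s) ≤ 1 := Real.exp_le_one_iff.2 (by nlinarith)
  have hδε : δ ≤ ε := min_le_left _ _
  nlinarith [Real.exp_pos (-μ * s)]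

end DelayModel

/-! ### Second-order regularity of the profile and the complete flow -/

namespace DelayModel

variable {D : DelayModel}

variable (D) in
/-- The derivative of `profile`. -/
def profileDeriv (G₀ G₀' l : ℝ → ℝ) (ξ : ℝ) : ℝ :=
  if 0 ≤ ξ then G₀' ξ
  else -(D.h1 (l (-ξ)) * D.R (l (-ξ)) (D.profile G₀ l (l (-ξ) - -ξ)))

variable (D) in
/-- The second derivative of `l`. -/
def accel (G₀ G₀' l : ℝ → ℝ) (s : ℝ) : ℝ :=
  D.Rl (l s) (D.profile G₀ l (l s - s)) * D.R (l s) (D.profile G₀ l (l s - s))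
    + D.Rφ (l s) (D.profile G₀ l (l s - s)) * (D.profileDeriv G₀ G₀' l (l s - s)
      * (D.R (l s) (D.profile G₀ l (l s - s)) - 1))

variable (D) in
/-- The second derivative of `profile` on the negative half-line. -/
def profileDeriv₂ (G₀ G₀' l : ℝ → ℝ) (ξ : ℝ) : ℝ :=
  D.h2 (l (-ξ)) * D.R (l (-ξ)) (D.profile G₀ l (l (-ξ) - -ξ)) ^ 2
    + D.h1 (l (-ξ)) * D.accel G₀ G₀' l (-ξ)

section Calculus

variable {G₀ G₀' l : ℝ → ℝ}

/-- Away from `0` each branch is differentiable. At `0` the values match by `hG0` and the one-sided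
derivatives by `hG0'`, the two compatibility conditions. -/
theorem hasDerivAt_profile (hG : ∀ ξ, HasDerivAt G₀ (G₀' ξ) ξ)
    (hl : ∀ s, 0 ≤ s → HasDerivAt l (D.R (l s) (D.profile G₀ l (l s - s))) s)
    (hbox : ∀ s, 0 ≤ s → |l s - D.le| ≤ D.r)
    (hG0 : G₀ 0 = D.h (l 0)) (hG0' : G₀' 0 = -(D.h1 (l 0) * D.R (l 0) (G₀ (l 0)))) (ξ : ℝ) :
    HasDerivAt (D.profile G₀ l) (D.profileDeriv G₀ G₀' l ξ) ξ := by
  have hneg : ∀ ξ ≤ 0, HasDerivAt (fun ξ => D.h (l (-ξ)))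
      (-(D.h1 (l (-ξ)) * D.R (l (-ξ)) (D.profile G₀ l (l (-ξ) - -ξ)))) ξ := by
    intro ξ hξ
    have h1 : HasDerivAt (fun ξ : ℝ => l (-ξ))
        (D.R (l (-ξ)) (D.profile G₀ l (l (-ξ) - -ξ)) * -1) ξ :=
      HasDerivAt.comp ξ (hl (-ξ) (by linarith)) (hasDerivAt_neg ξ)
    have h2 := HasDerivAt.comp ξ (D.h_deriv _ (hbox (-ξ) (by linarith))) h1
    convert! h2 using 1
    ring
  rcases lt_trichotomy ξ 0 with h | h | h
  · rw [profileDeriv, if_neg (not_le.2 h)]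
    refine (hneg ξ h.le).congr_of_eventuallyEq ?_
    filter_upwards [gt_mem_nhds h] with x hx
    rw [profile, if_neg (not_le.2 hx)]
  · subst h
    have hpos : 0 < l 0 := by linarith [(abs_le.1 (hbox 0 le_rfl)).1, D.r_lt]
    have h1 : HasDerivWithinAt (D.profile G₀ l) (G₀' 0) (Ici 0) 0 :=
      (hG 0).hasDerivWithinAt.congr (fun x hx => by rw [profile, if_pos (mem_Ici.1 hx)])
        (by rw [profile, if_pos le_rfl])
    have h2 : HasDerivWithinAt (D.profile G₀ l) (G₀' 0) (Iic 0) 0 := by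
      have := hneg 0 le_rfl
      rw [neg_zero, sub_zero, profile, if_pos hpos.le, ← hG0'] at this
      refine this.hasDerivWithinAt.congr (fun x hx => ?_) ?_
      · rcases (show x ≤ 0 from hx).eq_or_lt with h | h
        · rw [profile, if_pos h.ge, h, neg_zero, hG0]
        · rw [profile, if_neg (not_le.2 h)]
      · rw [profile, if_pos le_rfl, neg_zero, hG0]
    rw [profileDeriv, if_pos le_rfl]
    have h3 := h2.union h1
    rwa [Iic_union_Ici, hasDerivWithinAt_univ] at h3
  · rw [profileDeriv, if_pos h.le]
    refine (hG ξ).congr_of_eventuallyEq ?_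
    filter_upwards [lt_mem_nhds h] with x hx
    rw [profile, if_pos hx.le]

/-- Bootstrap: once the profile is differentiable, so is the right-hand side of the equation for
`l`, and `l` has a second derivative. -/
theorem hasDerivAt_rate (hl : ∀ s, 0 ≤ s → HasDerivAt l (D.R (l s) (D.profile G₀ l (l s - s))) s)
    (hbox : ∀ s, 0 ≤ s → |l s - D.le| ≤ D.r)
    (htr : ∀ s, 0 ≤ s → |D.profile G₀ l (l s - s) - D.fe| ≤ D.r)
    (hprof : ∀ ξ, HasDerivAt (D.profile G₀ l) (D.profileDeriv G₀ G₀' l ξ) ξ) {s : ℝ} (hs : 0 ≤ s) :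
    HasDerivAt (fun s => D.R (l s) (D.profile G₀ l (l s - s))) (D.accel G₀ G₀' l s) s :=
  D.R_deriv l (fun s => D.profile G₀ l (l s - s)) _ _ s (hbox s hs) (htr s hs) (hl s hs)
    (HasDerivAt.comp (h := fun s => l s - s) s (hprof (l s - s)) ((hl s hs).sub (hasDerivAt_id s)))

theorem continuous_profileDeriv (hc : Continuous G₀')
    (hl : ∀ s, 0 ≤ s → HasDerivAt l (D.R (l s) (D.profile G₀ l (l s - s))) s)
    (hbox : ∀ s, 0 ≤ s → |l s - D.le| ≤ D.r)
    (htr : ∀ s, 0 ≤ s → |D.profile G₀ l (l s - s) - D.fe| ≤ D.r)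
    (hprof : ∀ ξ, HasDerivAt (D.profile G₀ l) (D.profileDeriv G₀ G₀' l ξ) ξ)
    (hG0' : G₀' 0 = -(D.h1 (l 0) * D.R (l 0) (G₀ (l 0)))) :
    Continuous (D.profileDeriv G₀ G₀' l) := by
  set k : ℝ → ℝ := fun s => -(D.h1 (l s) * D.R (l s) (D.profile G₀ l (l s - s))) with hk
  have hkc : ContinuousOn k (Ici 0) := by
    intro s hs
    have h1 := (hasDerivAt_rate hl hbox htr hprof hs).continuousAt
    have h2 : ContinuousAt (fun s => D.h1 (l s)) s :=
      ContinuousAt.comp (g := D.h1) (D.h1_deriv _ (hbox s hs)).continuousAt (hl s hs).continuousAt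
    exact (h2.mul h1).neg.continuousWithinAt
  have hkm : Continuous fun ξ : ℝ => k (max (-ξ) 0) := by
    rw [← continuousOn_univ]
    exact hkc.comp (by fun_prop) fun x _ => mem_Ici.2 (le_max_right _ _)
  have heq : D.profileDeriv G₀ G₀' l = fun ξ => if 0 ≤ ξ then G₀' ξ else k (max (-ξ) 0) := by
    ext ξ
    unfold profileDeriv
    split_ifs with h
    · rfl
    · rw [max_eq_left (by linarith)]
  have hpos : 0 < l 0 := by linarith [(abs_le.1 (hbox 0 le_rfl)).1, D.r_lt]
  rw [heq]
  refine Continuous.if_le hc hkm continuous_const continuous_id ?_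
  intro x hx
  rw [← hx, neg_zero, max_self, hG0', hk]
  simp only [sub_zero]
  rw [profile, if_pos hpos.le]

theorem hasDerivAt_profileDeriv
    (hl : ∀ s, 0 ≤ s → HasDerivAt l (D.R (l s) (D.profile G₀ l (l s - s))) s)
    (hbox : ∀ s, 0 ≤ s → |l s - D.le| ≤ D.r)
    (htr : ∀ s, 0 ≤ s → |D.profile G₀ l (l s - s) - D.fe| ≤ D.r)
    (hprof : ∀ ξ, HasDerivAt (D.profile G₀ l) (D.profileDeriv G₀ G₀' l ξ) ξ) {ξ : ℝ} (hξ : ξ < 0) :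
    HasDerivAt (D.profileDeriv G₀ G₀' l) (D.profileDeriv₂ G₀ G₀' l ξ) ξ := by
  have hs : 0 ≤ -ξ := by linarith
  have h2 := HasDerivAt.comp (-ξ) (D.h1_deriv _ (hbox _ hs)) (hl _ hs)
  have h3 := (h2.mul (hasDerivAt_rate hl hbox htr hprof hs)).neg
  have h4 := HasDerivAt.comp ξ h3 (hasDerivAt_neg ξ)
  have h5 : HasDerivAt (fun ξ => -(D.h1 (l (-ξ)) * D.R (l (-ξ)) (D.profile G₀ l (l (-ξ) - -ξ))))
      (D.profileDeriv₂ G₀ G₀' l ξ) ξ := by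
    convert! h4 using 1
    simp only [profileDeriv₂, Function.comp_apply]
    ring
  refine h5.congr_of_eventuallyEq ?_
  filter_upwards [gt_mem_nhds hξ] with x hx
  rw [profileDeriv, if_neg (not_le.2 hx)]

theorem continuousOn_profileDeriv₂
    (hl : ∀ s, 0 ≤ s → HasDerivAt l (D.R (l s) (D.profile G₀ l (l s - s))) s)
    (hbox : ∀ s, 0 ≤ s → |l s - D.le| ≤ D.r)
    (htr : ∀ s, 0 ≤ s → |D.profile G₀ l (l s - s) - D.fe| ≤ D.r)
    (hprof : ∀ ξ, HasDerivAt (D.profile G₀ l) (D.profileDeriv G₀ G₀' l ξ) ξ)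
    (hcont : Continuous (D.profileDeriv G₀ G₀' l)) :
    ContinuousOn (D.profileDeriv₂ G₀ G₀' l) (Iio 0) := by
  have hlc : ContinuousOn l (Ici 0) := fun s hs => (hl s hs).continuousAt.continuousWithinAt
  have hrc : ContinuousOn (fun s => D.R (l s) (D.profile G₀ l (l s - s))) (Ici 0) := fun s hs =>
    (hasDerivAt_rate hl hbox htr hprof hs).continuousAt.continuousWithinAt
  have hpc : Continuous (D.profile G₀ l) :=
    continuous_iff_continuousAt.2 fun ξ => (hprof ξ).continuousAt
  have htc : ContinuousOn (fun s => D.profile G₀ l (l s - s)) (Ici 0) :=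
    hpc.comp_continuousOn (hlc.sub continuousOn_id)
  have hac : ContinuousOn (D.accel G₀ G₀' l) (Ici 0) := by
    unfold accel
    refine ContinuousOn.add (ContinuousOn.mul ?_ hrc) (ContinuousOn.mul ?_ (ContinuousOn.mul
      (hcont.comp_continuousOn (hlc.sub continuousOn_id)) (hrc.sub continuousOn_const)))
    · exact D.Rl_cont.comp (hlc.prodMk htc) fun s hs => ⟨hbox s hs, htr s hs⟩
    · exact D.Rφ_cont.comp (hlc.prodMk htc) fun s hs => ⟨hbox s hs, htr s hs⟩
  have h1c : ContinuousOn (fun s => D.h1 (l s)) (Ici 0) := fun s hs =>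
    (ContinuousAt.comp (g := D.h1) (D.h1_deriv _ (hbox s hs)).continuousAt
      (hl s hs).continuousAt).continuousWithinAt
  have h2c : ContinuousOn (fun s => D.h2 (l s)) (Ici 0) :=
    D.h2_cont.comp hlc fun s hs => hbox s hs
  have := ((h2c.mul (hrc.pow 2)).add (h1c.mul hac)).comp
    (continuous_neg.continuousOn (s := Iio (0 : ℝ))) fun ξ (hξ : ξ < 0) =>
      show (0 : ℝ) ≤ -ξ by linarith
  exact this

end Calculus

-- The bound on `l` is passed on through `R`, `h1` and the differentiated equation, each step losing
-- only a constant. All bounds are linear in the size `m` of the data, as a quadratic estimate in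
-- `H²` requires.
set_option maxHeartbeats 600000 in
theorem exists_flow (D : DelayModel) : ∃ m₀ K μ : ℝ, 0 < m₀ ∧ 0 < K ∧ 0 < μ ∧
    ∀ (l₀ m : ℝ) (G₀ G₀' : ℝ → ℝ), 0 ≤ m → m ≤ m₀ → |l₀ - D.le| ≤ m →
      (∀ ξ, HasDerivAt G₀ (G₀' ξ) ξ) → Continuous G₀' → (∀ ξ, |G₀' ξ| ≤ m) →
      (∀ ξ ∈ Icc 0 l₀, |G₀ ξ - D.fe| ≤ m) → G₀ 0 = D.h l₀ →
      G₀' 0 = -(D.h1 l₀ * D.R l₀ (G₀ l₀)) →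
      ∃ l G G1 G2 : ℝ → ℝ, l 0 = l₀ ∧ D.IsFlow m K μ G₀ G₀' l G G1 G2 := by
  obtain ⟨μ, hμ, hrate⟩ := D.exists_rate
  have hq := D.q_pos
  have hr := D.r_pos
  have hC := D.C_ge
  have hle : 0 < D.le := D.r_pos.trans D.r_lt
  obtain ⟨X, hX⟩ : ∃ x, x = Real.exp (μ * (D.le + D.r)) := ⟨_, rfl⟩
  rw [← hX] at hrate
  have hX1 : 1 ≤ X := by rw [hX]; exact Real.one_le_exp (by positivity)
  have hX0 : 0 < X := by linarith
  -- With this `κ` both `m ≤ κ * m` and `m ≤ q * (κ * m)` hold, so the barrier of height `κ * m`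
  -- covers the initial position and the initial profile.
  obtain ⟨κ, hκ⟩ : ∃ x, x = 1 + 1 / D.q := ⟨_, rfl⟩
  have hκ1 : 1 ≤ κ := by rw [hκ]; linarith [one_div_pos.2 hq]
  have hκ0 : 0 < κ := by linarith
  have hC0 : 0 < D.C := by linarith
  have hκq : 1 ≤ D.q * κ := by
    rw [hκ, mul_add, mul_one_div_cancel hq.ne']
    linarith
  have hcpos : 0 < (1 + D.q) * X * κ := by positivity
  -- Decay constants: `k1` for the outlet value, `k2` for `l'`, `k3` for `G'` on the negative axis,
  -- `k4` for `G'` at `l s - s` (with the delay factor `X`), `k5` for `l''`.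
  obtain ⟨k1, hk1⟩ : ∃ x, x = D.q * X * κ := ⟨_, rfl⟩
  obtain ⟨k2, hk2⟩ : ∃ x, x = D.C * (κ + k1) := ⟨_, rfl⟩
  obtain ⟨k3, hk3⟩ : ∃ x, x = D.C * k2 := ⟨_, rfl⟩
  obtain ⟨k4, hk4⟩ : ∃ x, x = (1 + k3) * X := ⟨_, rfl⟩
  obtain ⟨k5, hk5⟩ : ∃ x, x = D.C * k2 + 2 * D.C * k4 := ⟨_, rfl⟩
  have k1p : 0 < k1 := by rw [hk1]; positivity
  have k2p : 0 < k2 := by rw [hk2]; positivity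
  have k3p : 0 < k3 := by rw [hk3]; positivity
  have k4p : 0 < k4 := by rw [hk4]; positivity
  have k5p : 0 < k5 := by rw [hk5]; positivity
  obtain ⟨K, hK⟩ : ∃ x, x = κ + D.q * κ + k3 + (D.C * k2 + D.C * k5) := ⟨_, rfl⟩
  -- The factor `2` makes the smallness condition `hmr` strict.
  refine ⟨D.r / (2 * ((1 + D.q) * X * κ)), K, μ, by positivity, by rw [hK]; positivity, hμ, ?_⟩
  intro l₀ m G₀ G₀' hm0 hm hl₀ hGd hGc hGb hGm hG0 hG0'
  have hmr : (1 + D.q) * X * (κ * m) < D.r := by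
    rw [le_div_iff₀ (by positivity)] at hm
    linarith
  have hGlip : ∀ x y, |G₀ x - G₀ y| ≤ m * |x - y| := by
    intro x y
    have := convex_univ.norm_image_sub_le_of_norm_hasDerivWithin_le (f := G₀) (f' := G₀') (C := m)
      (fun x _ => (hGd x).hasDerivWithinAt) (fun x _ => hGb x) (mem_univ y) (mem_univ x)
    simpa using this
  obtain ⟨l, hl0, hlip, hlder⟩ := D.exists_truncated hGlip l₀
  rw [← hl0] at hG0 hG0' hGm hl₀
  have hdec : ∀ s, 0 ≤ s → |l s - D.le| ≤ κ * m * Real.exp (-μ * s) := fun s hs =>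
    abs_sub_le_exp hμ (hX ▸ hrate) hm0 hκ1 hκq (hX ▸ hmr) hlip hG0 hGm hl₀ hlder hs
  have hexp : ∀ s, 0 ≤ s → Real.exp (-μ * s) ≤ 1 := fun s hs =>
    Real.exp_le_one_iff.2 (by linarith [mul_nonneg hμ.le hs])
  have hκm : 0 ≤ κ * m := by positivity
  have hκmr : κ * m ≤ D.r := by
    have : 1 ≤ (1 + D.q) * X := one_le_mul_of_one_le_of_one_le (by linarith) hX1
    exact (le_mul_of_one_le_left hκm this).trans hmr.le
  have hmq : m ≤ D.q * (κ * m) := by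
    have := mul_le_mul_of_nonneg_right hκq hm0
    linarith
  have hbox : ∀ s, 0 ≤ s → |l s - D.le| ≤ D.r := fun s hs =>
    (hdec s hs).trans ((mul_le_of_le_one_right hκm (hexp s hs)).trans hκmr)
  have htrd : ∀ s, 0 ≤ s → |D.profile G₀ l (l s - s) - D.fe| ≤ k1 * (m * Real.exp (-μ * s)) := by
    intro s hs
    have := abs_profile_sub_le (D := D) hs hμ.le hκmr hκm hmq hlip hGm
      (fun σ h0 _ => hdec σ h0)
    refine this.trans (le_of_eq ?_)
    rw [hk1, hX]; ring
  have htr : ∀ s, 0 ≤ s → |D.profile G₀ l (l s - s) - D.fe| ≤ D.r := fun s hs =>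
    (htrd s hs).trans (by
      have h1 : k1 * m ≤ D.r := by
        have h2 : k1 * m = D.q * X * (κ * m) := by rw [hk1]; ring
        have h3 : 0 ≤ X * (κ * m) := by positivity
        linarith
      have h3 : 0 ≤ k1 * m := by positivity
      rw [← mul_assoc]
      exact (mul_le_of_le_one_right h3 (hexp s hs)).trans h1)
  have hl : ∀ s, 0 ≤ s → HasDerivAt l (D.R (l s) (D.profile G₀ l (l s - s))) s := by
    intro s hs
    have := hlder s hs
    rwa [rhs, trace_eq_profile hG0 hs (fun σ h0 _ => hbox σ h0), clamp_of_abs_le (hbox s hs),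
      clamp_of_abs_le (htr s hs)] at this
  have hprof := hasDerivAt_profile (D := D) hGd hl hbox hG0 hG0'
  have hcont := continuous_profileDeriv (D := D) hGc hl hbox htr hprof hG0'
  have hE : ∀ s, 0 ≤ m * Real.exp (-μ * s) := fun s => by positivity
  have hrate' : ∀ s, 0 ≤ s →
      |D.R (l s) (D.profile G₀ l (l s - s))| ≤ k2 * (m * Real.exp (-μ * s)) := by
    intro s hs
    have := D.R_lip (l s) (D.profile G₀ l (l s - s)) D.le D.fe (hbox s hs) (htr s hs)
      (by simp [hr.le]) (by simp [hr.le])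
    rw [D.R_eq, sub_zero] at this
    refine this.trans ?_
    rw [hk2, mul_assoc]
    refine mul_le_mul_of_nonneg_left ?_ (by linarith)
    have h1 := hdec s hs
    have h2 := htrd s hs
    linarith
  have hGneg : ∀ s, 0 ≤ s → D.profile G₀ l (-s) = D.h (l s) := by
    intro s hs
    rcases hs.eq_or_lt with h | h
    · rw [← h, neg_zero, profile, if_pos le_rfl, hG0]
    · rw [profile, if_neg (by linarith), neg_neg]
  have hpos0 : 0 < l 0 := by linarith [(abs_le.1 (hbox 0 le_rfl)).1, D.r_lt]
  have hG1neg : ∀ s, 0 ≤ s → D.profileDeriv G₀ G₀' l (-s)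
      = -(D.h1 (l s) * D.R (l s) (D.profile G₀ l (l s - s))) := by
    intro s hs
    rcases hs.eq_or_lt with h | h
    · rw [← h, neg_zero, profileDeriv, if_pos le_rfl, hG0', sub_zero, profile, if_pos hpos0.le]
    · rw [profileDeriv, if_neg (by linarith), neg_neg]
  have hG1dec : ∀ s, 0 ≤ s → |D.profileDeriv G₀ G₀' l (-s)| ≤ k3 * (m * Real.exp (-μ * s)) := by
    intro s hs
    rw [hG1neg s hs, abs_neg, abs_mul, hk3, mul_assoc]
    exact mul_le_mul (D.h1_bound _ (hbox s hs)) (hrate' s hs) (abs_nonneg _) (by linarith)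
  have hG1tr : ∀ s, 0 ≤ s →
      |D.profileDeriv G₀ G₀' l (l s - s)| ≤ k4 * (m * Real.exp (-μ * s)) := by
    intro s hs
    have hls := abs_le.1 (hbox s hs)
    have e : k4 * (m * Real.exp (-μ * s))
        = (1 + k3) * (m * Real.exp (μ * (D.le + D.r) + -μ * s)) := by
      rw [Real.exp_add, hk4, hX]; ring
    rw [e]
    by_cases h : 0 ≤ l s - s
    · rw [profileDeriv, if_pos h]
      refine (hGb _).trans ?_
      have : 1 ≤ Real.exp (μ * (D.le + D.r) + -μ * s) := by
        apply Real.one_le_exp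
        have := mul_nonneg hμ.le (show 0 ≤ D.le + D.r - s by linarith [hls.2])
        linarith
      have h2 : m ≤ m * Real.exp (μ * (D.le + D.r) + -μ * s) := le_mul_of_one_le_right hm0 this
      exact h2.trans (le_mul_of_one_le_left (hm0.trans h2) (by linarith))
    · have h1 := hG1dec (s - l s) (by linarith)
      rw [neg_sub] at h1
      refine h1.trans (mul_le_mul (by linarith) ?_ (hE _) (by linarith))
      refine mul_le_mul_of_nonneg_left (Real.exp_le_exp.2 ?_) hm0
      have := mul_nonneg hμ.le (show 0 ≤ D.le + D.r - l s by linarith [hls.2])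
      linarith
  have hacc : ∀ s, 0 ≤ s → |D.accel G₀ G₀' l s| ≤ k5 * (m * Real.exp (-μ * s)) := by
    intro s hs
    have b1 := D.Rl_bound _ _ (hbox s hs) (htr s hs)
    have b2 := D.Rφ_bound _ _ (hbox s hs) (htr s hs)
    have b3 := abs_le.1 (D.R_bound _ _ (hbox s hs) (htr s hs))
    have b4 : |D.R (l s) (D.profile G₀ l (l s - s)) - 1| ≤ 2 := by
      rw [abs_le]; constructor <;> linarith
    unfold accel
    refine (abs_add_le _ _).trans ?_
    rw [abs_mul, abs_mul, abs_mul]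
    have c1 := mul_le_mul b1 (hrate' s hs) (abs_nonneg _) (by linarith)
    have c2 := mul_le_mul (hG1tr s hs) b4 (abs_nonneg _) (mul_nonneg k4p.le (hE s))
    have c3 := mul_le_mul b2 c2 (by positivity) (by linarith)
    rw [hk5]
    linarith
  have hG2dec : ∀ s, 0 ≤ s → |D.profileDeriv₂ G₀ G₀' l (-s)|
      ≤ (D.C * k2 + D.C * k5) * (m * Real.exp (-μ * s)) := by
    intro s hs
    unfold profileDeriv₂
    rw [neg_neg]
    refine (abs_add_le _ _).trans ?_
    rw [abs_mul, abs_mul, sq, abs_mul]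
    have b3 := D.R_bound _ _ (hbox s hs) (htr s hs)
    have c1 := mul_le_mul (b3.trans (by norm_num : (1 / 2 : ℝ) ≤ 1)) (hrate' s hs) (abs_nonneg _)
      (by norm_num)
    have c2 := mul_le_mul (D.h2_bound _ (hbox s hs)) c1 (by positivity) (by linarith)
    have c3 := mul_le_mul (D.h1_bound _ (hbox s hs)) (hacc s hs) (abs_nonneg _) (by linarith)
    linarith
  have hmono : ∀ {x : ℝ}, x ≤ K → ∀ s, x * (m * Real.exp (-μ * s)) ≤ K * (m * Real.exp (-μ * s)) :=
    fun hx s => mul_le_mul_of_nonneg_right hx (hE s)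
  have hqκ : 0 < D.q * κ := by positivity
  have hCk : 0 < D.C * k2 + D.C * k5 := by positivity
  refine ⟨l, D.profile G₀ l, D.profileDeriv G₀ G₀' l, D.profileDeriv₂ G₀ G₀' l, hl0, ?_⟩
  exact
    { deriv_l := hl
      lip_l := hlip
      G_neg := hGneg
      G_nonneg := fun ξ hξ => by rw [profile, if_pos hξ]
      G1_nonneg := fun ξ hξ => by rw [profileDeriv, if_pos hξ]
      deriv_G := hprof
      cont_G1 := hcont
      deriv_G1 := fun ξ hξ => hasDerivAt_profileDeriv hl hbox htr hprof hξ
      cont_G2 := continuousOn_profileDeriv₂ hl hbox htr hprof hcont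
      l_box := hbox
      G_box := htr
      l_decay := fun s hs => by
        have := hdec s hs
        rw [mul_assoc] at this
        exact this.trans (hmono (by linarith) s)
      G_decay := fun s hs => by
        rw [hGneg s hs]
        refine (D.h_gain _ (hbox s hs)).trans (le_trans ?_ (hmono (x := D.q * κ) (by linarith) s))
        have := mul_le_mul_of_nonneg_left (hdec s hs) hq.le
        linarith
      G1_decay := fun s hs => (hG1dec s hs).trans (hmono (by linarith) s)
      G2_decay := fun s hs => (hG2dec s hs.le).trans (hmono (by linarith) s) }

end DelayModel

/-! ### Reduction of the extruder model to the delay equation -/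

namespace Params

variable (p : Params)

/-- The denominator of the pressure relation. -/
def den (l : ℝ) : ℝ := p.B * p.ρ + p.Kd * (p.L - l)

/-- The pressure per unit screw speed. -/
def unitPress (l : ℝ) : ℝ := p.η * p.ρ * p.V * (p.L - l) / p.den l

/-- The derivative of `unitPress`. -/
def unitPress' (l : ℝ) : ℝ := -(p.η * p.ρ * p.V * (p.B * p.ρ)) / p.den l ^ 2

/-- The second derivative of `unitPress`. -/
def unitPress'' (l : ℝ) : ℝ := -(p.η * p.ρ * p.V * (p.B * p.ρ)) * (2 * p.Kd) / p.den l ^ 3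

/-- The interface velocity per unit of transported length. -/
def rate (l φ : ℝ) : ℝ :=
  (p.Kd / p.η * p.unitPress l - p.ρ * p.V * φ) / (p.ζ * p.ρ * p.S * (1 - φ))

/-- The partial derivative of `rate` in `l`. -/
def rateL (l φ : ℝ) : ℝ := p.Kd / p.η * p.unitPress' l / (p.ζ * p.ρ * p.S * (1 - φ))

/-- The partial derivative of `rate` in `φ`. -/
def rateφ (l φ : ℝ) : ℝ :=
  (p.Kd / p.η * p.unitPress l - p.ρ * p.V) / (p.ζ * p.ρ * p.S * (1 - φ) ^ 2)

theorem press_eq (N l : ℝ) : p.press N l = N * p.unitPress l := by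
  unfold press unitPress den
  ring

/-- Because `N` factors out, it disappears from the interface equation when time is measured by the
transported length. -/
theorem vel_eq (l N φ : ℝ) : p.vel l N φ = p.ζ * N * p.rate l φ := by
  have hζ := p.ζ_pos.ne'
  unfold vel rate
  rw [press_eq]
  have : p.ζ * N * ((p.Kd / p.η * p.unitPress l - p.ρ * p.V * φ) / (p.ζ * p.ρ * p.S * (1 - φ)))
      = p.ζ * (N * (p.Kd / p.η * p.unitPress l - p.ρ * p.V * φ))
        / (p.ζ * (p.ρ * p.S * (1 - φ))) := by ring
  rw [this, mul_div_mul_left _ _ hζ]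
  ring

theorem den_pos {l : ℝ} (hl : l < p.L) : 0 < p.den l := by
  have := mul_pos p.B_pos p.ρ_pos
  have := mul_pos p.Kd_pos (sub_pos.2 hl)
  unfold den
  linarith

theorem hasDerivAt_den (l : ℝ) : HasDerivAt p.den (-p.Kd) l := by
  have := (((hasDerivAt_id l).const_sub p.L).const_mul p.Kd).const_add (p.B * p.ρ)
  convert! this using 1
  ring

theorem hasDerivAt_unitPress {l : ℝ} (hl : l < p.L) :
    HasDerivAt p.unitPress (p.unitPress' l) l := by
  have hd := (p.den_pos hl).ne'
  have := (((hasDerivAt_id l).const_sub p.L).const_mul (p.η * p.ρ * p.V)).div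
    (p.hasDerivAt_den l) hd
  convert! this using 1
  unfold unitPress'
  congr 1
  simp only [id, den]
  ring

theorem hasDerivAt_unitPress' {l : ℝ} (hl : l < p.L) :
    HasDerivAt p.unitPress' (p.unitPress'' l) l := by
  have hd := (p.den_pos hl).ne'
  have := (hasDerivAt_const l (-(p.η * p.ρ * p.V * (p.B * p.ρ)))).div
    ((p.hasDerivAt_den l).pow 2) (pow_ne_zero 2 hd)
  convert! this using 1
  unfold unitPress''
  simp only [Pi.pow_apply]
  field_simp
  norm_num
  left
  ring

theorem continuousAt_unitPress'' {l : ℝ} (hl : l < p.L) : ContinuousAt p.unitPress'' l := by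
  have hd := (p.den_pos hl).ne'
  unfold unitPress''
  exact continuousAt_const.div ((p.hasDerivAt_den l).continuousAt.pow 3) (pow_ne_zero 3 hd)

theorem rate_den_ne {φ : ℝ} (hφ : φ ≠ 1) : p.ζ * p.ρ * p.S * (1 - φ) ≠ 0 :=
  mul_ne_zero (mul_pos (mul_pos p.ζ_pos p.ρ_pos) p.S_pos).ne' (sub_ne_zero.2 hφ.symm)

theorem hasDerivAt_rate_comp {u v : ℝ → ℝ} {u' v' s : ℝ} (hl : u s < p.L) (hφ : v s < 1)
    (hu : HasDerivAt u u' s) (hv : HasDerivAt v v' s) :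
    HasDerivAt (fun s => p.rate (u s) (v s))
      (p.rateL (u s) (v s) * u' + p.rateφ (u s) (v s) * v') s := by
  have hd := p.rate_den_ne hφ.ne
  have h1 := HasDerivAt.comp s (p.hasDerivAt_unitPress hl) hu
  have h2 := ((h1.const_mul (p.Kd / p.η)).sub (hv.const_mul (p.ρ * p.V))).div
    ((hv.const_sub 1).const_mul (p.ζ * p.ρ * p.S)) hd
  convert! h2 using 1
  unfold rateL rateφ
  have h3 : 1 - v s ≠ 0 := (sub_pos.2 hφ).ne'
  have := p.ζ_pos.ne'
  have := p.ρ_pos.ne'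
  have := p.S_pos.ne'
  have := p.η_pos.ne'
  simp only [Pi.sub_apply, Function.comp_apply]
  field_simp
  ring

theorem contDiffAt_unitPress {l : ℝ} (hl : l < p.L) {n : WithTop ℕ∞} :
    ContDiffAt ℝ n p.unitPress l := by
  have hd := (p.den_pos hl).ne'
  unfold unitPress
  refine ContDiffAt.div ?_ ?_ hd
  · exact (contDiff_const.mul (contDiff_const.sub contDiff_id)).contDiffAt
  · unfold den
    exact (contDiff_const.add (contDiff_const.mul (contDiff_const.sub contDiff_id))).contDiffAt

theorem contDiffAt_rate {z : ℝ × ℝ} (hl : z.1 < p.L) (hφ : z.2 ≠ 1) {n : WithTop ℕ∞} :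
    ContDiffAt ℝ n (fun z : ℝ × ℝ => p.rate z.1 z.2) z := by
  unfold rate
  refine ContDiffAt.div ?_ ?_ (p.rate_den_ne hφ)
  · exact (contDiffAt_const.mul ((p.contDiffAt_unitPress hl).comp z contDiffAt_fst)).sub
      (contDiffAt_const.mul contDiffAt_snd)
  · exact contDiffAt_const.mul (contDiffAt_const.sub contDiffAt_snd)

theorem continuousAt_rateL {z : ℝ × ℝ} (hl : z.1 < p.L) (hφ : z.2 < 1) :
    ContinuousAt (fun z : ℝ × ℝ => p.rateL z.1 z.2) z := by
  unfold rateL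
  refine ContinuousAt.div ?_ (by fun_prop) (p.rate_den_ne hφ.ne)
  exact continuousAt_const.mul (ContinuousAt.comp (g := p.unitPress')
    (p.hasDerivAt_unitPress' hl).continuousAt continuousAt_fst)

theorem continuousAt_rateφ {z : ℝ × ℝ} (hl : z.1 < p.L) (hφ : z.2 < 1) :
    ContinuousAt (fun z : ℝ × ℝ => p.rateφ z.1 z.2) z := by
  unfold rateφ
  have h3 : (1 - z.2) ^ 2 ≠ 0 := pow_ne_zero 2 (sub_pos.2 hφ).ne'
  refine ContinuousAt.div ?_ (by fun_prop) (mul_ne_zero (mul_pos (mul_pos p.ζ_pos p.ρ_pos)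
    p.S_pos).ne' h3)
  exact (continuousAt_const.mul (ContinuousAt.comp (g := p.unitPress)
    (p.hasDerivAt_unitPress hl).continuousAt continuousAt_fst)).sub continuousAt_const

end Params

/-! ### The feedback law and the linearisation at the equilibrium -/

namespace Equilibrium

variable {p : Params} (e : Equilibrium p)

/-- The screw speed determined by the feedback. -/
def screw (k₁ l : ℝ) : ℝ := e.N * (1 - k₁ * p.unitPress e.l) / (1 - k₁ * p.unitPress l)

/-- The slope of the inlet filling ratio with respect to `unitPress`. -/
def inletSlope (k₁ k₂ : ℝ) : ℝ :=
  (k₂ - e.f * p.ρ * p.V * k₁) / (p.ρ * p.V * (1 - k₁ * p.unitPress e.l))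

/-- The inlet filling ratio determined by the feedback. -/
def inlet (k₁ k₂ l : ℝ) : ℝ := e.f + e.inletSlope k₁ k₂ * (p.unitPress l - p.unitPress e.l)

/-- The inlet flow rate determined by the feedback. -/
def inflow (k₁ k₂ l : ℝ) : ℝ := e.Fi + k₂ * (e.screw k₁ l * p.unitPress l - e.press)

theorem b₂_eq : e.b₂ = p.unitPress e.l := by
  unfold b₂
  simp only [Params.press_eq]
  exact ((hasDerivAt_id e.N).mul_const _).deriv.trans (one_mul _)

theorem b₁_eq : e.b₁ = e.N * p.unitPress' e.l := by
  unfold b₁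
  simp only [Params.press_eq]
  exact ((p.hasDerivAt_unitPress e.l_mem.2).const_mul _).deriv

theorem rate_eq_zero : p.rate e.l e.f = 0 := by
  have h := e.vel_eq_zero
  rw [Params.vel_eq] at h
  rcases mul_eq_zero.1 h with h | h
  · exact absurd h (mul_pos p.ζ_pos e.N_pos).ne'
  · exact h

theorem a₁_eq : e.a₁ = p.ζ * e.N * p.rateL e.l e.f := by
  unfold a₁
  simp only [Params.vel_eq]
  have := p.hasDerivAt_rate_comp (u := id) (v := fun _ => e.f) (s := e.l) e.l_mem.2 e.f_mem.2
    (hasDerivAt_id _) (hasDerivAt_const _ _)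
  simp only [id, mul_one, mul_zero, add_zero] at this
  exact (this.const_mul _).deriv

/-- The velocity is linear in `N`, with a factor that vanishes at the equilibrium. -/
theorem a₂_eq : e.a₂ = 0 := by
  unfold a₂
  simp [Params.vel_eq, e.rate_eq_zero]

theorem a₃_eq : e.a₃ = p.ζ * e.N * p.rateφ e.l e.f := by
  unfold a₃
  simp only [Params.vel_eq]
  have := p.hasDerivAt_rate_comp (u := fun _ => e.l) (v := id) (s := e.f) e.l_mem.2 e.f_mem.2
    (hasDerivAt_const _ _) (hasDerivAt_id _)
  simp only [id, mul_one, mul_zero, zero_add] at this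
  exact (this.const_mul _).deriv

variable {e}

/-- The first feedback equation is `N * (1 - k₁ * unitPress l) = N_e * (1 - k₁ * unitPress l_e)`.
Its right side is nonzero, so the factor on the left cannot vanish. -/
theorem feedback_iff {k₁ k₂ l N Fi : ℝ} (hk : 1 - k₁ * p.unitPress e.l ≠ 0) :
    e.Feedback k₁ k₂ l N Fi ↔
      1 - k₁ * p.unitPress l ≠ 0 ∧ N = e.screw k₁ l ∧ Fi = e.inflow k₁ k₂ l := by
  have hN := e.N_pos.ne'
  unfold Feedback inflow screw
  rw [press, Params.press_eq, Params.press_eq]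
  constructor
  · rintro ⟨h1, h2⟩
    have h3 : N * (1 - k₁ * p.unitPress l) = e.N * (1 - k₁ * p.unitPress e.l) := by linarith
    have h4 : 1 - k₁ * p.unitPress l ≠ 0 := by
      intro h
      rw [h, mul_zero] at h3
      exact mul_ne_zero hN hk h3.symm
    have h5 : N = e.N * (1 - k₁ * p.unitPress e.l) / (1 - k₁ * p.unitPress l) := by
      rw [eq_div_iff h4, h3]
    refine ⟨h4, h5, ?_⟩
    rw [← h5]
    linarith
  · rintro ⟨h1, rfl, rfl⟩
    constructor
    · field_simp
      ring
    · ring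

theorem screw_ne_zero {k₁ l : ℝ} (hk : 1 - k₁ * p.unitPress e.l ≠ 0)
    (hl : 1 - k₁ * p.unitPress l ≠ 0) : e.screw k₁ l ≠ 0 :=
  div_ne_zero (mul_ne_zero e.N_pos.ne' hk) hl

/-- Dividing by `N` clears the denominator of `screw`, which leaves an affine function of `unitPress
l`. -/
theorem inflow_div {k₁ k₂ l : ℝ} (hk : 1 - k₁ * p.unitPress e.l ≠ 0)
    (hl : 1 - k₁ * p.unitPress l ≠ 0) :
    e.inflow k₁ k₂ l / (p.ρ * p.V * e.screw k₁ l) = e.inlet k₁ k₂ l := by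
  have hN := e.N_pos.ne'
  have hρ := p.ρ_pos.ne'
  have hV := p.V_pos.ne'
  rw [div_eq_iff (mul_ne_zero (mul_ne_zero hρ hV) (screw_ne_zero hk hl))]
  unfold inflow inlet inletSlope screw press Fi
  rw [Params.press_eq]
  field_simp
  ring

theorem hasDerivAt_inlet (e : Equilibrium p) (k₁ k₂ : ℝ) {l : ℝ} (hl : l < p.L) :
    HasDerivAt (e.inlet k₁ k₂) (e.inletSlope k₁ k₂ * p.unitPress' l) l :=
  (((p.hasDerivAt_unitPress hl).sub_const _).const_mul _).const_add _

theorem continuousAt_screw {k₁ l : ℝ} (hl : l < p.L) (h : 1 - k₁ * p.unitPress l ≠ 0) :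
    ContinuousAt (e.screw k₁) l := by
  unfold screw
  refine continuousAt_const.div ?_ h
  exact continuousAt_const.sub (continuousAt_const.mul (p.hasDerivAt_unitPress hl).continuousAt)

end Equilibrium

namespace Equilibrium

variable {p : Params} {e : Equilibrium p}

theorem eventually_linear_approx (e : Equilibrium p) {ε : ℝ} (hε : 0 < ε) :
    ∀ᶠ z : ℝ × ℝ in 𝓝 (e.l, e.f),
      |p.rate z.1 z.2 - (p.rateL e.l e.f * (z.1 - e.l) + p.rateφ e.l e.f * (z.2 - e.f))|
        ≤ ε * (|z.1 - e.l| + |z.2 - e.f|) := by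
  obtain ⟨T, hT⟩ := ((p.contDiffAt_rate (z := (e.l, e.f)) e.l_mem.2 e.f_mem.2.ne
    (n := 1)).differentiableAt one_ne_zero)
  have h1 : T (1, 0) = p.rateL e.l e.f := by
    have c1 := HasFDerivAt.comp_hasDerivAt (f := fun l : ℝ => (l, e.f)) e.l hT
      ((hasDerivAt_id e.l).prodMk (hasDerivAt_const e.l e.f))
    have c2 := p.hasDerivAt_rate_comp (u := id) (v := fun _ => e.f) (s := e.l) e.l_mem.2 e.f_mem.2
      (hasDerivAt_id _) (hasDerivAt_const _ _)
    have := c1.unique c2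
    simpa using this
  have h2 : T (0, 1) = p.rateφ e.l e.f := by
    have c1 := HasFDerivAt.comp_hasDerivAt (f := fun φ : ℝ => (e.l, φ)) e.f hT
      ((hasDerivAt_const e.f e.l).prodMk (hasDerivAt_id e.f))
    have c2 := p.hasDerivAt_rate_comp (u := fun _ => e.l) (v := id) (s := e.f) e.l_mem.2 e.f_mem.2
      (hasDerivAt_const _ _) (hasDerivAt_id _)
    have := c1.unique c2
    simpa using this
  have hT' : ∀ a b : ℝ, T (a, b) = p.rateL e.l e.f * a + p.rateφ e.l e.f * b := by
    intro a b
    have : ((a, b) : ℝ × ℝ) = a • (1, 0) + b • (0, 1) := by simp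
    rw [this, map_add, map_smul, map_smul, h1, h2]
    simp only [smul_eq_mul]
    ring
  filter_upwards [hT.isLittleO.def hε] with z hz
  rw [e.rate_eq_zero, sub_zero] at hz
  have h3 : z - (e.l, e.f) = (z.1 - e.l, z.2 - e.f) := rfl
  rw [h3, hT'] at hz
  refine hz.trans (mul_le_mul_of_nonneg_left ?_ hε.le)
  rw [Prod.norm_def]
  exact max_le (le_add_of_nonneg_right (abs_nonneg _)) (le_add_of_nonneg_left (abs_nonneg _))

theorem eventually_inlet_gain (e : Equilibrium p) (k₁ k₂ : ℝ) {ε : ℝ} (hε : 0 < ε) :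
    ∀ᶠ l in 𝓝 e.l, |e.inlet k₁ k₂ l - e.f|
      ≤ (|e.inletSlope k₁ k₂ * p.unitPress' e.l| + ε) * |l - e.l| := by
  have h := (e.hasDerivAt_inlet k₁ k₂ e.l_mem.2).hasFDerivAt.isLittleO.def hε
  filter_upwards [h] with l hl
  have h0 : e.inlet k₁ k₂ e.l = e.f := by simp [inlet]
  rw [h0] at hl
  simp only [ContinuousLinearMap.toSpanSingleton_apply, smul_eq_mul, Real.norm_eq_abs] at hl
  have h1 := abs_sub_abs_le_abs_sub (e.inlet k₁ k₂ l - e.f)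
    ((l - e.l) * (e.inletSlope k₁ k₂ * p.unitPress' e.l))
  rw [abs_mul (l - e.l)] at h1
  linarith

/-- The strict inequalities at the equilibrium survive a small perturbation, which absorbs the
linearisation errors on a small box. -/
theorem exists_delayModel (e : Equilibrium p) {k₁ k₂ : ℝ} (hk : 1 - k₁ * e.b₂ ≠ 0)
    (hk₁ : e.a₁ + k₁ * e.a₂ * e.b₁ / (1 - k₁ * e.b₂) < 0)
    (hk₂ : |e.a₃ * e.b₁ * (k₂ - e.f * p.ρ * p.V * k₁) / (p.ρ * p.V * e.N * (1 - k₁ * e.b₂))| <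
      |e.a₁ + k₁ * e.a₂ * e.b₁ / (1 - k₁ * e.b₂)|) :
    ∃ D : DelayModel, D.le = e.l ∧ D.fe = e.f ∧ D.R = p.rate ∧ D.h = e.inlet k₁ k₂ ∧
      D.h1 = (fun l => e.inletSlope k₁ k₂ * p.unitPress' l) ∧
      ∀ l φ, |l - e.l| ≤ D.r → |φ - e.f| ≤ D.r → l ∈ Ioo 0 p.L ∧ φ < 1 ∧
        1 - k₁ * p.unitPress l ≠ 0 ∧ e.N / 2 ≤ e.screw k₁ l ∧ e.screw k₁ l ≤ 2 * e.N := by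
  have hζ := p.ζ_pos
  have hρ := p.ρ_pos
  have hV := p.V_pos
  have hN := e.N_pos
  rw [e.b₂_eq] at hk
  rw [e.a₂_eq, e.b₂_eq, e.a₁_eq, mul_zero, zero_mul, zero_div, add_zero] at hk₁ hk₂
  rw [e.a₃_eq, e.b₁_eq] at hk₂
  obtain ⟨A, hA⟩ : ∃ A, A = p.rateL e.l e.f := ⟨_, rfl⟩
  obtain ⟨Q, hQ⟩ : ∃ Q, Q = p.rateφ e.l e.f := ⟨_, rfl⟩
  obtain ⟨H, hH⟩ : ∃ H, H = e.inletSlope k₁ k₂ * p.unitPress' e.l := ⟨_, rfl⟩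
  have hζN : 0 < p.ζ * e.N := mul_pos hζ hN
  have hA0 : A < 0 := by
    rw [hA]
    by_contra hcon
    exact absurd hk₁ (not_lt.2 (mul_nonneg hζN.le (not_lt.1 hcon)))
  -- The gain hypothesis divided by `ζ * N_e`.
  have hgain : |Q| * |H| < -A := by
    have e1 : p.ζ * e.N * p.rateφ e.l e.f * (e.N * p.unitPress' e.l)
        * (k₂ - e.f * p.ρ * p.V * k₁) / (p.ρ * p.V * e.N * (1 - k₁ * p.unitPress e.l))
        = p.ζ * e.N * (Q * H) := by
      rw [hQ, hH, inletSlope]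
      field_simp
    rw [e1, ← hA, abs_mul, abs_mul (p.ζ * e.N) A, abs_of_neg hA0, abs_mul Q] at hk₂
    exact lt_of_mul_lt_mul_left hk₂ (abs_nonneg _)
  -- The slack `ε` pays for the remainders: `a = -A - ε`, `d = |Q| + ε`, `q = |H| + ε`. It also
  -- makes `q` positive when `H = 0`.
  obtain ⟨ε, hε, hε'⟩ : ∃ ε, 0 < ε ∧ (|Q| + ε) * (|H| + ε) < -A - ε := by
    have hc : Continuous fun ε : ℝ => (|Q| + ε) * (|H| + ε) - (-A - ε) := by fun_prop
    have h0 : (fun ε : ℝ => (|Q| + ε) * (|H| + ε) - (-A - ε)) 0 < 0 := by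
      simp only [add_zero, sub_zero]; linarith
    obtain ⟨δ, hδ, h⟩ := Metric.eventually_nhds_iff.1 ((hc.tendsto 0).eventually (gt_mem_nhds h0))
    refine ⟨δ / 2, by positivity, ?_⟩
    have := h (y := δ / 2) (by rw [Real.dist_eq, sub_zero, abs_of_pos] <;> linarith)
    linarith
  have hZ1 : Tendsto (fun z : ℝ × ℝ => z.1) (𝓝 (e.l, e.f)) (𝓝 e.l) := continuous_fst.tendsto _
  have hZ2 : Tendsto (fun z : ℝ × ℝ => z.2) (𝓝 (e.l, e.f)) (𝓝 e.f) := continuous_snd.tendsto _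
  obtain ⟨K, t, ht, hKt⟩ := (p.contDiffAt_rate (z := (e.l, e.f)) e.l_mem.2 e.f_mem.2.ne
    (n := 1)).exists_lipschitzOnWith
  have hin : ContDiffAt ℝ 1 (e.inlet k₁ k₂) e.l :=
    contDiffAt_const.add (contDiffAt_const.mul
      ((p.contDiffAt_unitPress e.l_mem.2).sub contDiffAt_const))
  obtain ⟨K', t', ht', hKt'⟩ := hin.exists_lipschitzOnWith
  have c1 : ContinuousAt (fun l => e.inletSlope k₁ k₂ * p.unitPress' l) e.l :=
    continuousAt_const.mul (p.hasDerivAt_unitPress' e.l_mem.2).continuousAt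
  have c2 : ContinuousAt (fun l => e.inletSlope k₁ k₂ * p.unitPress'' l) e.l :=
    continuousAt_const.mul (p.continuousAt_unitPress'' e.l_mem.2)
  have c3 := p.continuousAt_rateL (z := (e.l, e.f)) e.l_mem.2 e.f_mem.2
  have c4 := p.continuousAt_rateφ (z := (e.l, e.f)) e.l_mem.2 e.f_mem.2
  have c5 : ContinuousAt (fun z : ℝ × ℝ => p.rate z.1 z.2) (e.l, e.f) :=
    (p.contDiffAt_rate (z := (e.l, e.f)) e.l_mem.2 e.f_mem.2.ne (n := 1)).continuousAt
  have c6 : ContinuousAt (fun l => 1 - k₁ * p.unitPress l) e.l :=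
    continuousAt_const.sub (continuousAt_const.mul (p.hasDerivAt_unitPress e.l_mem.2).continuousAt)
  have c7 : ContinuousAt (e.screw k₁) e.l := continuousAt_screw e.l_mem.2 hk
  have s0 : e.screw k₁ e.l = e.N := by
    unfold screw
    field_simp
  set C1 := |e.inletSlope k₁ k₂ * p.unitPress' e.l| + 1 with hC1
  set C2 := |e.inletSlope k₁ k₂ * p.unitPress'' e.l| + 1 with hC2
  set C3 := |p.rateL e.l e.f| + 1 with hC3
  set C4 := |p.rateφ e.l e.f| + 1 with hC4
  have hev : ∀ᶠ z : ℝ × ℝ in 𝓝 (e.l, e.f),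
      (z.1 ∈ Ioo 0 p.L ∧ z.2 < 1 ∧ 1 - k₁ * p.unitPress z.1 ≠ 0 ∧ e.N / 2 ≤ e.screw k₁ z.1 ∧
        e.screw k₁ z.1 ≤ 2 * e.N) ∧ z ∈ t ∧ z.1 ∈ t' ∧
      |p.rate z.1 z.2 - (p.rateL e.l e.f * (z.1 - e.l) + p.rateφ e.l e.f * (z.2 - e.f))|
        ≤ ε * (|z.1 - e.l| + |z.2 - e.f|) ∧
      |e.inlet k₁ k₂ z.1 - e.f|
        ≤ (|e.inletSlope k₁ k₂ * p.unitPress' e.l| + ε) * |z.1 - e.l| ∧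
      |e.inletSlope k₁ k₂ * p.unitPress' z.1| < C1 ∧
      |e.inletSlope k₁ k₂ * p.unitPress'' z.1| < C2 ∧
      |p.rateL z.1 z.2| < C3 ∧ |p.rateφ z.1 z.2| < C4 ∧ |p.rate z.1 z.2| < 1 / 2 := by
    have w1 := hZ1.eventually (Ioo_mem_nhds e.l_mem.1 e.l_mem.2)
    have w2 := hZ2.eventually (gt_mem_nhds e.f_mem.2)
    have w3 := hZ1.eventually (c6.eventually_ne hk)
    have w4 := hZ1.eventually (c7.eventually (lt_mem_nhds (show e.N / 2 < e.screw k₁ e.l by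
      rw [s0]; linarith)))
    have w5 := hZ1.eventually (c7.eventually (gt_mem_nhds (show e.screw k₁ e.l < 2 * e.N by
      rw [s0]; linarith)))
    have w6 := hZ1.eventually ht'
    have w7 := hZ1.eventually (e.eventually_inlet_gain k₁ k₂ hε)
    have w8 := hZ1.eventually (c1.abs.eventually (gt_mem_nhds (lt_add_one _)))
    have w9 := hZ1.eventually (c2.abs.eventually (gt_mem_nhds (lt_add_one _)))
    have w10 := c3.abs.eventually (gt_mem_nhds (lt_add_one _))
    have w11 := c4.abs.eventually (gt_mem_nhds (lt_add_one _))
    have w12 := c5.abs.eventually (gt_mem_nhds (show |p.rate e.l e.f| < 1 / 2 by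
      rw [e.rate_eq_zero]; norm_num))
    filter_upwards [w1, w2, w3, w4, w5, ht, w6, e.eventually_linear_approx hε, w7, w8, w9, w10, w11,
      w12] with z a1 a2 a3 a4 a5 a6 a7 a8 a9 a10 a11 a12 a13 a14
    exact ⟨⟨a1, a2, a3, a4.le, a5.le⟩, a6, a7, a8, a9, a10, a11, a12, a13, a14⟩
  obtain ⟨δ, hδ, hball⟩ := Metric.eventually_nhds_iff.1 hev
  obtain ⟨r, hr0, hrδ, hrl⟩ : ∃ r, 0 < r ∧ r < δ ∧ r < e.l :=
    ⟨min δ e.l / 2, by have := lt_min hδ e.l_mem.1; positivity, by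
      have := lt_min hδ e.l_mem.1; linarith [min_le_left δ e.l], by
      have := lt_min hδ e.l_mem.1; linarith [min_le_right δ e.l]⟩
  have hbox := fun (l φ : ℝ) (hl : |l - e.l| ≤ r) (hφ : |φ - e.f| ≤ r) =>
    hball (y := (l, φ)) (by
      rw [Prod.dist_eq, Real.dist_eq, Real.dist_eq]
      exact (max_le hl hφ).trans_lt hrδ)
  have hff : |e.f - e.f| ≤ r := by simp [hr0.le]
  set C := 1 + K + K' + C1 + C2 + C3 + C4 with hC
  have p1 : 0 < C1 := by positivity
  have p2 : 0 < C2 := by positivity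
  have p3 : 0 < C3 := by positivity
  have p4 : 0 < C4 := by positivity
  have pK := K.2
  have pK' := K'.2
  refine ⟨{ le := e.l, fe := e.f, r := r, a := -A - ε, d := |Q| + ε, q := |H| + ε, C := C,
            R := p.rate, Rl := p.rateL, Rφ := p.rateφ, h := e.inlet k₁ k₂,
            h1 := fun l => e.inletSlope k₁ k₂ * p.unitPress' l,
            h2 := fun l => e.inletSlope k₁ k₂ * p.unitPress'' l,
            r_pos := hr0, r_lt := hrl, d_nonneg := by positivity, q_pos := by positivity,
            gain := hε', C_ge := ?_, R_eq := e.rate_eq_zero, R_lip := ?_,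
            R_bound := fun l φ hl hφ => (hbox l φ hl hφ).2.2.2.2.2.2.2.2.2.le,
            R_diss := ?_,
            R_deriv := fun u v u' v' s hu hv => p.hasDerivAt_rate_comp (hbox _ _ hu hv).1.1.2
              (hbox _ _ hu hv).1.2.1,
            Rl_bound := ?_, Rφ_bound := ?_,
            Rl_cont := fun z hz => (p.continuousAt_rateL (hbox _ _ hz.1 hz.2).1.1.2
              (hbox _ _ hz.1 hz.2).1.2.1).continuousWithinAt,
            Rφ_cont := fun z hz => (p.continuousAt_rateφ (hbox _ _ hz.1 hz.2).1.1.2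
              (hbox _ _ hz.1 hz.2).1.2.1).continuousWithinAt,
            h_gain := ?_, h_lip := ?_,
            h_deriv := fun l hl => e.hasDerivAt_inlet k₁ k₂ (hbox l e.f hl hff).1.1.2,
            h1_deriv := fun l hl => (p.hasDerivAt_unitPress' (hbox l e.f hl hff).1.1.2).const_mul _,
            h1_bound := ?_, h2_bound := ?_,
            h2_cont := fun l hl => (continuousAt_const.mul
              (p.continuousAt_unitPress'' (hbox l e.f hl hff).1.1.2)).continuousWithinAt },
    rfl, rfl, rfl, rfl, rfl, fun l φ hl hφ => (hbox l φ hl hφ).1⟩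
  · linarith
  · intro l φ l' φ' hl hφ hl' hφ'
    have := hKt.dist_le_mul _ (hbox l φ hl hφ).2.1 _ (hbox l' φ' hl' hφ').2.1
    rw [Real.dist_eq] at this
    refine this.trans (mul_le_mul (by linarith) ?_ dist_nonneg (by linarith))
    rw [Prod.dist_eq, Real.dist_eq, Real.dist_eq]
    exact max_le (le_add_of_nonneg_right (abs_nonneg _)) (le_add_of_nonneg_left (abs_nonneg _))
  · intro l φ hl hφ
    have h1 := (hbox l φ hl hφ).2.2.2.1
    rw [← hA, ← hQ] at h1
    simp only at h1
    have h2 : (l - e.l) * (p.rate l φ - (A * (l - e.l) + Q * (φ - e.f)))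
        ≤ |l - e.l| * (ε * (|l - e.l| + |φ - e.f|)) := by
      refine (le_abs_self _).trans ?_
      rw [abs_mul]
      exact mul_le_mul_of_nonneg_left h1 (abs_nonneg _)
    have h3 : (l - e.l) * (Q * (φ - e.f)) ≤ |l - e.l| * (|Q| * |φ - e.f|) := by
      refine (le_abs_self _).trans ?_
      rw [abs_mul, abs_mul]
    have h4 := sq_abs (l - e.l)
    nlinarith
  · intro l φ hl hφ
    have := (hbox l φ hl hφ).2.2.2.2.2.2.2.1
    simp only at this
    linarith
  · intro l φ hl hφ
    have := (hbox l φ hl hφ).2.2.2.2.2.2.2.2.1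
    simp only at this
    linarith
  · intro l hl
    rw [hH]
    exact (hbox l e.f hl hff).2.2.2.2.1
  · intro l l' hl hl'
    have := hKt'.dist_le_mul _ (hbox l e.f hl hff).2.2.1 _ (hbox l' e.f hl' hff).2.2.1
    rw [Real.dist_eq, Real.dist_eq] at this
    exact this.trans (mul_le_mul_of_nonneg_right (by linarith) (abs_nonneg _))
  · intro l hl
    have := (hbox l e.f hl hff).2.2.2.2.2.1
    simp only at this
    linarith
  · intro l hl
    have := (hbox l e.f hl hff).2.2.2.2.2.2.1
    simp only at this
    linarith

end Equilibrium

/-! ### The filling ratio as a curve in `H²(0,1)` -/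

/-- The part of the second derivative of `G` that comes from the initial datum `f₀(·/l₀)`. -/
def initialPart (f₀ : H2) (l₀ ξ : ℝ) : ℝ := (Ioo (0 : ℝ) 1).indicator f₀.d2 (ξ / l₀) / l₀ ^ 2

/-- The second derivative of `G` on `(-∞, l₀)`. -/
def secondDeriv (f₀ : H2) (l₀ : ℝ) (G2 : ℝ → ℝ) (ξ : ℝ) : ℝ :=
  (Iio (0 : ℝ)).indicator G2 ξ + initialPart f₀ l₀ ξ

theorem initialPart_of_neg (f₀ : H2) {l₀ ξ : ℝ} (hl₀ : 0 < l₀) (hξ : ξ ≤ 0) :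
    initialPart f₀ l₀ ξ = 0 := by
  have : ξ / l₀ ∉ Ioo (0 : ℝ) 1 := fun h =>
    absurd h.1 (not_lt.2 (div_nonpos_of_nonpos_of_nonneg hξ hl₀.le))
  rw [initialPart, indicator_of_notMem this, zero_div]

theorem memLp_initialPart (f₀ : H2) {l₀ : ℝ} (hl₀ : 0 < l₀) : MemLp (initialPart f₀ l₀) 2 := by
  have h1 : MemLp ((Ioo (0 : ℝ) 1).indicator f₀.d2) 2 :=
    (memLp_indicator_iff_restrict measurableSet_Ioo).2 f₀.memLp_d2
  have h2 := (memLp_comp_mul_sub h1 0 (inv_ne_zero hl₀.ne')).const_mul (1 / l₀ ^ 2)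
  convert! h2 using 1
  ext ξ
  rw [initialPart, sub_zero, div_eq_inv_mul ξ]
  ring

theorem integral_initialPart_sq (f₀ : H2) {l₀ : ℝ} (hl₀ : 0 < l₀) :
    ∫ ξ, initialPart f₀ l₀ ξ ^ 2 = (l₀ ^ 3)⁻¹ * ∫ x in (0 : ℝ)..1, f₀.d2 x ^ 2 := by
  have h1 : (fun ξ => initialPart f₀ l₀ ξ ^ 2)
      = fun ξ => (fun y => (l₀ ^ 4)⁻¹ * (Ioo (0 : ℝ) 1).indicator (fun x => f₀.d2 x ^ 2) y)
        (ξ / l₀) := by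
    ext ξ
    simp only [initialPart, indicator]
    split_ifs
    · ring
    · ring
  rw [h1, Measure.integral_comp_div (fun y => (l₀ ^ 4)⁻¹ *
    (Ioo (0 : ℝ) 1).indicator (fun x => f₀.d2 x ^ 2) y) l₀, integral_const_mul,
    integral_indicator measurableSet_Ioo,
    intervalIntegral.integral_of_le zero_le_one, integral_Ioc_eq_integral_Ioo, abs_of_pos hl₀,
    smul_eq_mul]
  field_simp

namespace DelayModel.IsFlow

variable {D : DelayModel} {m K μ l₀ : ℝ} {f₀ : H2} {l G G1 G2 : ℝ → ℝ}

/-- The decay of `G2` is a domination by `K * m * exp (μ * ξ)`, which is square integrable on the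
negative axis. -/
theorem memLp_indicator {G₀ G₀' : ℝ → ℝ} (H : D.IsFlow m K μ G₀ G₀' l G G1 G2) (hμ : 0 < μ) :
    MemLp ((Iio (0 : ℝ)).indicator G2) 2 := by
  have hg : MemLp ((Iio (0 : ℝ)).indicator fun ξ => K * (m * Real.exp (μ * ξ))) 2 := by
    rw [memLp_indicator_iff_restrict measurableSet_Iio, memLp_two_iff_integrable_sq
      (Continuous.aestronglyMeasurable (by fun_prop))]
    have h1 : IntegrableOn (fun ξ : ℝ => Real.exp (2 * μ * ξ)) (Iio 0) :=
      (integrableOn_exp_mul_Iic (by positivity) 0).mono_set Iio_subset_Iic_self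
    have h2 := h1.const_mul ((K * m) ^ 2)
    refine h2.congr (Eventually.of_forall fun ξ => ?_)
    have : Real.exp (2 * μ * ξ) = Real.exp (μ * ξ) ^ 2 := by
      rw [← Real.exp_nat_mul]; congr 1; push_cast; ring
    simp only [this]
    ring
  refine hg.mono' ?_ (Eventually.of_forall fun ξ => ?_)
  · exact (aestronglyMeasurable_indicator_iff measurableSet_Iio).2
      (H.cont_G2.aestronglyMeasurable measurableSet_Iio)
  · by_cases h : ξ ∈ Iio (0 : ℝ)
    · rw [indicator_of_mem h, indicator_of_mem h]
      have := H.G2_decay (-ξ) (by linarith [mem_Iio.1 h])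
      simpa using this
    · rw [indicator_of_notMem h, indicator_of_notMem h, norm_zero]

theorem memLp_secondDeriv {G₀ G₀' : ℝ → ℝ} (H : D.IsFlow m K μ G₀ G₀' l G G1 G2) (hμ : 0 < μ)
    (f₀ : H2) (hl₀ : 0 < l₀) : MemLp (secondDeriv f₀ l₀ G2) 2 :=
  (H.memLp_indicator hμ).add (memLp_initialPart f₀ hl₀)

theorem intervalIntegrable_secondDeriv {G₀ G₀' : ℝ → ℝ} (H : D.IsFlow m K μ G₀ G₀' l G G1 G2)
    (hμ : 0 < μ) (f₀ : H2) (hl₀ : 0 < l₀) (a b : ℝ) :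
    IntervalIntegrable (secondDeriv f₀ l₀ G2) volume a b := by
  rw [intervalIntegrable_iff]
  have hw : MemLp (secondDeriv f₀ l₀ G2) 2 (volume.restrict (uIoc a b)) :=
    (H.memLp_secondDeriv hμ f₀ hl₀).restrict _
  have : IsFiniteMeasure (volume.restrict (uIoc a b)) := by
    unfold uIoc
    infer_instance
  exact hw.integrable one_le_two

/-- `G1` is continuous across `0`, so the contributions of the two pieces add up. The restriction `ξ
≤ l₀` is needed because `secondDeriv` vanishes beyond the initial datum. -/
theorem G1_sub_eq_integral
    (H : D.IsFlow m K μ (fun ξ => f₀.ext (ξ / l₀)) (fun ξ => f₀.extDeriv (ξ / l₀) / l₀) l G G1 G2)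
    (hμ : 0 < μ) (hl₀ : 0 < l₀) {b ξ : ℝ} (hb : 0 ≤ b) (hbξ : -b ≤ ξ) (hξ : ξ ≤ l₀) :
    G1 ξ = G1 (-b) + ∫ y in (-b)..ξ, secondDeriv f₀ l₀ G2 y := by
  have hG2int := H.intervalIntegrable_secondDeriv hμ f₀ hl₀
  have hneg : ∀ ξ, -b ≤ ξ → ξ ≤ 0 →
      ∫ y in (-b)..ξ, secondDeriv f₀ l₀ G2 y = G1 ξ - G1 (-b) := by
    intro ξ h1 h2
    refine intervalIntegral.integral_eq_sub_of_hasDerivAt_of_le h1 H.cont_G1.continuousOn ?_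
      (hG2int _ _)
    intro x hx
    have hx0 : x < 0 := hx.2.trans_le h2
    rw [secondDeriv, indicator_of_mem (mem_Iio.2 hx0), initialPart_of_neg f₀ hl₀ hx0.le, add_zero]
    exact H.deriv_G1 x hx0
  rcases le_total ξ 0 with h | h
  · rw [hneg ξ hbξ h]; ring
  · rw [← intervalIntegral.integral_add_adjacent_intervals (hG2int (-b) 0) (hG2int 0 ξ),
      hneg 0 (by linarith) le_rfl]
    have h1 : ∫ y in (0 : ℝ)..ξ, secondDeriv f₀ l₀ G2 y
        = ∫ y in (0 : ℝ)..ξ, (fun x => f₀.d2 x / l₀ ^ 2) (y / l₀) := by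
      apply intervalIntegral.integral_congr_ae
      filter_upwards [Measure.ae_ne volume l₀] with y hy hy'
      rw [uIoc_of_le h] at hy'
      have hmem : y / l₀ ∈ Ioo (0 : ℝ) 1 :=
        ⟨div_pos hy'.1 hl₀, (div_lt_one hl₀).2 (lt_of_le_of_ne (hy'.2.trans hξ) hy)⟩
      rw [secondDeriv, indicator_of_notMem (by simpa using hy'.1.le), initialPart,
        indicator_of_mem hmem, zero_add]
    have hx : ξ / l₀ ∈ Icc (0 : ℝ) 1 := ⟨div_nonneg h hl₀.le, (div_le_one hl₀).2 hξ⟩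
    rw [h1, intervalIntegral.integral_comp_div (fun x => f₀.d2 x / l₀ ^ 2) hl₀.ne', zero_div,
      intervalIntegral.integral_div, H.G1_nonneg ξ h, H.G1_nonneg 0 le_rfl, zero_div,
      f₀.extDeriv_of_mem hx, f₀.extDeriv_of_mem (left_mem_Icc.2 zero_le_one),
      f₀.d1_eq_integral _ hx, smul_eq_mul]
    field_simp
    ring

theorem continuous_G {G₀ G₀' : ℝ → ℝ} (H : D.IsFlow m K μ G₀ G₀' l G G1 G2) : Continuous G :=
  continuous_iff_continuousAt.2 fun ξ => (H.deriv_G ξ).continuousAt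

/-- With `a = l(s)` and `b = s` this is the state at transported length `s`. -/
theorem exists_H2
    (H : D.IsFlow m K μ (fun ξ => f₀.ext (ξ / l₀)) (fun ξ => f₀.extDeriv (ξ / l₀) / l₀) l G G1 G2)
    (hμ : 0 < μ) (hl₀ : 0 < l₀) {a b : ℝ} (ha : 0 < a) (hb : 0 ≤ b) (hab : a - b ≤ l₀) :
    ∃ u : H2, u.val = (fun x => G (a * x - b)) ∧ u.d1 = (fun x => a * G1 (a * x - b)) ∧
      u.d2 = fun x => a ^ 2 * secondDeriv f₀ l₀ G2 (a * x - b) := by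
  have hGc := H.continuous_G
  have hG1c := H.cont_G1
  have hc1 : Continuous fun x => a * G1 (a * x - b) := by fun_prop
  have hm : MemLp (fun x => a ^ 2 * secondDeriv f₀ l₀ G2 (a * x - b)) 2
      (volume.restrict (Ioo (0 : ℝ) 1)) :=
    (memLp_restrict_comp_mul_sub (H.memLp_secondDeriv hμ f₀ hl₀) ha).const_mul _
  refine ⟨⟨fun x => G (a * x - b), fun x => a * G1 (a * x - b),
    fun x => a ^ 2 * secondDeriv f₀ l₀ G2 (a * x - b), by fun_prop, hc1.continuousOn, hm, ?_, ?_⟩,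
    rfl, rfl, rfl⟩
  · apply hasWeakDeriv_of_eq_integral (hc1.intervalIntegrable _ _)
    intro x _
    rw [intervalIntegral.integral_eq_sub_of_hasDerivAt (f := fun x => G (a * x - b)) _
      (hc1.intervalIntegrable _ _)]
    · ring
    · intro y _
      have := HasDerivAt.comp (h := fun y => a * y - b) y (H.deriv_G (a * y - b))
        (((hasDerivAt_id y).const_mul a).sub_const b)
      convert! this using 1
      ring
  · apply hasWeakDeriv_of_eq_integral (intervalIntegrable_of_memLp hm)
    intro x hx
    rw [intervalIntegral.integral_const_mul,
      intervalIntegral.integral_comp_mul_sub (secondDeriv f₀ l₀ G2) ha.ne', smul_eq_mul]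
    have h1 : -b ≤ a * x - b := by nlinarith [hx.1]
    have h2 : a * x - b ≤ l₀ := by nlinarith [hx.2]
    have := H.G1_sub_eq_integral hμ hl₀ hb h1 h2
    rw [this, mul_zero, zero_sub]
    field_simp

/-- Quadratic decay of the second derivative in `L²`. -/
theorem integral_secondDeriv_sq_le {G₀ G₀' : ℝ → ℝ} (H : D.IsFlow m K μ G₀ G₀' l G G1 G2)
    (hμ : 0 < μ) (hl₀ : 0 < l₀) {a b Λ lam : ℝ} (hlam : 0 < lam) (hal : lam ≤ a) (hll : lam ≤ l₀)
    (haΛ : a ≤ Λ) (hK : 0 ≤ K) (hm : 0 ≤ m)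
    (hf : ∫ x in (0 : ℝ)..1, f₀.d2 x ^ 2 ≤ m ^ 2) :
    ∫ x in (0 : ℝ)..1, secondDeriv f₀ l₀ G2 (a * x - b) ^ 2
      ≤ (2 * K ^ 2 + 2 * (lam ^ 4)⁻¹) * (m * Real.exp (μ * (Λ - b))) ^ 2 := by
  have ha : 0 < a := hlam.trans_le hal
  set E := m * Real.exp (μ * (Λ - b)) with hE
  have hE0 : 0 ≤ E := by positivity
  have i1 := intervalIntegrable_sq_of_memLp (memLp_restrict_comp_mul_sub (a := a) (b := b)
    (H.memLp_secondDeriv hμ f₀ hl₀) ha)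
  have i2 := intervalIntegrable_sq_of_memLp (memLp_restrict_comp_mul_sub (a := a) (b := b)
    (memLp_initialPart f₀ hl₀) ha)
  have hpt : ∀ x ∈ Icc (0 : ℝ) 1, secondDeriv f₀ l₀ G2 (a * x - b) ^ 2
      ≤ 2 * (K * E) ^ 2 + 2 * initialPart f₀ l₀ (a * x - b) ^ 2 := by
    intro x hx
    have hneg : |(Iio (0 : ℝ)).indicator G2 (a * x - b)| ≤ K * E := by
      by_cases h : a * x - b ∈ Iio (0 : ℝ)
      · rw [indicator_of_mem h]
        have h1 := H.G2_decay (-(a * x - b)) (by linarith [mem_Iio.1 h])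
        rw [neg_neg] at h1
        refine h1.trans (mul_le_mul_of_nonneg_left (mul_le_mul_of_nonneg_left
          (Real.exp_le_exp.2 ?_) hm) hK)
        have : a * x ≤ Λ := by nlinarith [hx.2]
        nlinarith
      · rw [indicator_of_notMem h, abs_zero]; positivity
    have h2 := pow_le_pow_left₀ (abs_nonneg _) hneg 2
    rw [sq_abs] at h2
    unfold secondDeriv
    nlinarith [sq_nonneg ((Iio (0 : ℝ)).indicator G2 (a * x - b) - initialPart f₀ l₀ (a * x - b))]
  have hmono := intervalIntegral.integral_mono_on zero_le_one i1
    ((by simp : IntervalIntegrable (fun _ => 2 * (K * E) ^ 2) volume 0 1).add (i2.const_mul 2)) hpt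
  rw [intervalIntegral.integral_add (by simp) (i2.const_mul 2)] at hmono
  simp only [intervalIntegral.integral_const_mul, intervalIntegral.integral_const, sub_zero,
    smul_eq_mul, one_mul] at hmono
  have hpos : ∫ x in (0 : ℝ)..1, initialPart f₀ l₀ (a * x - b) ^ 2 ≤ (lam ^ 4)⁻¹ * E ^ 2 := by
    -- The initial datum is visible only while `b ≤ a`. The exponential in `E` is then at least `1`,
    -- so no decay has to be proved for this part; afterwards all arguments are nonpositive and the
    -- part vanishes.
    by_cases hba : b ≤ a
    · have h1 := integral_sq_comp_le (memLp_initialPart f₀ hl₀).integrable_sq (b := b) ha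
      rw [integral_initialPart_sq f₀ hl₀] at h1
      have h2 : m ^ 2 ≤ E ^ 2 := by
        refine pow_le_pow_left₀ hm ?_ 2
        exact le_mul_of_one_le_right hm (Real.one_le_exp (mul_nonneg hμ.le (by linarith)))
      have h3 : a⁻¹ * (l₀ ^ 3)⁻¹ ≤ (lam ^ 4)⁻¹ := by
        rw [← mul_inv]
        apply inv_anti₀ (by positivity)
        calc lam ^ 4 = lam * lam ^ 3 := by ring
          _ ≤ a * l₀ ^ 3 := mul_le_mul hal (pow_le_pow_left₀ hlam.le hll 3) (by positivity) ha.le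
      refine h1.trans ?_
      rw [← mul_assoc]
      exact mul_le_mul h3 (hf.trans h2) (H2.integral_sq_nonneg f₀.d2) (by positivity)
    · have h1 : ∫ x in (0 : ℝ)..1, initialPart f₀ l₀ (a * x - b) ^ 2 = 0 := by
        have h2 : ∀ x ∈ uIcc (0 : ℝ) 1, initialPart f₀ l₀ (a * x - b) ^ 2 = 0 := by
          intro x hx
          rw [uIcc_of_le zero_le_one] at hx
          rw [initialPart_of_neg f₀ hl₀ (by nlinarith [hx.2]), zero_pow two_ne_zero]
        rw [intervalIntegral.integral_congr h2]
        simp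
      rw [h1]
      positivity
  nlinarith

end DelayModel.IsFlow

/-- Solvability of `Θ' = v(Θ)`, `Θ(0) = 0` for a continuous `v` bounded above and below. -/
theorem exists_timeChange {v : ℝ → ℝ} (hv : Continuous v) {c C : ℝ} (hc : 0 < c)
    (h1 : ∀ s, c ≤ v s) (h2 : ∀ s, v s ≤ C) :
    ∃ Θ : ℝ → ℝ, Θ 0 = 0 ∧ (∀ t, HasDerivAt Θ (v (Θ t)) t) ∧ ∀ t, 0 ≤ t → c * t ≤ Θ t := by
  have hpos : ∀ s, 0 < v s := fun s => hc.trans_le (h1 s)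
  have hC : 0 < C := (hpos 0).trans_le (h2 0)
  have hci : Continuous fun s => (v s)⁻¹ := hv.inv₀ fun s => (hpos s).ne'
  -- Separation of variables: `Θ` is the inverse of `τ`, for which continuity of `v` suffices.
  set τ : ℝ → ℝ := fun s => ∫ σ in (0 : ℝ)..s, (v σ)⁻¹ with hτ
  have hd : ∀ s, HasDerivAt τ (v s)⁻¹ s := fun s =>
    intervalIntegral.integral_hasDerivAt_right (hci.intervalIntegrable _ _)
      (hci.stronglyMeasurableAtFilter _ _) hci.continuousAt
  have hτ0 : τ 0 = 0 := by simp [hτ]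
  have hmono : StrictMono τ := strictMono_of_deriv_pos fun s => by
    rw [(hd s).deriv]; exact inv_pos.2 (hpos s)
  have hcont : Continuous τ := continuous_iff_continuousAt.2 fun s => (hd s).continuousAt
  have hm2 : Monotone fun s => τ s - C⁻¹ * s := by
    have hd2 : ∀ s, HasDerivAt (fun s => τ s - C⁻¹ * s) ((v s)⁻¹ - C⁻¹ * 1) s := fun s =>
      (hd s).sub ((hasDerivAt_id s).const_mul _)
    refine monotone_of_deriv_nonneg (fun s => (hd2 s).differentiableAt) fun s => ?_
    rw [(hd2 s).deriv, mul_one, sub_nonneg]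
    exact inv_anti₀ (hpos s) (h2 s)
  have htop : Tendsto τ atTop atTop := by
    refine tendsto_atTop_mono' _ ?_ (tendsto_id.const_mul_atTop (inv_pos.2 hC))
    filter_upwards [eventually_ge_atTop 0] with s hs
    have := hm2 hs
    simp only [hτ0, mul_zero, sub_zero] at this
    simp only [id]
    linarith
  have hbot : Tendsto τ atBot atBot := by
    refine tendsto_atBot_mono' _ ?_ (tendsto_id.const_mul_atBot (inv_pos.2 hC))
    filter_upwards [eventually_le_atBot 0] with s hs
    have := hm2 hs
    simp only [hτ0, mul_zero, sub_zero] at this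
    simp only [id]
    linarith
  set I := hmono.orderIsoOfSurjective τ (hcont.surjective htop hbot) with hI
  have hinv : ∀ t, τ (I.symm t) = t := fun t => I.apply_symm_apply t
  have hder : ∀ t, HasDerivAt I.symm (v (I.symm t)) t := by
    intro t
    have := HasDerivAt.of_local_left_inverse (f := τ) (g := I.symm) (a := t)
      I.symm.continuous.continuousAt (hd _) (inv_ne_zero (hpos _).ne')
      (Eventually.of_forall hinv)
    rwa [inv_inv] at this
  have h00 : I.symm 0 = 0 := by
    apply hmono.injective
    rw [hinv, hτ0]
  refine ⟨I.symm, h00, hder, ?_⟩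
  have hm3 : Monotone fun t => I.symm t - c * t := by
    have hd3 : ∀ t, HasDerivAt (fun t => I.symm t - c * t) (v (I.symm t) - c * 1) t := fun t =>
      (hder t).sub ((hasDerivAt_id t).const_mul _)
    refine monotone_of_deriv_nonneg (fun t => (hd3 t).differentiableAt) fun t => ?_
    rw [(hd3 t).deriv, mul_one, sub_nonneg]
    exact h1 _
  intro t ht
  have := hm3 ht
  simp only [h00, mul_zero, sub_zero] at this
  linarith

namespace DelayModel.IsFlow

variable {D : DelayModel} {m K μ l₀ : ℝ} {f₀ : H2} {l G G1 G2 G₀ G₀' : ℝ → ℝ}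

theorem tendsto_distSq (H : D.IsFlow m K μ G₀ G₀' l G G1 G2) (hμ : 0 < μ) (hl₀ : 0 < l₀)
    {ι : Type*} {F : Filter ι} {a b : ι → ℝ} {u : ι → H2} {a₀ b₀ : ℝ} {u₀ : H2}
    (hpos : ∀ i, 0 < a i) (ha₀ : 0 < a₀)
    (hu : ∀ i, (u i).val = (fun x => G (a i * x - b i)) ∧
      (u i).d1 = (fun x => a i * G1 (a i * x - b i)) ∧
      (u i).d2 = fun x => a i ^ 2 * secondDeriv f₀ l₀ G2 (a i * x - b i))
    (hu₀ : u₀.val = (fun x => G (a₀ * x - b₀)) ∧ u₀.d1 = (fun x => a₀ * G1 (a₀ * x - b₀)) ∧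
      u₀.d2 = fun x => a₀ ^ 2 * secondDeriv f₀ l₀ G2 (a₀ * x - b₀))
    (ha : Tendsto a F (𝓝 a₀)) (hb : Tendsto b F (𝓝 b₀)) :
    Tendsto (fun i => (u i).distSq u₀) F (𝓝 0) := by
  have hGc := H.continuous_G
  have hG1c := H.cont_G1
  have t1 : Tendsto (fun i => ∫ x in (0 : ℝ)..1, ((u i).val x - u₀.val x) ^ 2) F (𝓝 0) := by
    have hc : Continuous fun q : ℝ × ℝ =>
        ∫ x in (0 : ℝ)..1, (G (q.1 * x - q.2) - G (a₀ * x - b₀)) ^ 2 := by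
      apply intervalIntegral.continuous_parametric_intervalIntegral_of_continuous'
      fun_prop
    have := (hc.tendsto (a₀, b₀)).comp (ha.prodMk_nhds hb)
    simpa [Function.comp_def, (hu _).1, hu₀.1] using this
  have t2 : Tendsto (fun i => ∫ x in (0 : ℝ)..1, ((u i).d1 x - u₀.d1 x) ^ 2) F (𝓝 0) := by
    have hc : Continuous fun q : ℝ × ℝ =>
        ∫ x in (0 : ℝ)..1, (q.1 * G1 (q.1 * x - q.2) - a₀ * G1 (a₀ * x - b₀)) ^ 2 := by
      apply intervalIntegral.continuous_parametric_intervalIntegral_of_continuous'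
      fun_prop
    have := (hc.tendsto (a₀, b₀)).comp (ha.prodMk_nhds hb)
    simpa [Function.comp_def, (hu _).2.1, hu₀.2.1] using this
  have t3 : Tendsto (fun i => ∫ x in (0 : ℝ)..1, ((u i).d2 x - u₀.d2 x) ^ 2) F (𝓝 0) := by
    set w := secondDeriv f₀ l₀ G2 with hw
    have hwm : MemLp w 2 := H.memLp_secondDeriv hμ f₀ hl₀
    set J := ∫ x in (0 : ℝ)..1, w (a₀ * x - b₀) ^ 2 with hJ
    -- The difference of second derivatives splits into `a i ^ 2` times a difference of translates
    -- and dilates of `w`, plus `a i ^ 2 - a₀ ^ 2` times the fixed function.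
    have hlim : Tendsto (fun i => 2 * a i ^ 4
        * (∫ x in (0 : ℝ)..1, (w (a i * x - b i) - w (a₀ * x - b₀)) ^ 2)
        + 2 * (a i ^ 2 - a₀ ^ 2) ^ 2 * J) F (𝓝 0) := by
      have := (((ha.pow 4).const_mul 2).mul (tendsto_integral_sq_comp_sub hwm ha₀ ha hb)).add
        (((((ha.pow 2).sub_const (a₀ ^ 2)).pow 2).const_mul 2).mul_const J)
      simpa using this
    refine squeeze_zero (fun i => H2.integral_sq_nonneg fun x => (u i).d2 x - u₀.d2 x)
      (fun i => ?_) hlim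
    have m1 := intervalIntegrable_sq_of_memLp
      ((memLp_restrict_comp_mul_sub hwm (b := b i) (hpos i)).sub
        (memLp_restrict_comp_mul_sub hwm (b := b₀) ha₀))
    have m2 := intervalIntegrable_sq_of_memLp (memLp_restrict_comp_mul_sub hwm (b := b₀) ha₀)
    have m3 := intervalIntegrable_sq_of_memLp ((u i).memLp_d2.sub u₀.memLp_d2)
    have hle := intervalIntegral.integral_mono_on zero_le_one m3
      ((m1.const_mul (2 * a i ^ 4)).add (m2.const_mul (2 * (a i ^ 2 - a₀ ^ 2) ^ 2)))
      (fun x _ => by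
        simp only [Pi.sub_apply, (hu i).2.2, hu₀.2.2]
        generalize w (a i * x - b i) = y
        generalize w (a₀ * x - b₀) = z
        nlinarith [sq_nonneg (a i ^ 2 * (y - z) - (a i ^ 2 - a₀ ^ 2) * z)])
    rw [intervalIntegral.integral_add (m1.const_mul (2 * a i ^ 4))
      (m2.const_mul (2 * (a i ^ 2 - a₀ ^ 2) ^ 2))] at hle
    simp only [intervalIntegral.integral_const_mul] at hle
    exact hle
  have := (t1.add t2).add t3
  simpa [H2.distSq] using this

/-- For negative `ξ` the decay gives `exp (μ * ξ)`; for positive `ξ` the bound `c` is nonnegative,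
so the exponential is at least `1` and the bound on the datum suffices. -/
theorem abs_G_sub_le (H : D.IsFlow m K μ G₀ G₀' l G G1 G2) (hμ : 0 < μ) (hK : 0 ≤ K) (hm : 0 ≤ m)
    (hG : ∀ ξ ∈ Icc 0 l₀, |G₀ ξ - D.fe| ≤ m) {ξ c : ℝ} (hξ : ξ ≤ l₀) (hξc : ξ ≤ c) :
    |G ξ - D.fe| ≤ (K + 1) * (m * Real.exp (μ * c)) := by
  have hE : 0 ≤ m * Real.exp (μ * c) := by positivity
  rcases le_total ξ 0 with h | h
  · have h1 := H.G_decay (-ξ) (by linarith)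
    rw [neg_neg] at h1
    refine h1.trans (mul_le_mul (by linarith) (mul_le_mul_of_nonneg_left
      (Real.exp_le_exp.2 ?_) hm) (by positivity) (by linarith))
    nlinarith
  · rw [H.G_nonneg ξ h]
    refine (hG ξ ⟨h, hξ⟩).trans ?_
    have h2 : m ≤ m * Real.exp (μ * c) :=
      le_mul_of_one_le_right hm (Real.one_le_exp (mul_nonneg hμ.le (h.trans hξc)))
    nlinarith

theorem abs_G1_le (H : D.IsFlow m K μ G₀ G₀' l G G1 G2) (hμ : 0 < μ) (hK : 0 ≤ K) (hm : 0 ≤ m)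
    (hG : ∀ ξ, |G₀' ξ| ≤ m) {ξ c : ℝ} (hξc : ξ ≤ c) :
    |G1 ξ| ≤ (K + 1) * (m * Real.exp (μ * c)) := by
  have hE : 0 ≤ m * Real.exp (μ * c) := by positivity
  rcases le_total ξ 0 with h | h
  · have h1 := H.G1_decay (-ξ) (by linarith)
    rw [neg_neg] at h1
    refine h1.trans (mul_le_mul (by linarith) (mul_le_mul_of_nonneg_left
      (Real.exp_le_exp.2 ?_) hm) (by positivity) (by linarith))
    nlinarith
  · rw [H.G1_nonneg ξ h]
    refine (hG ξ).trans ?_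
    have h2 : m ≤ m * Real.exp (μ * c) :=
      le_mul_of_one_le_right hm (Real.one_le_exp (mul_nonneg hμ.le (h.trans hξc)))
    nlinarith

theorem integral_sq_le_of_abs_le {w : ℝ → ℝ} (hw : ContinuousOn w (Icc 0 1)) {c : ℝ}
    (h : ∀ x ∈ Icc (0 : ℝ) 1, |w x| ≤ c) : ∫ x in (0 : ℝ)..1, w x ^ 2 ≤ c ^ 2 := by
  have hi : IntervalIntegrable (fun x => w x ^ 2) volume 0 1 :=
    ContinuousOn.intervalIntegrable (by rw [uIcc_of_le zero_le_one]; exact hw.pow 2)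
  have := intervalIntegral.integral_mono_on zero_le_one hi
    (by simp : IntervalIntegrable (fun _ => c ^ 2) volume 0 1) fun x hx => by
      have := pow_le_pow_left₀ (abs_nonneg _) (h x hx) 2
      rwa [sq_abs] at this
  simpa using this

/-- All arguments `a * x - b` are at most `Λ - b`, so a single exponential bounds the value and both
derivatives. -/
theorem distSq_const_le (H : D.IsFlow m K μ G₀ G₀' l G G1 G2)
    (hμ : 0 < μ) (hK : 0 ≤ K) (hm : 0 ≤ m) (hG : ∀ ξ ∈ Icc 0 l₀, |G₀ ξ - D.fe| ≤ m)
    (hG' : ∀ ξ, |G₀' ξ| ≤ m) (hf : ∫ x in (0 : ℝ)..1, f₀.d2 x ^ 2 ≤ m ^ 2)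
    {a b Λ lam : ℝ} (hlam : 0 < lam) (hal : lam ≤ a) (hll : lam ≤ l₀) (haΛ : a ≤ Λ)
    (hab : a - b ≤ l₀) {u : H2} (hu : u.val = (fun x => G (a * x - b)) ∧
      u.d1 = (fun x => a * G1 (a * x - b)) ∧
      u.d2 = fun x => a ^ 2 * secondDeriv f₀ l₀ G2 (a * x - b)) :
    u.distSq (H2.const D.fe) ≤ ((K + 1) ^ 2 + (Λ * (K + 1)) ^ 2
      + Λ ^ 4 * (2 * K ^ 2 + 2 * (lam ^ 4)⁻¹)) * (m * Real.exp (μ * (Λ - b))) ^ 2 := by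
  have ha : 0 < a := hlam.trans_le hal
  have hΛ : 0 < Λ := ha.trans_le haΛ
  have hl₀ : 0 < l₀ := hlam.trans_le hll
  set E := m * Real.exp (μ * (Λ - b)) with hE
  have hE0 : 0 ≤ E := by positivity
  have hx1 : ∀ x ∈ Icc (0 : ℝ) 1, a * x - b ≤ l₀ := fun x hx => by nlinarith [hx.2]
  have hx2 : ∀ x ∈ Icc (0 : ℝ) 1, a * x - b ≤ Λ - b := fun x hx => by nlinarith [hx.2]
  have e1 : ∫ x in (0 : ℝ)..1, (u.val x - (H2.const D.fe).val x) ^ 2 ≤ ((K + 1) * E) ^ 2 := by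
    apply integral_sq_le_of_abs_le (w := fun x => u.val x - D.fe)
      (u.continuousOn_val.sub continuousOn_const)
    intro x hx
    rw [hu.1]
    exact H.abs_G_sub_le hμ hK hm hG (hx1 x hx) (hx2 x hx)
  have e2 : ∫ x in (0 : ℝ)..1, (u.d1 x - (H2.const D.fe).d1 x) ^ 2
      ≤ (Λ * ((K + 1) * E)) ^ 2 := by
    apply integral_sq_le_of_abs_le (w := fun x => u.d1 x - 0)
      (u.continuousOn_d1.sub continuousOn_const)
    intro x hx
    rw [hu.2.1, sub_zero, abs_mul, abs_of_pos ha]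
    exact mul_le_mul haΛ (H.abs_G1_le hμ hK hm hG' (hx2 x hx)) (abs_nonneg _) hΛ.le
  have e3 : ∫ x in (0 : ℝ)..1, (u.d2 x - (H2.const D.fe).d2 x) ^ 2
      ≤ Λ ^ 4 * ((2 * K ^ 2 + 2 * (lam ^ 4)⁻¹) * E ^ 2) := by
    have h1 : ∫ x in (0 : ℝ)..1, (u.d2 x - (H2.const D.fe).d2 x) ^ 2
        = a ^ 4 * ∫ x in (0 : ℝ)..1, secondDeriv f₀ l₀ G2 (a * x - b) ^ 2 := by
      rw [← intervalIntegral.integral_const_mul]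
      congr 1
      ext x
      simp only [hu.2.2, H2.const]
      ring
    rw [h1]
    exact mul_le_mul (pow_le_pow_left₀ ha.le haΛ 4)
      (H.integral_secondDeriv_sq_le hμ hl₀ hlam hal hll haΛ hK hm hf)
      (H2.integral_sq_nonneg fun x => secondDeriv f₀ l₀ G2 (a * x - b)) (by positivity)
  unfold H2.distSq
  refine (add_le_add (add_le_add e1 e2) e3).trans (le_of_eq ?_)
  ring

end DelayModel.IsFlow

/-! ### Compatibility conditions and global existence with decay -/

namespace Equilibrium

variable {p : Params} {e : Equilibrium p}

theorem deviation_nonneg (e : Equilibrium p) (l : ℝ) (f : H2) : 0 ≤ e.deviation l f :=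
  add_nonneg (sq_nonneg _) (H2.distSq_nonneg _ _)

/-- The compatibility conditions in terms of `inlet` and `rate`. -/
theorem Compatible.eq {k₁ k₂ l₀ : ℝ} {f₀ : H2} (h : e.Compatible k₁ k₂ l₀ f₀)
    (hk : 1 - k₁ * p.unitPress e.l ≠ 0) (hl₀ : l₀ ∈ Ioo 0 p.L) :
    f₀.val 0 = e.inlet k₁ k₂ l₀ ∧
      f₀.d1 0 / l₀ = -(e.inletSlope k₁ k₂ * p.unitPress' l₀ * p.rate l₀ (f₀.val 1)) := by
  obtain ⟨N, Fi, dl, dP, dN, dFi, hfb, rfl, hdP, rfl, rfl, h0, h1⟩ := h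
  obtain ⟨hg, rfl, rfl⟩ := (feedback_iff hk).1 hfb
  have hin := inflow_div (k₂ := k₂) hk hg
  have hN := screw_ne_zero hk hg
  rw [hin] at h0
  refine ⟨h0, ?_⟩
  have d1 : deriv (fun l => p.press (e.screw k₁ l₀) l) l₀
      = e.screw k₁ l₀ * p.unitPress' l₀ := by
    simp only [Params.press_eq]
    exact ((p.hasDerivAt_unitPress hl₀.2).const_mul _).deriv
  have d2 : deriv (fun n => p.press n l₀) (e.screw k₁ l₀) = p.unitPress l₀ := by
    simp only [Params.press_eq]
    exact ((hasDerivAt_id _).mul_const _).deriv.trans (one_mul _)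
  rw [d1, d2, Params.vel_eq] at hdP
  have hρ := p.ρ_pos.ne'
  have hV := p.V_pos.ne'
  have hζ := p.ζ_pos.ne'
  have hl := hl₀.1.ne'
  obtain ⟨n, hn⟩ : ∃ n, n = e.screw k₁ l₀ := ⟨_, rfl⟩
  rw [← hn] at hdP h1 hin hN
  have hFi : e.inflow k₁ k₂ l₀ = e.inlet k₁ k₂ l₀ * (p.ρ * p.V * n) := by
    rw [← hin]; field_simp
  -- Differentiating the feedback puts the factor `1 - k₁ * unitPress l₀` in front of `dP`; the same
  -- factor appears here, so it is absorbed without a division.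
  have hslope : (k₂ - e.inlet k₁ k₂ l₀ * (p.ρ * p.V) * k₁)
      = p.ρ * p.V * (e.inletSlope k₁ k₂ * (1 - k₁ * p.unitPress l₀)) := by
    have hs : e.inletSlope k₁ k₂ * (p.ρ * p.V * (1 - k₁ * p.unitPress e.l))
        = k₂ - e.f * p.ρ * p.V * k₁ := by
      unfold inletSlope
      field_simp
    unfold inlet
    linear_combination -hs
  have hdP' : (1 - k₁ * p.unitPress l₀) * dP
      = n * p.unitPress' l₀ * (p.ζ * n * p.rate l₀ (f₀.val 1)) := by
    linear_combination hdP
  rw [hFi] at h1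
  have e1 : (k₂ * dP * n - e.inlet k₁ k₂ l₀ * (p.ρ * p.V * n) * (k₁ * dP)) / (p.ρ * p.V * n ^ 2)
      = p.ζ * n * (e.inletSlope k₁ k₂ * p.unitPress' l₀ * p.rate l₀ (f₀.val 1)) := by
    have e2 : k₂ * dP * n - e.inlet k₁ k₂ l₀ * (p.ρ * p.V * n) * (k₁ * dP)
        = n * dP * (k₂ - e.inlet k₁ k₂ l₀ * (p.ρ * p.V) * k₁) := by ring
    rw [e2, hslope, div_eq_iff (by positivity)]
    linear_combination n * (p.ρ * p.V) * e.inletSlope k₁ k₂ * hdP'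
  rw [e1] at h1
  have h2 : p.ζ * n * (e.inletSlope k₁ k₂ * p.unitPress' l₀ * p.rate l₀ (f₀.val 1)
      + f₀.d1 0 / l₀) = 0 := by
    linear_combination h1
  rcases mul_eq_zero.1 h2 with h3 | h3
  · exact absurd h3 (mul_ne_zero hζ hN)
  · linarith

theorem mem_timeInterval_top {t : ℝ} : t ∈ timeInterval ⊤ ↔ 0 ≤ t := by
  simp [timeInterval, EReal.coe_lt_top]

end Equilibrium

namespace Equilibrium

variable {p : Params} {e : Equilibrium p}

/-- By the Sobolev inequality values and derivatives are at most twice the root of the deviation;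
rescaling from `(0,1)` to `(0, l₀)` costs `1 / l₀ ≤ 1 / lam` for the derivative. -/
theorem bounds_of_deviation (e : Equilibrium p) {l₀ lam : ℝ} {f₀ : H2} (hlam : 0 < lam)
    (hll : lam ≤ l₀) {m : ℝ} (hm : m = (2 + 2 / lam) * √(e.deviation l₀ f₀)) :
    |l₀ - e.l| ≤ m ∧ (∀ ξ, |f₀.extDeriv (ξ / l₀) / l₀| ≤ m) ∧
      (∀ ξ ∈ Icc 0 l₀, |f₀.ext (ξ / l₀) - e.f| ≤ m) ∧ ∫ x in (0 : ℝ)..1, f₀.d2 x ^ 2 ≤ m ^ 2 := by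
  have hl₀ : 0 < l₀ := hlam.trans_le hll
  obtain ⟨δ, hδ⟩ : ∃ δ, δ = √(e.deviation l₀ f₀) := ⟨_, rfl⟩
  have hδ0 : 0 ≤ δ := by rw [hδ]; exact Real.sqrt_nonneg _
  have hδ2 : δ ^ 2 = e.deviation l₀ f₀ := by rw [hδ]; exact Real.sq_sqrt (e.deviation_nonneg _ _)
  rw [← hδ] at hm
  have hd : e.deviation l₀ f₀ = (l₀ - e.l) ^ 2 + f₀.distSq (H2.const e.f) := by
    rw [deviation, sq_abs]
  have hd0 := H2.distSq_nonneg f₀ (H2.const e.f)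
  have hdist : f₀.distSq (H2.const e.f) ≤ δ ^ 2 := by nlinarith [sq_nonneg (l₀ - e.l)]
  have h2δ : 2 * δ ≤ m := by
    rw [hm]
    have : 0 ≤ 2 / lam * δ := by positivity
    linarith
  refine ⟨?_, ?_, ?_, ?_⟩
  · have : |l₀ - e.l| ≤ δ := abs_le_of_sq_le_sq (by linarith) hδ0
    linarith
  · intro ξ
    have h1 := f₀.sq_d1_sub_le (H2.const e.f) (projIcc (0 : ℝ) 1 zero_le_one (ξ / l₀)).2
    have h2 : |f₀.extDeriv (ξ / l₀)| ≤ 2 * δ := by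
      apply abs_le_of_sq_le_sq _ (by positivity)
      simp only [H2.const, sub_zero] at h1
      unfold H2.extDeriv
      simp only [H2.const] at hdist
      nlinarith
    rw [abs_div, abs_of_pos hl₀, div_le_iff₀ hl₀]
    refine h2.trans ?_
    have h3 : 2 * δ = 2 / lam * δ * lam := by field_simp
    have h4 : 2 / lam * δ ≤ m := by rw [hm]; nlinarith
    have h5 : 0 ≤ 2 / lam * δ := by positivity
    rw [h3]
    exact mul_le_mul h4 hll hlam.le (h5.trans h4)
  · intro ξ hξ
    have hx : ξ / l₀ ∈ Icc (0 : ℝ) 1 := ⟨div_nonneg hξ.1 hl₀.le, (div_le_one hl₀).2 hξ.2⟩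
    rw [f₀.ext_of_mem hx]
    have h1 := f₀.sq_val_sub_le (H2.const e.f) hx
    have h2 : |f₀.val (ξ / l₀) - e.f| ≤ 2 * δ := by
      apply abs_le_of_sq_le_sq _ (by positivity)
      have h3 : (H2.const e.f).val (ξ / l₀) = e.f := rfl
      rw [h3] at h1
      nlinarith
    linarith
  · have h1 : ∫ x in (0 : ℝ)..1, f₀.d2 x ^ 2 ≤ f₀.distSq (H2.const e.f) := by
      have i1 := H2.integral_sq_nonneg fun x => f₀.val x - (H2.const e.f).val x
      have i2 := H2.integral_sq_nonneg fun x => f₀.d1 x - (H2.const e.f).d1 x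
      simp only [H2.distSq, H2.const, sub_zero] at i1 i2 ⊢
      linarith
    nlinarith

/-- The flow in transported length is converted back to physical time. The final clause, which is
not part of the decay estimate, is the strict outflow condition on which uniqueness rests. -/
theorem exists_solution (e : Equilibrium p) {k₁ k₂ : ℝ} (hk : 1 - k₁ * e.b₂ ≠ 0)
    (hk₁ : e.a₁ + k₁ * e.a₂ * e.b₁ / (1 - k₁ * e.b₂) < 0)
    (hk₂ : |e.a₃ * e.b₁ * (k₂ - e.f * p.ρ * p.V * k₁) / (p.ρ * p.V * e.N * (1 - k₁ * e.b₂))| <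
      |e.a₁ + k₁ * e.a₂ * e.b₁ / (1 - k₁ * e.b₂)|) :
    ∃ ε : ℝ, 0 < ε ∧ ∃ M : ℝ, 0 < M ∧ ∃ γ : ℝ, 0 < γ ∧ ∀ (l₀ : ℝ) (f₀ : H2),
      e.deviation l₀ f₀ ≤ ε → e.Compatible k₁ k₂ l₀ f₀ →
      ∃ (l : ℝ → ℝ) (f : ℝ → H2) (N Fi : ℝ → ℝ),
        e.IsSolution k₁ k₂ l₀ f₀ ⊤ l f N Fi ∧
        (∀ t : ℝ, 0 ≤ t →
          e.deviation (l t) (f t) ≤ M * Real.exp (-γ * t) * e.deviation l₀ f₀) ∧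
        ∀ t : ℝ, 0 ≤ t → 0 < N t ∧ p.vel (l t) (N t) ((f t).val 1) < p.ζ * N t := by
  obtain ⟨D, hle, hfe, hR, hh, hh1, hbox⟩ := e.exists_delayModel hk hk₁ hk₂
  rw [e.b₂_eq] at hk
  obtain ⟨m₀, K, μ, hm₀, hK, hμ, hflow⟩ := D.exists_flow
  have hζ := p.ζ_pos
  have hN := e.N_pos
  have hr := D.r_pos
  obtain ⟨lam, hlam_def⟩ : ∃ x, x = D.le - D.r := ⟨_, rfl⟩
  obtain ⟨Λ, hΛ_def⟩ : ∃ x, x = D.le + D.r := ⟨_, rfl⟩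
  have hlam : 0 < lam := by rw [hlam_def]; linarith [D.r_lt]
  have hΛ : 0 < Λ := by rw [hΛ_def]; linarith [D.r_lt]
  obtain ⟨c, hc⟩ : ∃ x, x = 2 + 2 / lam := ⟨_, rfl⟩
  have hc2 : 2 ≤ c := by rw [hc]; linarith [div_pos two_pos hlam]
  have hc0 : 0 < c := by linarith
  obtain ⟨B, hB⟩ : ∃ x, x = K ^ 2 + ((K + 1) ^ 2 + (Λ * (K + 1)) ^ 2
      + Λ ^ 4 * (2 * K ^ 2 + 2 * (lam ^ 4)⁻¹)) := ⟨_, rfl⟩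
  have hB0 : 0 < B := by rw [hB]; positivity
  have hmr : 0 < min m₀ D.r := lt_min hm₀ hr
  -- The square appears because `m` is `c` times the root of the deviation; `exp (2 * (μ * Λ))` is
  -- the squared cost of the largest delay.
  refine ⟨(min m₀ D.r / c) ^ 2, by positivity, B * c ^ 2 * Real.exp (2 * (μ * Λ)), by positivity,
    μ * (p.ζ * e.N), by positivity, ?_⟩
  intro l₀ f₀ hdev hcomp
  obtain ⟨m, hm⟩ : ∃ m, m = c * √(e.deviation l₀ f₀) := ⟨_, rfl⟩
  have hm0 : 0 ≤ m := by rw [hm]; positivity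
  have hsq : √(e.deviation l₀ f₀) ≤ min m₀ D.r / c := by
    rw [Real.sqrt_le_left (by positivity)]
    exact hdev
  have hmle : m ≤ min m₀ D.r := by
    rw [le_div_iff₀ hc0] at hsq
    rw [hm]
    linarith
  have hl₀r : |l₀ - e.l| ≤ D.r := by
    have h1 : |l₀ - e.l| ≤ √(e.deviation l₀ f₀) := by
      apply Real.abs_le_sqrt
      rw [deviation, sq_abs]
      linarith [H2.distSq_nonneg f₀ (H2.const e.f)]
    have h2 : √(e.deviation l₀ f₀) ≤ m := by
      rw [hm]
      exact le_mul_of_one_le_left (Real.sqrt_nonneg _) (by linarith)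
    exact h1.trans (h2.trans (hmle.trans (min_le_right _ _)))
  have hll : lam ≤ l₀ := by
    rw [hlam_def, hle]
    linarith [(abs_le.1 hl₀r).1]
  have hl₀ : 0 < l₀ := hlam.trans_le hll
  obtain ⟨b1, b2, b3, b4⟩ := e.bounds_of_deviation hlam hll (hc ▸ hm)
  have hffe : |e.f - e.f| ≤ D.r := by simp [hr.le]
  have hl₀mem := (hbox l₀ e.f hl₀r hffe).1
  obtain ⟨q1, q2⟩ := hcomp.eq hk hl₀mem
  have hG₀d : ∀ ξ, HasDerivAt (fun ξ => f₀.ext (ξ / l₀)) (f₀.extDeriv (ξ / l₀) / l₀) ξ := by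
    intro ξ
    have := HasDerivAt.comp (h := fun ξ => ξ / l₀) ξ (f₀.hasDerivAt_ext (ξ / l₀))
      ((hasDerivAt_id ξ).div_const l₀)
    convert! this using 1
    ring
  have hG₀c : Continuous fun ξ => f₀.extDeriv (ξ / l₀) / l₀ :=
    (f₀.continuous_extDeriv.comp (continuous_id.div_const l₀)).div_const l₀
  have h0mem : (0 : ℝ) ∈ Icc (0 : ℝ) 1 := left_mem_Icc.2 zero_le_one
  have h1mem : (1 : ℝ) ∈ Icc (0 : ℝ) 1 := right_mem_Icc.2 zero_le_one
  -- The two compatibility conditions, rewritten as `q1` and `q2`, are the matching conditions at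
  -- `0`.
  obtain ⟨l, G, G1, G2, hl0, H⟩ := hflow l₀ m (fun ξ => f₀.ext (ξ / l₀))
    (fun ξ => f₀.extDeriv (ξ / l₀) / l₀) hm0 (hmle.trans (min_le_left _ _)) (by rwa [hle])
    hG₀d hG₀c b2 (by rwa [hfe])
    (by simp only [zero_div]; rw [f₀.ext_of_mem h0mem, hh, q1])
    (by
      simp only [zero_div]
      rw [f₀.extDeriv_of_mem h0mem, div_self hl₀.ne', f₀.ext_of_mem h1mem, hh1, hR, q2])
  have hlc : Continuous l := by
    refine (LipschitzWith.of_dist_le_mul (K := 1 / 2) fun x y => ?_).continuous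
    rw [Real.dist_eq, Real.dist_eq]
    simpa using H.lip_l x y
  have hlb : ∀ s, 0 ≤ s → |l s - e.l| ≤ D.r := fun s hs => hle ▸ H.l_box s hs
  have hGb : ∀ s, 0 ≤ s → |G (l s - s) - e.f| ≤ D.r := fun s hs => hfe ▸ H.G_box s hs
  have hbx := fun s hs => hbox (l s) (G (l s - s)) (hlb s hs) (hGb s hs)
  -- The box estimate holds only for `s ≥ 0`; `max σ 0` makes the speed of the time change
  -- continuous and bounded on all of `ℝ`.
  have hvc : Continuous fun σ => p.ζ * e.screw k₁ (l (max σ 0)) := by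
    refine continuous_const.mul (continuous_iff_continuousAt.2 fun σ => ?_)
    have h1 := hbx (max σ 0) (le_max_right _ _)
    exact ContinuousAt.comp (g := e.screw k₁) (continuousAt_screw h1.1.2 h1.2.2.1)
      (by fun_prop : Continuous fun σ => l (max σ 0)).continuousAt
  obtain ⟨Θ, hΘ0, hΘd, hΘc⟩ := exists_timeChange hvc (c := p.ζ * (e.N / 2)) (C := p.ζ * (2 * e.N))
    (by positivity)
    (fun σ => mul_le_mul_of_nonneg_left (hbx (max σ 0) (le_max_right _ _)).2.2.2.1 hζ.le)
    (fun σ => mul_le_mul_of_nonneg_left (hbx (max σ 0) (le_max_right _ _)).2.2.2.2 hζ.le)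
  have hΘn : ∀ t, 0 ≤ t → 0 ≤ Θ t := fun t ht => le_trans (by positivity) (hΘc t ht)
  have hΘd' : ∀ t, 0 ≤ t → HasDerivAt Θ (p.ζ * e.screw k₁ (l (Θ t))) t := by
    intro t ht
    have := hΘd t
    rwa [max_eq_left (hΘn t ht)] at this
  have hΘcont : Continuous Θ := continuous_iff_continuousAt.2 fun t => (hΘd t).continuousAt
  have hmaxn : ∀ t, 0 ≤ Θ (max t 0) := fun t => hΘn _ (le_max_right _ _)
  have hlam_le : ∀ s, 0 ≤ s → lam ≤ l s := fun s hs => by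
    rw [hlam_def, hle]; linarith [(abs_le.1 (hlb s hs)).1]
  have hle_Λ : ∀ s, 0 ≤ s → l s ≤ Λ := fun s hs => by
    rw [hΛ_def, hle]; linarith [(abs_le.1 (hlb s hs)).2]
  have hlsub : ∀ s, 0 ≤ s → l s - s ≤ l₀ := by
    intro s hs
    have := (abs_le.1 (H.lip_l s 0)).2
    rw [sub_zero, abs_of_nonneg hs, hl0] at this
    linarith
  have hex := fun t => H.exists_H2 (a := l (Θ (max t 0))) (b := Θ (max t 0)) hμ hl₀
    (hlam.trans_le (hlam_le _ (hmaxn t))) (hmaxn t) (hlsub _ (hmaxn t))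
  choose f hf using hex
  have hval : ∀ t, 0 ≤ t → ∀ x, (f t).val x = G (l (Θ t) * x - Θ t) := by
    intro t ht x
    rw [(hf t).1, max_eq_left ht]
  have hval1 : ∀ t, 0 ≤ t → (f t).val 1 = G (l (Θ t) - Θ t) := by
    intro t ht
    rw [hval t ht, mul_one]
  have hvel : ∀ t, 0 ≤ t → p.vel (l (Θ t)) (e.screw k₁ (l (Θ t))) ((f t).val 1)
      = p.ζ * e.screw k₁ (l (Θ t)) * D.R (l (Θ t)) (G (l (Θ t) - Θ t)) := by
    intro t ht
    rw [Params.vel_eq, hval1 t ht, hR]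
  have hlder : ∀ t, 0 ≤ t → HasDerivAt (fun t => l (Θ t))
      (p.vel (l (Θ t)) (e.screw k₁ (l (Θ t))) ((f t).val 1)) t := by
    intro t ht
    have := HasDerivAt.comp t (H.deriv_l (Θ t) (hΘn t ht)) (hΘd' t ht)
    convert! this using 1
    rw [hvel t ht]
    ring
  have hscrew : ∀ t, 0 ≤ t → 0 < e.screw k₁ (l (Θ t)) := fun t ht => by
    linarith [(hbx (Θ t) (hΘn t ht)).2.2.2.1]
  refine ⟨fun t => l (Θ t), f, fun t => e.screw k₁ (l (Θ t)), fun t => e.inflow k₁ k₂ (l (Θ t)),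
    ?_, ?_, ?_⟩
  · refine ⟨⟨⟨Λ, ?_⟩, ?_⟩, ?_, ?_, ?_, ?_, ?_, ?_, ?_, ?_⟩
    · intro t ht
      have ht := mem_timeInterval_top.1 ht
      rw [abs_of_pos (hlam.trans_le (hlam_le _ (hΘn t ht)))]
      exact hle_Λ _ (hΘn t ht)
    · have hC : 0 ≤ p.ζ * (2 * e.N) := by positivity
      refine ⟨⟨p.ζ * (2 * e.N), hC⟩, LipschitzOnWith.of_dist_le_mul fun x _ y _ => ?_⟩
      rw [Real.dist_eq, Real.dist_eq]
      have h1 := convex_univ.norm_image_sub_le_of_norm_hasDerivWithin_le (f := Θ)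
        (C := p.ζ * (2 * e.N)) (fun t _ => (hΘd t).hasDerivWithinAt)
        (fun t _ => by
          have h2 := hbx (max (Θ t) 0) (le_max_right _ _)
          have h3 : 0 ≤ e.screw k₁ (l (max (Θ t) 0)) := by linarith [h2.2.2.2.1]
          rw [Real.norm_of_nonneg (by positivity)]
          exact mul_le_mul_of_nonneg_left h2.2.2.2.2 hζ.le) (mem_univ y) (mem_univ x)
      rw [Real.norm_eq_abs, Real.norm_eq_abs] at h1
      have h2 := H.lip_l (Θ x) (Θ y)
      have h3 := abs_nonneg (Θ x - Θ y)
      show |l (Θ x) - l (Θ y)| ≤ p.ζ * (2 * e.N) * |x - y|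
      linarith
    · intro t₀ ht₀
      have hac : Continuous fun t => l (Θ (max t 0)) := by fun_prop
      have hbc : Continuous fun t => Θ (max t 0) := by fun_prop
      exact H.tendsto_distSq hμ hl₀ (fun t => hlam.trans_le (hlam_le _ (hmaxn t)))
        (hlam.trans_le (hlam_le _ (hmaxn t₀))) hf (hf t₀)
        ((hac.tendsto t₀).mono_left nhdsWithin_le_nhds)
        ((hbc.tendsto t₀).mono_left nhdsWithin_le_nhds)
    · intro t ht
      have ht := mem_timeInterval_top.1 ht
      have h1 := hbx (Θ t) (hΘn t ht)
      refine ⟨h1.1, (hscrew t ht).ne', ?_⟩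
      rw [hval1 t ht]
      exact h1.2.1.ne
    · intro t ht
      have ht := mem_timeInterval_top.1 ht
      exact (feedback_iff hk).2 ⟨(hbx (Θ t) (hΘn t ht)).2.2.1, rfl, rfl⟩
    · simp only [hΘ0, hl0]
    · intro t _ ht
      exact hlder t ht.le
    · intro x hx
      rw [hval 0 le_rfl, hΘ0, hl0, sub_zero, H.G_nonneg _ (mul_nonneg hl₀.le hx.1.le),
        mul_div_cancel_left₀ x hl₀.ne', f₀.ext_of_mem (Ioo_subset_Icc_self hx)]
    · intro t _ ht x _
      -- The inner derivative is `-(ζ N - x l')`, which is `-l` times the transport speed and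
      -- cancels the factor `l` in the space derivative.
      have h1 : HasDerivAt (fun t => l (Θ t) * x - Θ t)
          (p.vel (l (Θ t)) (e.screw k₁ (l (Θ t))) ((f t).val 1) * x
            - p.ζ * e.screw k₁ (l (Θ t))) t :=
        ((hlder t ht.le).mul_const x).sub (hΘd' t ht.le)
      have h2 := HasDerivAt.comp (h := fun t => l (Θ t) * x - Θ t) t
        (H.deriv_G (l (Θ t) * x - Θ t)) h1
      refine ⟨_, h2.congr_of_eventuallyEq ?_, ?_⟩
      · filter_upwards [lt_mem_nhds ht] with τ hτ
        exact hval τ hτ.le x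
      · have h3 : l (Θ t) ≠ 0 := (hlam.trans_le (hlam_le _ (hΘn t ht.le))).ne'
        rw [(hf t).2.1, max_eq_left ht.le]
        simp only [Params.speed]
        field_simp
        ring
    · intro t _ ht
      rw [hval t ht.le, mul_zero, zero_sub, H.G_neg _ (hΘn t ht.le), hh,
        inflow_div hk (hbx (Θ t) (hΘn t ht.le)).2.2.1]
  · intro t ht
    have hs := hΘn t ht
    have hft := hf t
    rw [max_eq_left ht] at hft
    have h1 := H.distSq_const_le (Λ := Λ) hμ hK.le hm0 (by rwa [hfe]) b2 b4 hlam
      (hlam_le _ hs) hll (hle_Λ _ hs) (hlsub _ hs) hft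
    rw [hfe] at h1
    obtain ⟨E, hE⟩ : ∃ E, E = m * Real.exp (μ * (Λ - Θ t)) := ⟨_, rfl⟩
    rw [← hE] at h1
    have h2 : (l (Θ t) - e.l) ^ 2 ≤ K ^ 2 * E ^ 2 := by
      have h3 := H.l_decay (Θ t) hs
      rw [hle] at h3
      have h4 : |l (Θ t) - e.l| ≤ K * E := by
        refine h3.trans (mul_le_mul_of_nonneg_left ?_ hK.le)
        rw [hE]
        refine mul_le_mul_of_nonneg_left (Real.exp_le_exp.2 ?_) hm0
        have := mul_pos hμ hΛ
        linarith
      have h5 := pow_le_pow_left₀ (abs_nonneg _) h4 2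
      rw [sq_abs] at h5
      linarith
    -- `Θ t` grows at least like `ζ * (N_e / 2) * t`; squaring the exponential turns this into the
    -- rate `μ * ζ * N_e`.
    have h6 : E ^ 2 ≤ c ^ 2 * Real.exp (2 * (μ * Λ)) * Real.exp (-(μ * (p.ζ * e.N)) * t)
        * e.deviation l₀ f₀ := by
      have h7 : m ^ 2 = c ^ 2 * e.deviation l₀ f₀ := by
        rw [hm, mul_pow, Real.sq_sqrt (e.deviation_nonneg _ _)]
      have h8 : Real.exp (μ * (Λ - Θ t)) ^ 2
          ≤ Real.exp (2 * (μ * Λ)) * Real.exp (-(μ * (p.ζ * e.N)) * t) := by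
        rw [← Real.exp_nat_mul, ← Real.exp_add]
        apply Real.exp_le_exp.2
        have := mul_le_mul_of_nonneg_left (hΘc t ht) hμ.le
        push_cast
        linarith
      rw [hE, mul_pow, h7]
      have := mul_le_mul_of_nonneg_left h8
        (mul_nonneg (sq_nonneg c) (e.deviation_nonneg l₀ f₀))
      linarith
    have h9 : e.deviation (l (Θ t)) (f t) ≤ B * E ^ 2 := by
      rw [deviation, sq_abs, hB]
      linarith
    refine h9.trans ((mul_le_mul_of_nonneg_left h6 hB0.le).trans (le_of_eq ?_))
    ring
  · intro t ht
    refine ⟨hscrew t ht, ?_⟩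
    show p.vel (l (Θ t)) (e.screw k₁ (l (Θ t))) ((f t).val 1) < p.ζ * e.screw k₁ (l (Θ t))
    rw [hvel t ht]
    -- The velocity is `ζ N` times `R`, and `R ≤ 1 / 2 < 1`.
    have h1 := (abs_le.1 (D.R_bound _ _ (H.l_box _ (hΘn t ht)) (H.G_box _ (hΘn t ht)))).2
    have h2 := mul_pos hζ (hscrew t ht)
    nlinarith

end Equilibrium

/-! ### Uniqueness -/

theorem mem_timeInterval_of_le {T : EReal} {s t : ℝ} (ht : t ∈ timeInterval T) (hs : 0 ≤ s)
    (hst : s ≤ t) : s ∈ timeInterval T :=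
  ⟨hs, lt_of_le_of_lt (EReal.coe_le_coe_iff.2 hst) ht.2⟩

theorem exists_gt_mem_timeInterval {T : EReal} {t : ℝ} (ht : t ∈ timeInterval T) :
    ∃ t', t < t' ∧ t' ∈ timeInterval T := by
  obtain ⟨t', h1, h2⟩ := EReal.lt_iff_exists_real_btwn.1 ht.2
  have h3 : t < t' := EReal.coe_lt_coe_iff.1 h1
  exact ⟨t', h3, ht.1.trans h3.le, h2⟩

theorem mem_nhds_timeInterval {T : EReal} {t : ℝ} (ht : t ∈ timeInterval T) (h0 : 0 < t) :
    timeInterval T ∈ 𝓝 t := by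
  obtain ⟨t', h1, h2⟩ := exists_gt_mem_timeInterval ht
  filter_upwards [Ioo_mem_nhds h0 h1] with s hs
  exact mem_timeInterval_of_le h2 hs.1.le hs.2.le

namespace ContinuousInH2

variable {I : Set ℝ} {f : ℝ → H2}

theorem tendsto_sqrt (h : ContinuousInH2 I f) {t : ℝ} (ht : t ∈ I) :
    Tendsto (fun s => √(2 * (f s).distSq (f t))) (𝓝[I] t) (𝓝 0) := by
  have := ((h t ht).const_mul 2).sqrt
  simpa using this

/-- Convergence in `H²` is uniform on `[0,1]` by the Sobolev inequality, which gives joint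
continuity. -/
theorem continuousOn_val (h : ContinuousInH2 I f) :
    ContinuousOn (fun q : ℝ × ℝ => (f q.1).val q.2) (I ×ˢ Icc 0 1) := by
  rintro ⟨t, x⟩ ⟨ht, hx⟩
  have h1 : Tendsto (fun q : ℝ × ℝ => √(2 * (f q.1).distSq (f t)))
      (𝓝[I ×ˢ Icc 0 1] (t, x)) (𝓝 0) := by
    refine (h.tendsto_sqrt ht).comp ?_
    rw [nhdsWithin_prod_eq]
    exact tendsto_fst
  have h2 : Tendsto (fun q : ℝ × ℝ => (f t).val q.2) (𝓝[I ×ˢ Icc 0 1] (t, x))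
      (𝓝 ((f t).val x)) := by
    refine Tendsto.comp ((f t).continuousOn_val x hx) ?_
    rw [nhdsWithin_prod_eq]
    exact tendsto_snd
  have h3 : Tendsto (fun q : ℝ × ℝ => (f q.1).val q.2 - (f t).val q.2)
      (𝓝[I ×ˢ Icc 0 1] (t, x)) (𝓝 0) := by
    refine squeeze_zero_norm' ?_ h1
    filter_upwards [self_mem_nhdsWithin] with q hq
    exact Real.abs_le_sqrt ((f q.1).sq_val_sub_le (f t) hq.2)
  have := h3.add h2
  simpa [ContinuousWithinAt] using this

theorem continuousOn_d1 (h : ContinuousInH2 I f) :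
    ContinuousOn (fun q : ℝ × ℝ => (f q.1).d1 q.2) (I ×ˢ Icc 0 1) := by
  rintro ⟨t, x⟩ ⟨ht, hx⟩
  have h1 : Tendsto (fun q : ℝ × ℝ => √(2 * (f q.1).distSq (f t)))
      (𝓝[I ×ˢ Icc 0 1] (t, x)) (𝓝 0) := by
    refine (h.tendsto_sqrt ht).comp ?_
    rw [nhdsWithin_prod_eq]
    exact tendsto_fst
  have h2 : Tendsto (fun q : ℝ × ℝ => (f t).d1 q.2) (𝓝[I ×ˢ Icc 0 1] (t, x))
      (𝓝 ((f t).d1 x)) := by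
    refine Tendsto.comp ((f t).continuousOn_d1 x hx) ?_
    rw [nhdsWithin_prod_eq]
    exact tendsto_snd
  have h3 : Tendsto (fun q : ℝ × ℝ => (f q.1).d1 q.2 - (f t).d1 q.2)
      (𝓝[I ×ˢ Icc 0 1] (t, x)) (𝓝 0) := by
    refine squeeze_zero_norm' ?_ h1
    filter_upwards [self_mem_nhdsWithin] with q hq
    exact Real.abs_le_sqrt ((f q.1).sq_d1_sub_le (f t) hq.2)
  have := h3.add h2
  simpa [ContinuousWithinAt] using this

theorem continuousOn_val_apply (h : ContinuousInH2 I f) {x : ℝ} (hx : x ∈ Icc (0 : ℝ) 1) :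
    ContinuousOn (fun t => (f t).val x) I :=
  h.continuousOn_val.comp (continuousOn_id.prodMk continuousOn_const) fun _ ht => ⟨ht, hx⟩

/-- The chain rule along a curve `X`. -/
theorem hasDerivAt_val_comp (h : ContinuousInH2 I f) {t ft X' : ℝ} {X : ℝ → ℝ} (hI : I ∈ 𝓝 t)
    (hX : X t ∈ Ioo (0 : ℝ) 1) (hXd : HasDerivAt X X' t)
    (hft : HasDerivAt (fun s => (f s).val (X t)) ft t) :
    HasDerivAt (fun s => (f s).val (X s)) (ft + (f t).d1 (X t) * X') t := by
  set d := (f t).d1 (X t) with hd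
  have hmain : HasDerivAt (fun s => (f s).val (X s) - (f s).val (X t)) (d * X') t := by
    have hlit : (fun s => (f s).val (X s) - (f s).val (X t) - d * (X s - X t))
        =o[𝓝 t] fun s => s - t := by
      refine Asymptotics.IsLittleO.trans_isBigO (g := fun s => X s - X t) ?_
        hXd.isBigO_sub
      rw [Asymptotics.isLittleO_iff]
      intro η hη
      have hc : ContinuousAt (fun q : ℝ × ℝ => (f q.1).d1 q.2) (t, X t) :=
        h.continuousOn_d1.continuousAt (prod_mem_nhds hI (Icc_mem_nhds hX.1 hX.2))
      have hev : ∀ᶠ q : ℝ × ℝ in 𝓝 (t, X t), |(f q.1).d1 q.2 - d| ≤ η ∧ q.2 ∈ Ioo (0 : ℝ) 1 := by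
        have h1 := hc.eventually (Metric.closedBall_mem_nhds _ hη)
        have h2 : ∀ᶠ q : ℝ × ℝ in 𝓝 (t, X t), q.2 ∈ Ioo (0 : ℝ) 1 :=
          (continuous_snd.tendsto (t, X t)).eventually (isOpen_Ioo.mem_nhds hX)
        filter_upwards [h1, h2] with q hq1 hq2
        exact ⟨hq1, hq2⟩
      rw [nhds_prod_eq] at hev
      obtain ⟨pa, ha, pb, hb, hab⟩ := eventually_prod_iff.1 hev
      obtain ⟨δ, hδ, hball⟩ := Metric.eventually_nhds_iff_ball.1 hb
      filter_upwards [ha, hXd.continuousAt.eventually (Metric.ball_mem_nhds _ hδ)] with s hs1 hs2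
      -- The time derivative is known only at fixed `x`, so the space increment is estimated at each
      -- frozen time `s` by the mean value inequality, with joint continuity of `d1` controlling the
      -- error uniformly.
      have := (convex_ball (X t) δ).norm_image_sub_le_of_norm_hasDerivWithin_le
        (f := fun y => (f s).val y - d * y) (f' := fun y => (f s).d1 y - d * 1) (C := η)
        (fun y hy => (((f s).hasDerivAt_val (hab hs1 (hball y hy)).2).sub
          ((hasDerivAt_id y).const_mul d)).hasDerivWithinAt)
        (fun y hy => by simpa using (hab hs1 (hball y hy)).1)
        (Metric.mem_ball_self hδ) hs2
      refine le_trans (le_of_eq ?_) this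
      congr 1
      ring
    rw [hasDerivAt_iff_isLittleO]
    have h2 := (hasDerivAt_iff_isLittleO.1 hXd).const_mul_left d
    refine (hlit.add h2).congr_left fun s => ?_
    simp only [smul_eq_mul, sub_self]
    ring
  have := hft.add hmain
  refine this.congr_of_eventuallyEq (Eventually.of_forall fun s => ?_)
  simp

end ContinuousInH2

/-! ### Characteristics of an arbitrary solution -/

namespace Equilibrium.IsSolution

variable {p : Params} {e : Equilibrium p} {k₁ k₂ l₀ : ℝ} {f₀ : H2} {T : EReal}
  {l : ℝ → ℝ} {f : ℝ → H2} {N Fi : ℝ → ℝ}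

theorem continuousOn_l (S : e.IsSolution k₁ k₂ l₀ f₀ T l f N Fi) :
    ContinuousOn l (timeInterval T) :=
  S.regular_l.2.choose_spec.continuousOn

theorem screw_eq (S : e.IsSolution k₁ k₂ l₀ f₀ T l f N Fi) (hk : 1 - k₁ * p.unitPress e.l ≠ 0)
    {t : ℝ} (ht : t ∈ timeInterval T) : 1 - k₁ * p.unitPress (l t) ≠ 0 ∧ N t = e.screw k₁ (l t) :=
  have h := (feedback_iff hk).1 (S.feedback t ht)
  ⟨h.1, h.2.1⟩

theorem continuousOn_N (S : e.IsSolution k₁ k₂ l₀ f₀ T l f N Fi)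
    (hk : 1 - k₁ * p.unitPress e.l ≠ 0) : ContinuousOn N (timeInterval T) := by
  have h : ContinuousOn (fun t => e.screw k₁ (l t)) (timeInterval T) := fun t ht =>
    ContinuousAt.comp_continuousWithinAt (g := e.screw k₁)
      (continuousAt_screw (S.admissible t ht).1.2 (S.screw_eq hk ht).1) (S.continuousOn_l t ht)
  exact h.congr fun t ht => (S.screw_eq hk ht).2

theorem continuousOn_vel (S : e.IsSolution k₁ k₂ l₀ f₀ T l f N Fi)
    (hk : 1 - k₁ * p.unitPress e.l ≠ 0) :
    ContinuousOn (fun t => p.vel (l t) (N t) ((f t).val 1)) (timeInterval T) := by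
  simp only [Params.vel_eq]
  refine (continuousOn_const.mul (S.continuousOn_N hk)).mul fun t ht => ?_
  have h1 := S.admissible t ht
  exact ContinuousAt.comp_continuousWithinAt (g := fun z : ℝ × ℝ => p.rate z.1 z.2)
    (f := fun t => (l t, (f t).val 1))
    (p.contDiffAt_rate (z := (l t, (f t).val 1)) h1.1.2 h1.2.2 (n := 1)).continuousAt
    ((S.continuousOn_l t ht).prodMk
      (S.regular_f.continuousOn_val_apply (right_mem_Icc.2 zero_le_one) t ht))

theorem boundary_eq (S : e.IsSolution k₁ k₂ l₀ f₀ T l f N Fi)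
    (hk : 1 - k₁ * p.unitPress e.l ≠ 0) {t : ℝ} (ht : t ∈ timeInterval T) (h0 : 0 < t) :
    (f t).val 0 = e.inlet k₁ k₂ (l t) := by
  obtain ⟨h1, h2, h3⟩ := (feedback_iff hk).1 (S.feedback t ht)
  rw [S.boundary t ht h0, h2, h3, inflow_div hk h1]

/-- The filling ratio is constant along characteristics. -/
theorem val_eq_of_characteristic (S : e.IsSolution k₁ k₂ l₀ f₀ T l f N Fi) {σ : ℝ → ℝ} {t₁ t₂ ξ : ℝ}
    (h0 : 0 ≤ t₁) (h12 : t₁ ≤ t₂) (ht₂ : t₂ ∈ timeInterval T) (hσ : ContinuousOn σ (Icc t₁ t₂))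
    (hσd : ∀ t ∈ Ioo t₁ t₂, HasDerivAt σ (p.ζ * N t) t)
    (hcl : ∀ t ∈ Icc t₁ t₂, 0 ≤ ξ + σ t ∧ ξ + σ t ≤ l t)
    (hop : ∀ t ∈ Ioo t₁ t₂, 0 < ξ + σ t ∧ ξ + σ t < l t) :
    (f t₁).val ((ξ + σ t₁) / l t₁) = (f t₂).val ((ξ + σ t₂) / l t₂) := by
  rcases h12.eq_or_lt with h | hlt
  · rw [h]
  have hI : ∀ t ∈ Icc t₁ t₂, t ∈ timeInterval T := fun t ht =>
    mem_timeInterval_of_le ht₂ (h0.trans ht.1) ht.2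
  have hpos : ∀ t ∈ Icc t₁ t₂, 0 < l t := fun t ht => (S.admissible t (hI t ht)).1.1
  have hXc : ContinuousOn (fun t => (ξ + σ t) / l t) (Icc t₁ t₂) :=
    (continuousOn_const.add hσ).div (S.continuousOn_l.mono hI) fun t ht => (hpos t ht).ne'
  have hwc : ContinuousOn (fun t => (f t).val ((ξ + σ t) / l t)) (Icc t₁ t₂) :=
    S.regular_f.continuousOn_val.comp (continuousOn_id.prodMk hXc) fun t ht =>
      ⟨hI t ht, div_nonneg (hcl t ht).1 (hpos t ht).le, (div_le_one (hpos t ht)).2 (hcl t ht).2⟩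
  have hwd : ∀ t ∈ Ioo t₁ t₂, HasDerivAt (fun t => (f t).val ((ξ + σ t) / l t)) 0 t := by
    intro t ht
    have htc := Ioo_subset_Icc_self ht
    have ht0 : 0 < t := h0.trans_lt ht.1
    have hl := hpos t htc
    have hX : (ξ + σ t) / l t ∈ Ioo (0 : ℝ) 1 :=
      ⟨div_pos (hop t ht).1 hl, (div_lt_one hl).2 (hop t ht).2⟩
    obtain ⟨ft, hft, heq⟩ := S.transport t (hI t htc) ht0 _ hX
    -- The curve `(ξ + σ) / l` moves at the transport speed. The equation is available only for `x`
    -- in the open interval, so the endpoints are reached by continuity.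
    have hXd := ((hσd t ht).const_add ξ).div (S.interface t (hI t htc) ht0) hl.ne'
    have := S.regular_f.hasDerivAt_val_comp (mem_nhds_timeInterval (hI t htc) ht0) hX hXd hft
    convert! this using 1
    rw [← heq, Params.speed]
    field_simp
    rfl
  obtain ⟨c, -, hc⟩ := exists_hasDerivAt_eq_slope _ (fun _ => 0) hlt hwc hwd
  rw [eq_comm, div_eq_zero_iff] at hc
  rcases hc with hc | hc
  · linarith
  · linarith

end Equilibrium.IsSolution

namespace Equilibrium

variable {p : Params} {e : Equilibrium p} {k₁ k₂ l₀ : ℝ} {f₀ : H2} {T : EReal}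
  {l : ℝ → ℝ} {f : ℝ → H2} {N Fi : ℝ → ℝ}

variable (e) in
/-- On `[t₀, t₁]` the solution is given by the characteristics `y ↦ y + σ` starting from the state
`u` at time `t₀`, in the coordinate `y = x l(t)`. -/
structure IsTransported (k₁ k₂ t₀ t₁ : ℝ) (u : ℝ → ℝ) (l : ℝ → ℝ) (f : ℝ → H2) (σ : ℝ → ℝ) :
    Prop where
  zero : σ t₀ = 0
  cont : ContinuousOn σ (Icc t₀ t₁)
  mono : StrictMonoOn σ (Icc t₀ t₁)
  cont_l : ContinuousOn l (Icc t₀ t₁)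
  deriv : ∀ t ∈ Ico t₀ t₁, HasDerivWithinAt σ (p.ζ * e.screw k₁ (l t)) (Ici t) t
  deriv_l : ∀ t ∈ Ico t₀ t₁, HasDerivWithinAt l
    (p.ζ * e.screw k₁ (l t) * p.rate (l t) (u ((l t - σ t) / l t₀))) (Ici t) t
  foot : ∀ t ∈ Icc t₀ t₁, (l t - σ t) / l t₀ ∈ Icc (0 : ℝ) 1
  foot_le : ∀ t ∈ Icc t₀ t₁, ∀ x ∈ Ioc (0 : ℝ) 1, 0 ≤ x * l t - σ t →
    (x * l t - σ t) / l t₀ ∈ Icc (0 : ℝ) 1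
  initial : ∀ t ∈ Ioc t₀ t₁, ∀ x ∈ Ioc (0 : ℝ) 1, 0 ≤ x * l t - σ t →
    (f t).val x = u ((x * l t - σ t) / l t₀)
  inflow : ∀ t ∈ Ioc t₀ t₁, ∀ x ∈ Ioc (0 : ℝ) 1, x * l t - σ t < 0 →
    ∃ r ∈ Ioo t₀ t, σ r = -(x * l t - σ t) ∧ (f t).val x = e.inlet k₁ k₂ (l r)
  boundary : ∀ t ∈ Ioc t₀ t₁, (f t).val 0 = e.inlet k₁ k₂ (l t)

/-- Where `N > 0` and `l' < ζ N`, `σ` increases and `l - σ` decreases for a short time. Followed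
backwards, a characteristic therefore cannot leave through `x = 1`: it ends either in the state at
`t₀` or at the inlet. -/
theorem IsSolution.exists_isTransported (S : e.IsSolution k₁ k₂ l₀ f₀ T l f N Fi)
    (hk : 1 - k₁ * p.unitPress e.l ≠ 0) {t₀ : ℝ} (ht₀ : t₀ ∈ timeInterval T) (hN : 0 < N t₀)
    (hv : p.vel (l t₀) (N t₀) ((f t₀).val 1) < p.ζ * N t₀) :
    ∃ t₁, t₀ < t₁ ∧ t₁ ∈ timeInterval T ∧
      ∃ σ, e.IsTransported k₁ k₂ t₀ t₁ (f t₀).val l f σ := by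
  have hζ := p.ζ_pos
  have h0 : 0 ≤ t₀ := ht₀.1
  obtain ⟨T₁, hT₁, hT₁mem⟩ := exists_gt_mem_timeInterval ht₀
  have hI : ∀ t ∈ Icc t₀ T₁, t ∈ timeInterval T := fun t ht =>
    mem_timeInterval_of_le hT₁mem (h0.trans ht.1) ht.2
  -- The constant extension of `N` makes `σ` differentiable from both sides, also at `t₀`.
  set n : ℝ → ℝ := IccExtend hT₁.le ((Icc t₀ T₁).domRestrict N) with hn
  have hnc : Continuous n :=
    (continuousOn_iff_continuous_domRestrict.1 ((S.continuousOn_N hk).mono hI)).Icc_extend'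
  have hnN : ∀ t ∈ Icc t₀ T₁, n t = N t := fun t ht => by
    rw [hn, IccExtend_of_mem _ _ ht, domRestrict_apply]
  set σ : ℝ → ℝ := fun t => ∫ r in t₀..t, p.ζ * n r with hσ
  have hσd : ∀ t, HasDerivAt σ (p.ζ * n t) t := fun t =>
    intervalIntegral.integral_hasDerivAt_right ((hnc.const_mul _).intervalIntegrable _ _)
      ((hnc.const_mul _).stronglyMeasurableAtFilter _ _) (hnc.const_mul _).continuousAt
  have hσ0 : σ t₀ = 0 := by simp [hσ]
  have hσc : Continuous σ := continuous_iff_continuousAt.2 fun t => (hσd t).continuousAt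
  have hl₀ : 0 < l t₀ := (S.admissible t₀ ht₀).1.1
  have hnear : ∀ᶠ t in 𝓝[Icc t₀ T₁] t₀, 0 < N t ∧
      p.vel (l t) (N t) ((f t).val 1) < p.ζ * N t ∧ 0 < l t - σ t := by
    have hmem : t₀ ∈ Icc t₀ T₁ := left_mem_Icc.2 hT₁.le
    have c1 := ((S.continuousOn_N hk).mono hI) t₀ hmem
    have c2 := ((S.continuousOn_vel hk).mono hI) t₀ hmem
    have c3 := (S.continuousOn_l.mono hI) t₀ hmem
    have e1 := c1.eventually (lt_mem_nhds hN)
    have e2 := (c2.sub (c1.const_mul p.ζ)).eventually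
      (gt_mem_nhds (show p.vel (l t₀) (N t₀) ((f t₀).val 1) - p.ζ * N t₀ < 0 by linarith))
    have e3 := (c3.sub hσc.continuousWithinAt).eventually
      (lt_mem_nhds (show 0 < l t₀ - σ t₀ by rw [hσ0]; linarith))
    filter_upwards [e1, e2, e3] with t a1 a2 a3
    exact ⟨a1, sub_neg.1 a2, a3⟩
  obtain ⟨t₁, ht₁, ht₁T, hgood⟩ : ∃ t₁, t₀ < t₁ ∧ t₁ ≤ T₁ ∧ ∀ t ∈ Icc t₀ t₁, 0 < N t ∧
      p.vel (l t) (N t) ((f t).val 1) < p.ζ * N t ∧ 0 < l t - σ t := by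
    rw [nhdsWithin_Icc_eq_nhdsGE hT₁] at hnear
    obtain ⟨b, hb, hsub⟩ := mem_nhdsGE_iff_exists_Icc_subset.1 hnear
    refine ⟨min b T₁, lt_min hb hT₁, min_le_right _ _, fun t ht => ?_⟩
    exact hsub ⟨ht.1, ht.2.trans (min_le_left _ _)⟩
  have hII : ∀ t ∈ Icc t₀ t₁, t ∈ timeInterval T := fun t ht => hI t ⟨ht.1, ht.2.trans ht₁T⟩
  have hσd' : ∀ t ∈ Icc t₀ t₁, HasDerivAt σ (p.ζ * N t) t := fun t ht => by
    have := hσd t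
    rwa [hnN t ⟨ht.1, ht.2.trans ht₁T⟩] at this
  have hlc : ContinuousOn l (Icc t₀ t₁) := S.continuousOn_l.mono hII
  have hld : ∀ t ∈ Ioc t₀ t₁, HasDerivAt l (p.vel (l t) (N t) ((f t).val 1)) t := fun t ht =>
    S.interface t (hII t (Ioc_subset_Icc_self ht)) (h0.trans_lt ht.1)
  have hmono : StrictMonoOn σ (Icc t₀ t₁) := by
    refine strictMonoOn_of_deriv_pos (convex_Icc _ _) hσc.continuousOn fun t ht => ?_
    have ht := interior_subset ht
    rw [(hσd' t ht).deriv]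
    exact mul_pos hζ (hgood t ht).1
  have hanti : StrictAntiOn (fun t => l t - σ t) (Icc t₀ t₁) := by
    refine strictAntiOn_of_deriv_neg (convex_Icc _ _) (hlc.sub hσc.continuousOn) fun t ht => ?_
    rw [interior_Icc] at ht
    have htc := Ioo_subset_Icc_self ht
    have hd : HasDerivAt (fun t => l t - σ t)
        (p.vel (l t) (N t) ((f t).val 1) - p.ζ * N t) t :=
      (hld t ⟨ht.1, ht.2.le⟩).sub (hσd' t htc)
    rw [hd.deriv]
    linarith [(hgood t htc).2.1]
  have hσpos : ∀ t ∈ Ioc t₀ t₁, 0 < σ t := fun t ht => by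
    have := hmono (left_mem_Icc.2 ht₁.le) (Ioc_subset_Icc_self ht) ht.1
    rwa [hσ0] at this
  have hfoot : ∀ t ∈ Icc t₀ t₁, ∀ x ∈ Ioc (0 : ℝ) 1, 0 ≤ x * l t - σ t →
      (x * l t - σ t) / l t₀ ∈ Icc (0 : ℝ) 1 := by
    intro t ht x hx h
    refine ⟨div_nonneg h hl₀.le, (div_le_one hl₀).2 ?_⟩
    have h1 := hanti.antitoneOn (left_mem_Icc.2 ht₁.le) ht ht.1
    have h2 := (S.admissible t (hII t ht)).1.1
    simp only [hσ0, sub_zero] at h1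
    nlinarith [hx.2]
  have hchar : ∀ t ∈ Ioc t₀ t₁, ∀ x ∈ Ioc (0 : ℝ) 1, 0 ≤ x * l t - σ t →
      (f t).val x = (f t₀).val ((x * l t - σ t) / l t₀) := by
    intro t ht x hx h
    have htc := Ioc_subset_Icc_self ht
    have hlt := (S.admissible t (hII t htc)).1.1
    have hsub : ∀ r ∈ Icc t₀ t, r ∈ Icc t₀ t₁ := fun r hr => ⟨hr.1, hr.2.trans ht.2⟩
    have hlow : ∀ r ∈ Icc t₀ t, 0 ≤ σ r := fun r hr => by
      have := hmono.monotoneOn (left_mem_Icc.2 ht₁.le) (hsub r hr) hr.1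
      rwa [hσ0] at this
    have hx1 : x * l t ≤ l t := by nlinarith [hx.2]
    have := S.val_eq_of_characteristic (ξ := x * l t - σ t) h0 ht.1.le (hII t htc)
      hσc.continuousOn (fun r hr => hσd' r (hsub r (Ioo_subset_Icc_self hr)))
      (fun r hr => ⟨by linarith [hlow r hr], by
        have : l t - σ t ≤ l r - σ r := hanti.antitoneOn (hsub r hr) htc hr.2
        linarith⟩)
      (fun r hr => ⟨by linarith [hσpos r ⟨hr.1, hr.2.le.trans ht.2⟩], by
        have : l t - σ t < l r - σ r := hanti (hsub r (Ioo_subset_Icc_self hr)) htc hr.2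
        linarith⟩)
    rw [hσ0, add_zero, sub_add_cancel, mul_div_cancel_right₀ x hlt.ne'] at this
    exact this.symm
  have htrace : ∀ t ∈ Icc t₀ t₁, (f t).val 1 = (f t₀).val ((l t - σ t) / l t₀) := by
    intro t ht
    rcases ht.1.eq_or_lt with h | h
    · rw [← h, hσ0, sub_zero, div_self hl₀.ne']
    · have := hchar t ⟨h, ht.2⟩ 1 ⟨one_pos, le_rfl⟩
      rw [one_mul] at this
      exact this (hgood t ht).2.2.le
  refine ⟨t₁, ht₁, hII t₁ (right_mem_Icc.2 ht₁.le), σ, ?_⟩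
  refine
    { zero := hσ0
      cont := hσc.continuousOn
      mono := hmono
      cont_l := hlc
      deriv := fun t ht => ?_
      deriv_l := fun t ht => ?_
      foot := fun t ht => ?_
      foot_le := hfoot
      initial := hchar
      inflow := fun t ht x hx h => ?_
      boundary := fun t ht => S.boundary_eq hk (hII t (Ioc_subset_Icc_self ht)) (h0.trans_lt ht.1) }
  · have htc := Ico_subset_Icc_self ht
    rw [← (S.screw_eq hk (hII t htc)).2]
    exact (hσd' t htc).hasDerivWithinAt
  · have htc := Ico_subset_Icc_self ht
    rw [← (S.screw_eq hk (hII t htc)).2, ← htrace t htc, ← Params.vel_eq]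
    rcases ht.1.eq_or_lt with h | h
    · subst h
      -- The interface equation is only assumed for positive times, so when `t₀ = 0` the right
      -- derivative is the limit of the derivatives.
      have hs : Ioo t₀ t₁ ∈ 𝓝[>] t₀ := Ioo_mem_nhdsGT ht₁
      refine hasDerivWithinAt_Ici_of_tendsto_deriv (s := Ioo t₀ t₁)
        (fun r hr => (hld r ⟨hr.1, hr.2.le⟩).differentiableAt.differentiableWithinAt)
        ((hlc t₀ htc).mono Ioo_subset_Icc_self) hs ?_
      have hc := ((S.continuousOn_vel hk).mono hII) t₀ htc
      have hc' : Tendsto (fun t => p.vel (l t) (N t) ((f t).val 1)) (𝓝[>] t₀)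
          (𝓝 (p.vel (l t₀) (N t₀) ((f t₀).val 1))) := by
        refine hc.tendsto.mono_left (nhdsWithin_le_of_mem ?_)
        exact mem_of_superset hs Ioo_subset_Icc_self
      refine hc'.congr' ?_
      filter_upwards [hs] with r hr
      rw [(hld r ⟨hr.1, hr.2.le⟩).deriv]
    · exact (hld t ⟨h, ht.2.le⟩).hasDerivWithinAt
  · have := hfoot t ht 1 ⟨one_pos, le_rfl⟩
    rw [one_mul] at this
    exact this (hgood t ht).2.2.le
  · have htc := Ioc_subset_Icc_self ht
    have hlt := (S.admissible t (hII t htc)).1.1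
    have hsub : ∀ r ∈ Icc t₀ t, r ∈ Icc t₀ t₁ := fun r hr => ⟨hr.1, hr.2.trans ht.2⟩
    -- `r` is the time at which the characteristic entered through `x = 0`.
    obtain ⟨r, hr, hσr⟩ : -(x * l t - σ t) ∈ σ '' Ioo t₀ t := by
      refine intermediate_value_Ioo ht.1.le hσc.continuousOn ⟨?_, ?_⟩
      · rw [hσ0]; linarith
      · have := mul_pos hx.1 hlt
        linarith
    refine ⟨r, hr, hσr, ?_⟩
    have hx1 : x * l t ≤ l t := by nlinarith [hx.2]
    have hrc := hsub r (Ioo_subset_Icc_self hr)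
    have hsub' : ∀ s ∈ Icc r t, s ∈ Icc t₀ t₁ := fun s hs => ⟨hrc.1.trans hs.1, hs.2.trans ht.2⟩
    have := S.val_eq_of_characteristic (ξ := x * l t - σ t) (h0.trans hrc.1) hr.2.le (hII t htc)
      hσc.continuousOn (fun s hs => hσd' s (hsub' s (Ioo_subset_Icc_self hs)))
      (fun s hs => ⟨by
        have := hmono.monotoneOn hrc (hsub' s hs) hs.1
        linarith, by
        have : l t - σ t ≤ l s - σ s := hanti.antitoneOn (hsub' s hs) htc hs.2
        linarith⟩)
      (fun s hs => ⟨by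
        have := hmono hrc (hsub' s (Ioo_subset_Icc_self hs)) hs.1
        linarith, by
        have : l t - σ t < l s - σ s := hanti (hsub' s (Ioo_subset_Icc_self hs)) htc hs.2
        linarith⟩)
    rw [hσr, add_neg_cancel, zero_div, sub_add_cancel, mul_div_cancel_right₀ x hlt.ne'] at this
    rw [← this, S.boundary_eq hk (hII r hrc) (h0.trans_lt hr.1)]

end Equilibrium

/-! ### Local uniqueness and continuation -/

namespace Equilibrium

variable {p : Params} {e : Equilibrium p} {k₁ k₂ : ℝ}

/-- The vector field governing the interface and the transported length. -/
def field (e : Equilibrium p) (k₁ lref : ℝ) (u : ℝ → ℝ) (z : ℝ × ℝ) : ℝ × ℝ :=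
  (p.ζ * e.screw k₁ z.1 * p.rate z.1 (u ((z.1 - z.2) / lref)), p.ζ * e.screw k₁ z.1)

theorem contDiffAt_field {lref : ℝ} {u : ℝ → ℝ} (hu : ContDiff ℝ 1 u) (hl : lref < p.L)
    (hl0 : lref ≠ 0) (hg : 1 - k₁ * p.unitPress lref ≠ 0) (hu1 : u 1 ≠ 1) :
    ContDiffAt ℝ 1 (e.field k₁ lref u) (lref, 0) := by
  have c1 : ContDiffAt ℝ 1 (fun z : ℝ × ℝ => p.ζ * e.screw k₁ z.1) (lref, 0) := by
    unfold screw
    refine contDiffAt_const.mul (contDiffAt_const.div ?_ hg)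
    exact contDiffAt_const.sub (contDiffAt_const.mul
      (ContDiffAt.comp (lref, (0 : ℝ)) (p.contDiffAt_unitPress hl) contDiffAt_fst))
  have c2 : ContDiffAt ℝ 1 (fun z : ℝ × ℝ => (z.1, u ((z.1 - z.2) / lref))) (lref, 0) :=
    contDiffAt_fst.prodMk (hu.contDiffAt.comp _
      ((contDiffAt_fst.sub contDiffAt_snd).div_const lref))
  have e1 : u ((lref - 0) / lref) = u 1 := by rw [sub_zero, div_self hl0]
  have c3 : ContDiffAt ℝ 1 (fun z : ℝ × ℝ => p.rate z.1 z.2)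
      ((fun z : ℝ × ℝ => (z.1, u ((z.1 - z.2) / lref))) (lref, 0)) :=
    p.contDiffAt_rate hl (by simp only; rwa [e1])
  have c4 : ContDiffAt ℝ 1 (fun z : ℝ × ℝ => p.rate z.1 (u ((z.1 - z.2) / lref))) (lref, 0) :=
    ContDiffAt.comp (g := fun z : ℝ × ℝ => p.rate z.1 z.2)
      (f := fun z : ℝ × ℝ => (z.1, u ((z.1 - z.2) / lref))) (lref, (0 : ℝ)) c3 c2
  exact (c1.mul c4).prodMk c1

/-- As long as the outlet characteristic starts in the common state `u`, the pair `(l, σ)` solves an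
ODE with a locally Lipschitz field. Once `l` and `σ` agree, the characteristic formulas determine
the filling ratio. -/
theorem IsTransported.eventually_eq {t₀ t₁ t₁' : ℝ} {u u' : H2} {l l' : ℝ → ℝ} {f f' : ℝ → H2}
    {σ σ' : ℝ → ℝ} (A : e.IsTransported k₁ k₂ t₀ t₁ u.val l f σ)
    (A' : e.IsTransported k₁ k₂ t₀ t₁' u'.val l' f' σ') (h₁ : t₀ < t₁) (h₁' : t₀ < t₁')
    (huu : ∀ x ∈ Icc (0 : ℝ) 1, u'.val x = u.val x) (hll : l' t₀ = l t₀)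
    (hl : l t₀ ∈ Ioo 0 p.L) (hg : 1 - k₁ * p.unitPress (l t₀) ≠ 0) (hu1 : u.val 1 ≠ 1) :
    ∀ᶠ t in 𝓝[>] t₀, l' t = l t ∧ ∀ x ∈ Icc (0 : ℝ) 1, (f' t).val x = (f t).val x := by
  have h1mem : (1 : ℝ) ∈ Icc (0 : ℝ) 1 := right_mem_Icc.2 zero_le_one
  obtain ⟨K, W, hW, hKW⟩ := (contDiffAt_field (e := e) u.contDiff_ext hl.2 hl.1.ne' hg
    (by rwa [u.ext_of_mem h1mem])).exists_lipschitzOnWith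
  have hev : ∀ᶠ t in 𝓝[≥] t₀, (l t, σ t) ∈ W ∧ (l' t, σ' t) ∈ W := by
    have c1 : Tendsto (fun t => (l t, σ t)) (𝓝[≥] t₀) (𝓝 (l t₀, 0)) := by
      rw [← A.zero, ← nhdsWithin_Icc_eq_nhdsGE h₁]
      exact (A.cont_l t₀ (left_mem_Icc.2 h₁.le)).prodMk (A.cont t₀ (left_mem_Icc.2 h₁.le))
    have c2 : Tendsto (fun t => (l' t, σ' t)) (𝓝[≥] t₀) (𝓝 (l t₀, 0)) := by
      rw [← A'.zero, ← hll, ← nhdsWithin_Icc_eq_nhdsGE h₁']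
      exact (A'.cont_l t₀ (left_mem_Icc.2 h₁'.le)).prodMk (A'.cont t₀ (left_mem_Icc.2 h₁'.le))
    exact (c1.eventually hW).and (c2.eventually hW)
  obtain ⟨b, hb, hsub⟩ := mem_nhdsGE_iff_exists_Icc_subset.1 hev
  obtain ⟨t₂, ht₂, ht₂b, ht₂1, ht₂1'⟩ : ∃ t₂, t₀ < t₂ ∧ t₂ ≤ b ∧ t₂ ≤ t₁ ∧ t₂ ≤ t₁' :=
    ⟨min b (min t₁ t₁'), lt_min hb (lt_min h₁ h₁'), min_le_left _ _,
      (min_le_right _ _).trans (min_le_left _ _), (min_le_right _ _).trans (min_le_right _ _)⟩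
  have i1 : Icc t₀ t₂ ⊆ Icc t₀ t₁ := Icc_subset_Icc_right ht₂1
  have i1' : Icc t₀ t₂ ⊆ Icc t₀ t₁' := Icc_subset_Icc_right ht₂1'
  have hode : EqOn (fun t => (l' t, σ' t)) (fun t => (l t, σ t)) (Icc t₀ t₂) := by
    refine ODE_solution_unique_of_mem_Icc_right (v := fun _ => e.field k₁ (l t₀) u.ext)
      (s := fun _ => W) (K := K) (fun _ _ => hKW) ((A'.cont_l.mono i1').prodMk (A'.cont.mono i1'))
      ?_ (fun t ht => (hsub ⟨ht.1, ht.2.le.trans ht₂b⟩).2)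
      ((A.cont_l.mono i1).prodMk (A.cont.mono i1)) ?_
      (fun t ht => (hsub ⟨ht.1, ht.2.le.trans ht₂b⟩).1) ?_
    · intro t ht
      have hf := A'.foot t ⟨ht.1, ht.2.le.trans ht₂1'⟩
      have := (A'.deriv_l t ⟨ht.1, ht.2.trans_le ht₂1'⟩).prodMk
        (A'.deriv t ⟨ht.1, ht.2.trans_le ht₂1'⟩)
      rw [huu _ hf, ← u.ext_of_mem hf, hll] at this
      exact this
    · intro t ht
      have hf := A.foot t ⟨ht.1, ht.2.le.trans ht₂1⟩
      have := (A.deriv_l t ⟨ht.1, ht.2.trans_le ht₂1⟩).prodMk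
        (A.deriv t ⟨ht.1, ht.2.trans_le ht₂1⟩)
      rw [← u.ext_of_mem hf] at this
      exact this
    · simp only [A.zero, A'.zero, hll]
  have hleq : ∀ t ∈ Icc t₀ t₂, l' t = l t := fun t ht => congrArg Prod.fst (hode ht)
  have hσeq : ∀ t ∈ Icc t₀ t₂, σ' t = σ t := fun t ht => congrArg Prod.snd (hode ht)
  filter_upwards [Ioo_mem_nhdsGT ht₂] with t ht
  have htc := Ioo_subset_Icc_self ht
  have hto : t ∈ Ioc t₀ t₁ := ⟨ht.1, ht.2.le.trans ht₂1⟩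
  have hto' : t ∈ Ioc t₀ t₁' := ⟨ht.1, ht.2.le.trans ht₂1'⟩
  refine ⟨hleq t htc, fun x hx => ?_⟩
  rcases hx.1.eq_or_lt with h | h
  · rw [← h, A.boundary t hto, A'.boundary t hto', hleq t htc]
  · have hx' : x ∈ Ioc (0 : ℝ) 1 := ⟨h, hx.2⟩
    by_cases hξ : 0 ≤ x * l t - σ t
    · have hξ' : 0 ≤ x * l' t - σ' t := by rwa [hleq t htc, hσeq t htc]
      rw [A.initial t hto x hx' hξ, A'.initial t hto' x hx' hξ', hleq t htc, hσeq t htc, hll,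
        huu _ (A.foot_le t (Ioc_subset_Icc_self hto) x hx' hξ)]
    · have hξ := not_le.1 hξ
      have hξ' : x * l' t - σ' t < 0 := by rwa [hleq t htc, hσeq t htc]
      obtain ⟨r, hr, hσr, hval⟩ := A.inflow t hto x hx' hξ
      obtain ⟨r', hr', hσr', hval'⟩ := A'.inflow t hto' x hx' hξ'
      have hrc : r ∈ Icc t₀ t₂ := ⟨hr.1.le, (hr.2.trans ht.2).le⟩
      have hrc' : r' ∈ Icc t₀ t₂ := ⟨hr'.1.le, (hr'.2.trans ht.2).le⟩
      -- The two entry times carry the same transported length, and `σ` is injective.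
      have hrr : r' = r := by
        apply A.mono.injOn (i1 hrc') (i1 hrc)
        rw [← hσeq r' hrc', hσr', hσr, hleq t htc, hσeq t htc]
      rw [hval, hval', hrr, hleq r hrc]

/-- Continuous induction on the closed set of agreement times. The strict outflow condition is
needed for one solution only: where the states agree, the other inherits it. -/
theorem IsSolution.eq_of_nonresonant {l₀ : ℝ} {f₀ : H2} {T : EReal} {l l' : ℝ → ℝ} {f f' : ℝ → H2}
    {N N' Fi Fi' : ℝ → ℝ} (hk : 1 - k₁ * p.unitPress e.l ≠ 0)
    (S : e.IsSolution k₁ k₂ l₀ f₀ ⊤ l f N Fi)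
    (hS : ∀ t : ℝ, 0 ≤ t → 0 < N t ∧ p.vel (l t) (N t) ((f t).val 1) < p.ζ * N t)
    (S' : e.IsSolution k₁ k₂ l₀ f₀ T l' f' N' Fi') {t : ℝ} (ht : t ∈ timeInterval T) :
    l' t = l t ∧ ∀ x ∈ Icc (0 : ℝ) 1, (f' t).val x = (f t).val x := by
  have hI : ∀ r ∈ Icc 0 t, r ∈ timeInterval T := fun r hr => mem_timeInterval_of_le ht hr.1 hr.2
  have hI' : ∀ r ∈ Icc 0 t, r ∈ timeInterval ⊤ := fun r hr => mem_timeInterval_top.2 hr.1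
  set s : Set ℝ := {r | l' r = l r ∧ ∀ x ∈ Icc (0 : ℝ) 1, (f' r).val x = (f r).val x} with hs
  have hclosed : IsClosed (s ∩ Icc 0 t) := by
    have h1 : IsClosed (Icc 0 t ∩ (fun r => l' r - l r) ⁻¹' {0}) :=
      ((S'.continuousOn_l.mono hI).sub (S.continuousOn_l.mono hI')).preimage_isClosed_of_isClosed
        isClosed_Icc isClosed_singleton
    have h2 : IsClosed (⋂ x : Icc (0 : ℝ) 1,
        Icc 0 t ∩ (fun r => (f' r).val x - (f r).val x) ⁻¹' {0}) := by
      refine isClosed_iInter fun x => ?_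
      exact (((S'.regular_f.continuousOn_val_apply x.2).mono hI).sub
        ((S.regular_f.continuousOn_val_apply x.2).mono hI')).preimage_isClosed_of_isClosed
        isClosed_Icc isClosed_singleton
    convert! h1.inter h2 using 1
    ext r
    simp only [hs, mem_inter_iff, mem_ofPred_eq, mem_iInter, mem_preimage, mem_singleton_iff,
      sub_eq_zero, Subtype.forall]
    constructor
    · rintro ⟨⟨h3, h4⟩, h5⟩
      exact ⟨⟨h5, h3⟩, fun x hx => ⟨h5, h4 x hx⟩⟩
    · rintro ⟨⟨h5, h3⟩, h4⟩
      exact ⟨⟨h3, fun x hx => (h4 x hx).2⟩, h5⟩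
  have hzero : (0 : ℝ) ∈ s := by
    refine ⟨by rw [S.initial_l, S'.initial_l], ?_⟩
    have hEq : EqOn (f' 0).val (f 0).val (Ioo 0 1) := fun x hx => by
      rw [S.initial_f x hx, S'.initial_f x hx]
    refine hEq.of_subset_closure (f' 0).continuousOn_val (f 0).continuousOn_val
      Ioo_subset_Icc_self ?_
    rw [closure_Ioo (by norm_num)]
  have hstep : ∀ r ∈ s ∩ Ico 0 t, s ∈ 𝓝[>] r := by
    rintro r ⟨⟨hlr, hfr⟩, hr⟩
    have hrc := Ico_subset_Icc_self hr
    have hN : N' r = N r := by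
      rw [(S.screw_eq hk (hI' r hrc)).2, (S'.screw_eq hk (hI r hrc)).2, hlr]
    obtain ⟨h1, h2⟩ := hS r hr.1
    obtain ⟨t₁, ht₁, -, σ, A⟩ := S.exists_isTransported hk (hI' r hrc) h1 h2
    obtain ⟨t₁', ht₁', -, σ', A'⟩ := S'.exists_isTransported hk (hI r hrc) (by rwa [hN])
      (by rwa [hN, hlr, hfr 1 (right_mem_Icc.2 zero_le_one)])
    have hadm := S.admissible r (hI' r hrc)
    exact A.eventually_eq A' ht₁ ht₁' hfr hlr hadm.1 (S.screw_eq hk (hI' r hrc)).1 hadm.2.2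
  exact hclosed.Icc_subset_of_forall_mem_nhdsWithin hzero hstep ⟨ht.1, le_rfl⟩

end Equilibrium

end Extruder

end

theorem theorem1 (p : Extruder.Params) (e : Extruder.Equilibrium p) (k₁ k₂ : ℝ)
    (hk : 1 - k₁ * e.b₂ ≠ 0)
    (hk₁ : e.a₁ + k₁ * e.a₂ * e.b₁ / (1 - k₁ * e.b₂) < 0)
    (hk₂ : |e.a₃ * e.b₁ * (k₂ - e.f * p.ρ * p.V * k₁) / (p.ρ * p.V * e.N * (1 - k₁ * e.b₂))| <
      |e.a₁ + k₁ * e.a₂ * e.b₁ / (1 - k₁ * e.b₂)|) :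
    ∃ ε : ℝ, 0 < ε ∧ ∃ M : ℝ, 0 < M ∧ ∃ ω : ℝ, 0 < ω ∧ ∀ (l₀ : ℝ) (f₀ : Extruder.H2),
      e.deviation l₀ f₀ ≤ ε → e.Compatible k₁ k₂ l₀ f₀ →
      ∃ (l : ℝ → ℝ) (f : ℝ → Extruder.H2) (N Fi : ℝ → ℝ),
        e.IsSolution k₁ k₂ l₀ f₀ ⊤ l f N Fi ∧
        (∀ t : ℝ, 0 ≤ t →
          e.deviation (l t) (f t) ≤ M * Real.exp (-ω * t) * e.deviation l₀ f₀) ∧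
        ∀ (T : EReal) (l' : ℝ → ℝ) (f' : ℝ → Extruder.H2) (N' Fi' : ℝ → ℝ),
          e.IsSolution k₁ k₂ l₀ f₀ T l' f' N' Fi' →
          ∀ t ∈ Extruder.timeInterval T,
            l' t = l t ∧ ∀ x ∈ Set.Icc (0 : ℝ) 1, (f' t).val x = (f t).val x := by
  obtain ⟨ε, hε, M, hM, γ, hγ, h⟩ := e.exists_solution hk hk₁ hk₂
  refine ⟨ε, hε, M, hM, γ, hγ, fun l₀ f₀ hdev hcomp => ?_⟩
  obtain ⟨l, f, N, Fi, hsol, hdecay, hspeed⟩ := h l₀ f₀ hdev hcomp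
  rw [e.b₂_eq] at hk
  exact ⟨l, f, N, Fi, hsol, hdecay, fun T l' f' N' Fi' hsol' t ht =>
    Extruder.Equilibrium.IsSolution.eq_of_nonresonant hk hsol hspeed hsol' ht⟩
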